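/- Cubes $Q\subset\mathbb R^n$ have sides parallel to the axes; a weight is a non-negative locally integrable function $\sigma$ on $\mathbb{R}^n$, also regarded as the measure $\sigma(x)\,dx$, and $\langle\sigma\rangle_Q=\sigma(Q)/|Q|$. For $0<\alpha<n$ put $$M_\alpha f(x)=\sup_{Q\ni x}\frac{1}{|Q|^{1-\alpha/n}}\int_Q|f|,\qquad I_\alpha f(x)=\int_{\mathbb R^n}\frac{f(y)}{|y-x|^{n-\alpha}}\,dy,\qquad I_\alpha^\sigma f=I_\alpha(\sigma f).$$ Let $1<p\le q<\infty$, with conjugate exponents $p',q'$. Let $\varepsilon_q,\varepsilon_{p'}:(0,\infty)\to(0,\infty)$ be bounded below by positive constants, nonincreasing on $(0,1)$, nondecreasing on $(1,\infty)$, with $$\int_0^\infty\frac{dt}{t\,\varepsilon_q(t)^{1/q}}<\infty,\qquad \int_0^\infty\frac{dt}{t\,\varepsilon_{p'}(t)^{1/p'}}<\infty .$$ For weights $\sigma,w$ define $$\varrho_\sigma^{\alpha,p,q}(Q)=\frac{\int_Q M_\alpha(\mathbf 1_Q\sigma)^{q/p}\,dx}{\sigma(Q)^{q/p}},\qquad [[\sigma,w]]_{\alpha,p,q}=\sup_{Q}\left(|Q|^{\alpha/n}\langle\sigma\rangle_Q\right)^{q/p'}\langle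 w\rangle_Q\,\varrho_\sigma^{\alpha,p,q}(Q)\,\varepsilon_q\!\left(\varrho_\sigma^{\alpha,p,q}(Q)\right),$$ where the supremum is over all cubes; cubes with $\sigma(Q)=0$ or $w(Q)=0$ contribute $0$, and $t\,\varepsilon(t)$ is read as $\infty$ at $t=\infty$. Let $[[w,\sigma]]_{\alpha,q',p'}$ be defined in the same way, with $(\sigma,w,p,q,\varepsilon_q)$ replaced by $(w,\sigma,q',p',\varepsilon_{p'})$; that is, $$[[w,\sigma]]_{\alpha,q',p'}=\sup_{Q}\left(|Q|^{\alpha/n}\langle w\rangle_Q\right)^{p'/q}\langle \sigma\rangle_Q\,\varrho_w^{\alpha,q',p'}(Q)\,\varepsilon_{p'}\!\left(\varrho_w^{\alpha,q',p'}(Q)\right).$$ Then there are finite constants $C_{\alpha,n}$, depending only on $\alpha$ and $n$, and $K$, depending only on $p,q,\varepsilon_q,\varepsilon_{p'}$, such that for all weights $\sigma,w$ on $\mathbb R^n$ $$\left\|I_\alpha^\sigma:L^p(\sigma)\to L^q(w)\right\|\le K\,C_{\alpha,n}\left([[\sigma,w]]_{\alpha,p,q}^{1/q}+[[w,\sigma]]_{\alpha,q',p'}^{1/p'}\right).$$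 In particular, if the right-hand side is finite, then for every $f\in L^p(\sigma)$ the integral $I_\alpha(\sigma f)(x)$ converges absolutely for $w$-almost every $x$. -/

import Mathlib

open MeasureTheory Set
open scoped ENNReal NNReal

noncomputable section

namespace SepBump

variable {n : ℕ}

/-- The axis-parallel half-open cube with corner `a` and side length `l`. -/
def cube (a : EuclideanSpace ℝ (Fin n)) (l : ℝ) : Set (EuclideanSpace ℝ (Fin n)) :=
  {x | ∀ i, x i ∈ Ico (a i) (a i + l)}

/-- A weight: a non-negative, locally integrable function. -/
structure IsWeight (σ : EuclideanSpace ℝ (Fin n) → ℝ) : Prop where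
  nonneg : ∀ x, 0 ≤ σ x
  locallyIntegrable : LocallyIntegrable σ volume

/-- The measure `σ(x) dx`. -/
def weightMeasure (σ : EuclideanSpace ℝ (Fin n) → ℝ) : Measure (EuclideanSpace ℝ (Fin n)) :=
  volume.withDensity (fun x => ENNReal.ofReal (σ x))

/-- The average `⟨σ⟩_Q = σ(Q) / |Q|`. -/
def average (σ : EuclideanSpace ℝ (Fin n) → ℝ) (Q : Set (EuclideanSpace ℝ (Fin n))) : ℝ≥0∞ :=
  weightMeasure σ Q / volume Q

/-- The fractional maximal function: the supremum over all cubes `Q ∋ x` of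
`|Q|^(α/n - 1) ∫_Q |f|`. -/
def fracMax (α : ℝ) (f : EuclideanSpace ℝ (Fin n) → ℝ) (x : EuclideanSpace ℝ (Fin n)) : ℝ≥0∞ :=
  ⨆ (a : EuclideanSpace ℝ (Fin n)) (l : ℝ) (_ : 0 < l) (_ : x ∈ cube a l),
    (volume (cube a l)) ^ (α / n - 1) * ∫⁻ y in cube a l, ‖f y‖ₑ

/-- `ϱ_σ^{α,p,q}(Q) = ∫_Q M_α(1_Q σ)^{q/p} dx / σ(Q)^{q/p}`. -/
def varrho (α p q : ℝ) (σ : EuclideanSpace ℝ (Fin n) → ℝ)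
    (Q : Set (EuclideanSpace ℝ (Fin n))) : ℝ≥0∞ :=
  (∫⁻ x in Q, fracMax α (Q.indicator σ) x ^ (q / p)) / weightMeasure σ Q ^ (q / p)

/-- `t ↦ t ε(t)` on `[0, ∞]`, with value `0` at `0` and `∞` at `∞`. -/
def timesBump (ε : ℝ → ℝ) (t : ℝ≥0∞) : ℝ≥0∞ :=
  if t = ⊤ then ⊤ else t * ENNReal.ofReal (ε t.toReal)

/-- The separated bump `[[σ, w]]_{α,p,q}` formed with the function `ε`. In the products
`0 * ∞ = 0`, so that cubes with `σ(Q) = 0` or `w(Q) = 0` contribute `0`. -/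
def sepBump (α p q : ℝ) (ε : ℝ → ℝ) (σ w : EuclideanSpace ℝ (Fin n) → ℝ) : ℝ≥0∞ :=
  ⨆ (a : EuclideanSpace ℝ (Fin n)) (l : ℝ) (_ : 0 < l),
    ((volume (cube a l)) ^ (α / n) * average σ (cube a l)) ^ (q / p.conjExponent)
      * average w (cube a l) * timesBump ε (varrho α p q σ (cube a l))

/-- The integrand of the fractional integral. -/
def fracKernel (α : ℝ) (f : EuclideanSpace ℝ (Fin n) → ℂ) (x y : EuclideanSpace ℝ (Fin n)) : ℂ :=
  f y / ((‖y - x‖ ^ ((n : ℝ) - α) : ℝ) : ℂ)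

/-- The fractional integral `I_α f(x) = ∫ f(y) / |y - x|^(n - α) dy`. -/
def fracInt (α : ℝ) (f : EuclideanSpace ℝ (Fin n) → ℂ) (x : EuclideanSpace ℝ (Fin n)) : ℂ :=
  ∫ y, fracKernel α f x y

/-- `I_α^σ : f ↦ I_α(σ f)` is a bounded operator from `L^p(σ)` to `L^q(w)` with bound `N`:
for every `f ∈ L^p(σ)` the integral `I_α(σ f)(x)` converges absolutely for `w`-a.e. `x`,
the function it defines is `w`-measurable, and its `L^q(w)` norm is at most `N ‖f‖_{L^p(σ)}`. -/
def IsBound (α p q : ℝ) (σ w : EuclideanSpace ℝ (Fin n) → ℝ) (N : ℝ≥0∞) : Prop :=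
  ∀ f : EuclideanSpace ℝ (Fin n) → ℂ, MemLp f (ENNReal.ofReal p) (weightMeasure σ) →
    (∀ᵐ x ∂(weightMeasure w), Integrable (fracKernel α (fun y => (σ y : ℂ) * f y) x) volume) ∧
    AEStronglyMeasurable (fracInt α (fun y => (σ y : ℂ) * f y)) (weightMeasure w) ∧
    eLpNorm (fracInt α (fun y => (σ y : ℂ) * f y)) (ENNReal.ofReal q) (weightMeasure w) ≤
      N * eLpNorm f (ENNReal.ofReal p) (weightMeasure σ)

/-- The operator norm `‖I_α^σ : L^p(σ) → L^q(w)‖ ∈ [0, ∞]` (it is `∞` when there is no bound). -/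
def fracIntNorm (α p q : ℝ) (σ w : EuclideanSpace ℝ (Fin n) → ℝ) : ℝ≥0∞ :=
  sInf {N : ℝ≥0∞ | IsBound α p q σ w N}

/-- The admissible functions `ε` on `(0, ∞)` for the exponent `s`: bounded below by a positive
constant, nonincreasing on `(0,1)`, nondecreasing on `(1,∞)`, and
`∫_0^∞ dt / (t ε(t)^(1/s)) < ∞`. -/
structure IsBumpFunction (s : ℝ) (ε : ℝ → ℝ) : Prop where
  pos : ∃ m : ℝ, 0 < m ∧ ∀ t, 0 < t → m ≤ ε t
  antitoneOn : AntitoneOn ε (Ioo 0 1)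
  monotoneOn : MonotoneOn ε (Ioi 1)
  integrableOn : IntegrableOn (fun t : ℝ => 1 / (t * ε t ^ (1 / s))) (Ioi 0) volume

end SepBump

end

/-! The kernel |y - x|^(α - n) is dominated by a constant times a sum, over 2^n shifted dyadic
grids, of the kernels |Q|^(α/n - 1) 1_Q(x) 1_Q(y) (`kernel_le_dyadic`). By Fatou's lemma it
therefore suffices to bound positive dyadic operators over finite families of cubes, uniformly in
the family. Such families are laminar: two members are nested or disjoint.

For these operators Sawyer's testing principle holds (`dyadicOp_bound`): it is enough to control the
operator and its adjoint, localized to a cube, on the indicator of that cube. By duality the object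
is a bilinear form in f and g. The cubes are split according to which of ⟨f⟩^p σ(Q) and ⟨g⟩^q' w(Q)
is larger. In each half (`bilinear_half`) stopping cubes are built for the dominant function only;
testing is applied on each stopping cube, and the pieces are summed by a Carleson embedding and
Hölder's inequality, using p' ≥ q'.

The testing condition follows from the bump (`testing_of_bump`). The cubes are sliced by ϱ(Q) ≈ 2^r.
Within a slice the sum of τ_Q σ(Q) 1_Q, τ_Q = |Q|^(α/n - 1), reduces to the cubes at which the
density σ(Q)/|Q| sets a record, and these are sparse. `chain_sum_le` distributes the q-th power of
the sum as a power q/p' on denser cubes and a power q/p on the larger cubes containing them. The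
bump condition absorbs the first power together with w, at the price of a factor 2^(-r)/ε;
sparseness and the definition of ϱ bound the second by 2^r σ(R)^(q/p). The powers of 2 cancel, so
the slice costs ε^(-1/q) at arguments near 2^r, and the integral condition on ε makes this summable
in r (`exists_bumpWeight`). -/

open MeasureTheory Set
open scoped ENNReal NNReal

noncomputable section

/-! ### Laminar families, records of a level function, stopping sets -/

namespace SepBump
variable {X : Type*}

/-- A finite family of sets, any two of which are nested or disjoint. -/
def Laminar (F : Finset (Set X)) : Prop :=
  ∀ P ∈ F, ∀ Q ∈ F, P ⊆ Q ∨ Q ⊆ P ∨ Disjoint P Q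

lemma Laminar.mono {F G : Finset (Set X)} (hF : Laminar F) (h : G ⊆ F) : Laminar G :=
  fun P hP Q hQ => hF P (h hP) Q (h hQ)

lemma Laminar.subset_or_ssubset {F : Finset (Set X)} (hF : Laminar F) {P Q : Set X}
    (hP : P ∈ F) (hQ : Q ∈ F) {x : X} (hxP : x ∈ P) (hxQ : x ∈ Q) : P ⊆ Q ∨ Q ⊂ P := by
  rcases hF P hP Q hQ with h | h | h
  · exact Or.inl h
  · by_cases h' : P ⊆ Q
    · exact Or.inl h'
    · exact Or.inr ⟨h, h'⟩
  · exact absurd hxQ (Set.disjoint_left.1 h hxP)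

open Classical in
/-- The members `P` of `F` at which the level `κ` exceeds its values at all larger members. -/
def records (F : Finset (Set X)) (κ : Set X → ℤ) : Finset (Set X) :=
  F.filter fun P => ∀ T ∈ F, P ⊂ T → κ T < κ P

lemma mem_records {F : Finset (Set X)} {κ : Set X → ℤ} {P : Set X} :
    P ∈ records F κ ↔ P ∈ F ∧ ∀ T ∈ F, P ⊂ T → κ T < κ P := by
  classical
  simp [records]

lemma records_subset (F : Finset (Set X)) (κ : Set X → ℤ) : records F κ ⊆ F :=
  fun _ h => (mem_records.1 h).1

/-- Among the members containing Q, first maximize the level and then, at that level, the set: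
anything strictly larger has a strictly smaller level. -/
lemma exists_record_ge (F : Finset (Set X)) (κ : Set X → ℤ) {Q : Set X} (hQ : Q ∈ F) :
    ∃ P ∈ records F κ, Q ⊆ P ∧ κ Q ≤ κ P := by
  classical
  obtain ⟨T, hT, hmax⟩ := (F.filter (Q ⊆ ·)).exists_max_image κ ⟨Q, by simp [hQ]⟩
  have hTF := Finset.mem_filter.1 hT
  obtain ⟨P, hTP, hP⟩ := ((F.filter fun P => Q ⊆ P ∧ κ P = κ T)).exists_le_maximal
    (a := T) (by simp [hTF.1, hTF.2])
  have hP1 := Finset.mem_filter.1 hP.1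
  refine ⟨P, mem_records.2 ⟨hP1.1, fun S hS hPS => ?_⟩, hP1.2.1, ?_⟩
  · have hQS : Q ⊆ S := hP1.2.1.trans hPS.1
    have h1 : κ S ≤ κ T := hmax S (by simp [hS, hQS])
    rw [hP1.2.2]
    refine lt_of_le_of_ne h1 fun h => hPS.2 ?_
    exact hP.2 (by simp [hS, hQS, h]) hPS.1
  · rw [hP1.2.2]; exact hmax Q (by simp [hQ])

/-- Levels strictly increase as records shrink, so the inequality for the record given by
`exists_record_ge` passes to the smallest record containing Q. A common point turns minimal into
least. -/
lemma exists_minimal_record {F : Finset (Set X)} (hF : Laminar F) (κ : Set X → ℤ)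
    {Q : Set X} (hQ : Q ∈ F) (hne : Q.Nonempty) :
    ∃ P ∈ records F κ, Q ⊆ P ∧ κ Q ≤ κ P ∧ ∀ T ∈ records F κ, Q ⊆ T → P ⊆ T := by
  classical
  obtain ⟨x, hx⟩ := hne
  obtain ⟨T, hT, hQT, hκ⟩ := exists_record_ge F κ hQ
  obtain ⟨P, hPT, hP⟩ := ((records F κ).filter (Q ⊆ ·)).exists_le_minimal
    (a := T) (by simp [hT, hQT])
  have hP1 := Finset.mem_filter.1 hP.1
  refine ⟨P, hP1.1, hP1.2, ?_, fun S hS hQS => ?_⟩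
  · rcases eq_or_ne P T with rfl | h
    · exact hκ
    · exact hκ.trans ((mem_records.1 hP1.1).2 T (records_subset F κ hT)
        (lt_of_le_of_ne hPT h)).le
  · rcases hF.subset_or_ssubset (records_subset F κ hP1.1) (records_subset F κ hS)
      (hP1.2 hx) (hQS hx) with h | h
    · exact h
    · exact (hP.2 (by simp [hS, hQS]) h.1)

/-- A record of smallest size containing `Q`. -/
def stoppingSet (F : Finset (Set X)) (κ : Set X → ℤ) (Q : Set X) : Set X :=
  open Classical in
  if h : ∃ P ∈ records F κ, Q ⊆ P ∧ κ Q ≤ κ P ∧ ∀ T ∈ records F κ, Q ⊆ T → P ⊆ T then h.choose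
  else ∅

lemma stoppingSet_spec {F : Finset (Set X)} (hF : Laminar F) (κ : Set X → ℤ)
    {Q : Set X} (hQ : Q ∈ F) (hne : Q.Nonempty) :
    stoppingSet F κ Q ∈ records F κ ∧ Q ⊆ stoppingSet F κ Q ∧ κ Q ≤ κ (stoppingSet F κ Q) ∧
      ∀ T ∈ records F κ, Q ⊆ T → stoppingSet F κ Q ⊆ T := by
  have h := exists_minimal_record hF κ hQ hne
  rw [stoppingSet, dif_pos h]
  exact h.choose_spec

lemma records_level_le {F : Finset (Set X)} {κ : Set X → ℤ} {P Q : Set X}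
    (hP : P ∈ records F κ) (hQ : Q ∈ records F κ) (h : P ⊆ Q) : κ Q ≤ κ P := by
  rcases eq_or_ne P Q with rfl | h'
  · exact le_rfl
  · exact ((mem_records.1 hP).2 Q (records_subset F κ hQ) (lt_of_le_of_ne h h')).le

/-- Records through one point form a chain of strictly monotone level. This injectivity is what
makes every pointwise sum over records a geometric sum. -/
lemma records_level_inj {F : Finset (Set X)} (hF : Laminar F) {κ : Set X → ℤ} {P Q : Set X}
    (hP : P ∈ records F κ) (hQ : Q ∈ records F κ) {x : X} (hxP : x ∈ P) (hxQ : x ∈ Q)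
    (h : κ P = κ Q) : P = Q := by
  by_contra hne
  rcases hF.subset_or_ssubset (records_subset F κ hP) (records_subset F κ hQ) hxP hxQ with h' | h'
  · have := (mem_records.1 hP).2 Q (records_subset F κ hQ) (lt_of_le_of_ne h' hne)
    omega
  · have := (mem_records.1 hQ).2 P (records_subset F κ hP) h'
    omega

/-! ### Geometric sums over finite sets of integers -/

/-- The sum of the geometric series with ratio `2 ^ (-a)`. -/
def geomConst (a : ℝ) : ℝ≥0∞ := (1 - (2 : ℝ≥0∞) ^ (-a))⁻¹

lemma geomConst_ne_top {a : ℝ} (ha : 0 < a) : geomConst a ≠ ⊤ := by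
  rw [geomConst, Ne, ENNReal.inv_eq_top, tsub_eq_zero_iff_le, not_le]
  exact ENNReal.rpow_lt_one_of_one_lt_of_neg (by norm_num) (by linarith)

lemma sum_geom_le {ι : Type*} (s : Finset ι) (κ : ι → ℤ) (hκ : Set.InjOn κ s) (a : ℝ) (k₀ : ℤ)
    (h : ∀ i ∈ s, κ i ≤ k₀) :
    ∑ i ∈ s, (2 : ℝ≥0∞) ^ ((κ i : ℝ) * a) ≤ 2 ^ ((k₀ : ℝ) * a) * geomConst a := by
  have h1 : ∀ i ∈ s, (2 : ℝ≥0∞) ^ ((κ i : ℝ) * a) =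
      2 ^ ((k₀ : ℝ) * a) * ((2 : ℝ≥0∞) ^ (-a)) ^ ((k₀ - κ i).toNat) := by
    intro i hi
    have h2 : (((k₀ - κ i).toNat : ℕ) : ℝ) = (k₀ : ℝ) - κ i := by
      have : (((k₀ - κ i).toNat : ℤ)) = k₀ - κ i := Int.toNat_of_nonneg (by linarith [h i hi])
      exact_mod_cast this
    rw [← ENNReal.rpow_natCast, ← ENNReal.rpow_mul,
      ← ENNReal.rpow_add _ _ (by norm_num) (by norm_num), h2]
    congr 1; ring
  rw [Finset.sum_congr rfl h1, ← Finset.mul_sum, geomConst, ← ENNReal.tsum_geometric]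
  gcongr
  classical
  have hinj : Set.InjOn (fun i => (k₀ - κ i).toNat) s := by
    intro i hi j hj hij
    refine hκ hi hj ?_
    have := h i hi
    have := h j hj
    simp only at hij
    omega
  rw [← Finset.sum_image (f := fun m : ℕ => ((2 : ℝ≥0∞) ^ (-a)) ^ m) hinj]
  exact ENNReal.sum_le_tsum _

lemma sum_geom_ge {ι : Type*} (s : Finset ι) (κ : ι → ℤ) (hκ : Set.InjOn κ s) (a : ℝ) (k₀ : ℤ)
    (h : ∀ i ∈ s, k₀ ≤ κ i) :
    ∑ i ∈ s, (2 : ℝ≥0∞) ^ (-(κ i : ℝ) * a) ≤ 2 ^ (-(k₀ : ℝ) * a) * geomConst a := by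
  have := sum_geom_le s (fun i => -κ i) (fun i hi j hj hij => hκ hi hj (by simpa using hij)) a
    (-k₀) (fun i hi => by linarith [h i hi])
  simpa using this

end SepBump

/-! ### Dyadic levels, means, and the Carleson embedding over records -/

namespace SepBump
variable {X : Type*}

lemma exists_level {x : ℝ≥0∞} (h0 : x ≠ 0) (ht : x ≠ ⊤) :
    ∃ k : ℤ, (2 : ℝ≥0∞) ^ (k : ℝ) ≤ x ∧ x < 2 ^ ((k : ℝ) + 1) := by
  obtain ⟨k, hk⟩ := ENNReal.exists_mem_Ico_zpow h0 ht (y := 2) (by norm_num) (by norm_num)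
  refine ⟨k, by simpa [ENNReal.rpow_intCast] using hk.1, ?_⟩
  have := hk.2
  rw [← ENNReal.rpow_intCast] at this
  simpa using this

/-- The dyadic level of `x ∈ (0, ∞)`: the integer `k` with `2 ^ k ≤ x < 2 ^ (k + 1)`. -/
def level (x : ℝ≥0∞) : ℤ :=
  open Classical in
  if h : ∃ k : ℤ, (2 : ℝ≥0∞) ^ (k : ℝ) ≤ x ∧ x < 2 ^ ((k : ℝ) + 1) then h.choose else 0

lemma level_spec {x : ℝ≥0∞} (h0 : x ≠ 0) (ht : x ≠ ⊤) :
    (2 : ℝ≥0∞) ^ (level x : ℝ) ≤ x ∧ x < 2 ^ ((level x : ℝ) + 1) := by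
  have h := exists_level h0 ht
  rw [level, dif_pos h]
  exact h.choose_spec

lemma two_rpow_strictMono : StrictMono fun a : ℝ => (2 : ℝ≥0∞) ^ a := fun _ _ h =>
  ENNReal.rpow_lt_rpow_of_exponent_lt (by norm_num) (by norm_num) h

lemma two_rpow_lt_iff {a b : ℝ} : (2 : ℝ≥0∞) ^ a < 2 ^ b ↔ a < b :=
  two_rpow_strictMono.lt_iff_lt

lemma two_rpow_le_iff {a b : ℝ} : (2 : ℝ≥0∞) ^ a ≤ 2 ^ b ↔ a ≤ b :=
  two_rpow_strictMono.le_iff_le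

lemma two_rpow_add (a b : ℝ) : (2 : ℝ≥0∞) ^ (a + b) = 2 ^ a * 2 ^ b :=
  ENNReal.rpow_add _ _ (by norm_num) (by norm_num)

lemma two_rpow_ne_zero (a : ℝ) : (2 : ℝ≥0∞) ^ a ≠ 0 := by simp

lemma two_rpow_ne_top (a : ℝ) : (2 : ℝ≥0∞) ^ a ≠ ⊤ := by
  simp [ENNReal.rpow_eq_top_iff]

/-- The mean of `f` over `Q` with respect to `σ`. -/
def mean [MeasurableSpace X] (σ : Measure X) (f : X → ℝ≥0∞) (Q : Set X) : ℝ≥0∞ :=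
  (∫⁻ x in Q, f x ∂σ) / σ Q

lemma mean_mul [MeasurableSpace X] {σ : Measure X} (f : X → ℝ≥0∞) {Q : Set X} (h0 : σ Q ≠ 0)
    (ht : σ Q ≠ ⊤) : mean σ f Q * σ Q = ∫⁻ x in Q, f x ∂σ :=
  ENNReal.div_mul_cancel h0 ht

lemma mean_ne_zero [MeasurableSpace X] {σ : Measure X} {f : X → ℝ≥0∞} {Q : Set X}
    (ht : σ Q ≠ ⊤) (hf : ∫⁻ x in Q, f x ∂σ ≠ 0) : mean σ f Q ≠ 0 := by
  simp [mean, ENNReal.div_eq_zero_iff, hf, ht]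

lemma mean_ne_top [MeasurableSpace X] {σ : Measure X} {f : X → ℝ≥0∞} {Q : Set X}
    (h0 : σ Q ≠ 0) (hf : ∫⁻ x in Q, f x ∂σ ≠ ⊤) : mean σ f Q ≠ ⊤ :=
  ENNReal.div_ne_top hf h0

/-- At least half of the integral over `Q` comes from where `f` exceeds half its mean. -/
lemma lintegral_le_two_mul_large [MeasurableSpace X] {σ : Measure X} {f : X → ℝ≥0∞} {Q : Set X}
    (h0 : σ Q ≠ 0) (ht : σ Q ≠ ⊤) (hft : ∫⁻ x in Q, f x ∂σ ≠ ⊤)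
    {t : ℝ≥0∞} (h : 2 * t ≤ mean σ f Q) :
    ∫⁻ x in Q, f x ∂σ ≤ 2 * ∫⁻ x in Q, {x | t < f x}.indicator f x ∂σ := by
  have h1 : ∫⁻ x in Q, f x ∂σ ≤ ∫⁻ x in Q, {x | t < f x}.indicator f x ∂σ + t * σ Q := by
    calc ∫⁻ x in Q, f x ∂σ ≤ ∫⁻ x in Q, ({x | t < f x}.indicator f x + t) ∂σ := by
          refine lintegral_mono fun x => ?_
          by_cases hx : t < f x
          · simp [indicator, hx]
          · rw [indicator_of_notMem (by exact hx), zero_add]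
            exact not_lt.1 hx
      _ = _ := by
          rw [lintegral_add_right _ measurable_const]
          simp
  have h2 : 2 * (t * σ Q) ≤ ∫⁻ x in Q, f x ∂σ := by
    rw [← mean_mul f h0 ht, ← mul_assoc]
    gcongr
  set A := ∫⁻ x in Q, f x ∂σ
  set B := ∫⁻ x in Q, {x | t < f x}.indicator f x ∂σ
  have h3 : A + A ≤ 2 * B + A := by
    calc A + A ≤ (B + t * σ Q) + (B + t * σ Q) := add_le_add h1 h1
      _ = 2 * B + 2 * (t * σ Q) := by ring
      _ ≤ _ := by gcongr
  exact (ENNReal.add_le_add_iff_right hft).1 h3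

/-- No maximal function is needed. At least half of the integral of f over a record P comes from the
part where f exceeds 2^(κ P - 1), so the term of P is at most the integral of a multiple of 2^(κ P
(p - 1)) f over that part. At a fixed x the contributing records have distinct levels, at most about
that of f(x), and the geometric sum is of order f(x)^(p - 1). -/
lemma carleson_records [MeasurableSpace X] {F : Finset (Set X)} (hF : Laminar F) {σ : Measure X}
    (hm : ∀ Q ∈ F, MeasurableSet Q) (h0 : ∀ Q ∈ F, σ Q ≠ 0) (ht : ∀ Q ∈ F, σ Q ≠ ⊤)
    {f : X → ℝ≥0∞} (hf : Measurable f) (hf0 : ∀ Q ∈ F, ∫⁻ x in Q, f x ∂σ ≠ 0)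
    (hft : ∀ Q ∈ F, ∫⁻ x in Q, f x ∂σ ≠ ⊤) {p : ℝ} (hp : 1 < p) :
    ∑ P ∈ records F (fun Q => level (mean σ f Q)), mean σ f P ^ p * σ P ≤
      2 * (2 ^ (p - 1) * 2 ^ (p - 1) * geomConst (p - 1)) * ∫⁻ x, f x ^ p ∂σ := by
  classical
  set κ : Set X → ℤ := fun Q => level (mean σ f Q) with hκ
  set R := records F κ with hR
  have hRF : ∀ P ∈ R, P ∈ F := fun P hP => records_subset F κ hP
  have hlev : ∀ P ∈ R, (2 : ℝ≥0∞) ^ (κ P : ℝ) ≤ mean σ f P ∧ mean σ f P < 2 ^ ((κ P : ℝ) + 1) :=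
    fun P hP => level_spec (mean_ne_zero (ht P (hRF P hP)) (hf0 P (hRF P hP)))
      (mean_ne_top (h0 P (hRF P hP)) (hft P (hRF P hP)))
  set E : Set X → Set X := fun P => P ∩ {x | (2 : ℝ≥0∞) ^ ((κ P : ℝ) - 1) < f x} with hE
  have hEm : ∀ P ∈ R, MeasurableSet (E P) := fun P hP =>
    (hm P (hRF P hP)).inter (measurableSet_lt measurable_const hf)
  have step : ∀ P ∈ R, mean σ f P ^ p * σ P ≤
      ∫⁻ x, (E P).indicator (fun x => (2 : ℝ≥0∞) ^ (((κ P : ℝ) + 1) * (p - 1)) * (2 * f x)) x ∂σ := by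
    intro P hP
    have hPF := hRF P hP
    have e1 : mean σ f P ^ p = mean σ f P ^ (p - 1) * mean σ f P := by
      conv_rhs => rw [← ENNReal.rpow_one (mean σ f P), ← ENNReal.rpow_mul,
        ← ENNReal.rpow_add _ _ (mean_ne_zero (ht P hPF) (hf0 P hPF))
          (mean_ne_top (h0 P hPF) (hft P hPF))]
      congr 1; ring
    rw [e1, mul_assoc, mean_mul f (h0 P hPF) (ht P hPF), lintegral_indicator (hEm P hP),
      lintegral_const_mul _ (by fun_prop)]
    have e2 : ∫⁻ x in P, f x ∂σ ≤ ∫⁻ x in E P, 2 * f x ∂σ := by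
      have h2t : 2 * (2 : ℝ≥0∞) ^ ((κ P : ℝ) - 1) ≤ mean σ f P := by
        refine le_trans (le_of_eq ?_) (hlev P hP).1
        conv_lhs => rw [← ENNReal.rpow_one 2, ← ENNReal.rpow_mul, ← two_rpow_add]
        congr 1; ring
      refine (lintegral_le_two_mul_large (h0 P hPF) (ht P hPF) (hft P hPF) h2t).trans ?_
      rw [lintegral_const_mul _ hf, hE, lintegral_indicator (measurableSet_lt measurable_const hf),
        Measure.restrict_restrict (measurableSet_lt measurable_const hf), Set.inter_comm]
    refine mul_le_mul' ?_ e2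
    rw [ENNReal.rpow_mul]
    exact ENNReal.rpow_le_rpow (hlev P hP).2.le (by linarith)
  refine (Finset.sum_le_sum step).trans ?_
  rw [← lintegral_finsetSum' _ (fun P hP =>
    (Measurable.indicator (by fun_prop) (hEm P hP)).aemeasurable),
    ← lintegral_const_mul _ (by fun_prop)]
  refine lintegral_mono fun x => ?_
  have hp1 : 0 < p - 1 := by linarith
  set G := geomConst (p - 1)
  rcases eq_or_ne (f x) 0 with hx0 | hx0
  · have : ∑ P ∈ R, (E P).indicator
        (fun x => (2 : ℝ≥0∞) ^ (((κ P : ℝ) + 1) * (p - 1)) * (2 * f x)) x = 0 := by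
      refine Finset.sum_eq_zero fun P _ => ?_
      by_cases h : x ∈ E P
      · simp [h, hx0]
      · simp [h]
    rw [this]; exact zero_le
  rcases eq_or_ne (f x) ⊤ with hxt | hxt
  · have hG : G ≠ 0 := by simp [G, geomConst, ENNReal.inv_eq_zero]
    rw [hxt, ENNReal.top_rpow_of_pos (by linarith), ENNReal.mul_top]
    · exact le_top
    · simp [hG]
  obtain ⟨hk1, hk2⟩ := level_spec hx0 hxt
  set k := level (f x)
  have e3 : ∑ P ∈ R, (E P).indicator
        (fun x => (2 : ℝ≥0∞) ^ (((κ P : ℝ) + 1) * (p - 1)) * (2 * f x)) x =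
      (∑ P ∈ R.filter (x ∈ E ·), (2 : ℝ≥0∞) ^ ((κ P : ℝ) * (p - 1))) * (2 ^ (p - 1) * (2 * f x)) := by
    rw [Finset.sum_filter, Finset.sum_mul]
    refine Finset.sum_congr rfl fun P _ => ?_
    by_cases h : x ∈ E P
    · simp only [h, indicator_of_mem, if_true]
      rw [add_mul, two_rpow_add, one_mul]; ring
    · simp [h]
  -- The bound k + 1 comes from 2^(κ P - 1) < f(x) < 2^(k + 1), that is κ P < k + 2.
  have e4 := sum_geom_le (R.filter (x ∈ E ·)) κ (by
    intro P hP Q hQ h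
    simp only [Finset.coe_filter, mem_ofPred_eq] at hP hQ
    exact records_level_inj hF hP.1 hQ.1 hP.2.1 hQ.2.1 h) (p - 1) (k + 1) (by
    intro P hP
    have hP := (Finset.mem_filter.1 hP).2
    have : (2 : ℝ≥0∞) ^ ((κ P : ℝ) - 1) < 2 ^ ((k : ℝ) + 1) := lt_trans hP.2 hk2
    rw [two_rpow_lt_iff] at this
    have : (κ P : ℝ) < k + 2 := by linarith
    have : κ P < k + 2 := by exact_mod_cast this
    omega)
  rw [e3]
  have e5 : f x ^ p = f x ^ (p - 1) * f x := by
    conv_rhs => rw [← ENNReal.rpow_one (f x), ← ENNReal.rpow_mul, ← ENNReal.rpow_add _ _ hx0 hxt]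
    congr 1; ring
  calc _ ≤ (2 ^ (((k + 1 : ℤ) : ℝ) * (p - 1)) * G) * (2 ^ (p - 1) * (2 * f x)) := by gcongr
    _ = ((2 ^ (k : ℝ)) ^ (p - 1) * 2 ^ (p - 1) * G) * (2 ^ (p - 1) * (2 * f x)) := by
        push_cast
        rw [add_mul, two_rpow_add, one_mul, ENNReal.rpow_mul]
    _ ≤ ((f x) ^ (p - 1) * 2 ^ (p - 1) * G) * (2 ^ (p - 1) * (2 * f x)) := by
        gcongr
    _ = _ := by rw [e5]; ring

end SepBump

/-! ### Children, cores, and averaging over the children of a stopping set -/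

namespace SepBump
variable {X : Type*}

lemma sum_ite_le_of_subsingleton {ι : Type*} (s : Finset ι) (c : ι → Prop) [DecidablePred c]
    (a : ℝ≥0∞) (h : ∀ i ∈ s, ∀ j ∈ s, c i → c j → i = j) :
    ∑ i ∈ s, (if c i then a else 0) ≤ a := by
  by_cases hc : ∃ i ∈ s, c i
  · obtain ⟨i, hi, hci⟩ := hc
    rw [Finset.sum_eq_single_of_mem i hi (fun j hj hji => if_neg fun hcj => hji (h j hj i hi hcj hci))]
    simp [hci]
  · push Not at hc
    rw [Finset.sum_eq_zero fun i hi => if_neg (hc i hi)]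
    exact zero_le

lemma sum_rpow_le_rpow_sum {ι : Type*} (s : Finset ι) (b : ι → ℝ≥0∞) {r : ℝ} (hr : 1 ≤ r) :
    ∑ i ∈ s, b i ^ r ≤ (∑ i ∈ s, b i) ^ r := by
  classical
  induction s using Finset.induction_on with
  | empty => simp
  | insert i s hi ih =>
    rw [Finset.sum_insert hi, Finset.sum_insert hi]
    exact (add_le_add le_rfl ih).trans (ENNReal.add_rpow_le_rpow_add _ _ hr)

open Classical in
/-- The maximal records strictly inside `P`. -/
def children (R : Finset (Set X)) (P : Set X) : Finset (Set X) :=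
  R.filter fun S => S ⊂ P ∧ ∀ T ∈ R, S ⊂ T → ¬ T ⊂ P

lemma mem_children {R : Finset (Set X)} {P S : Set X} :
    S ∈ children R P ↔ S ∈ R ∧ S ⊂ P ∧ ∀ T ∈ R, S ⊂ T → ¬ T ⊂ P := by
  classical
  simp [children]

lemma exists_child_ge {R : Finset (Set X)} {P S : Set X} (hS : S ∈ R) (h : S ⊂ P) :
    ∃ T ∈ children R P, S ⊆ T := by
  classical
  obtain ⟨T, hST, hT⟩ := (R.filter (· ⊂ P)).exists_le_maximal (a := S) (by simp [hS, h])
  have hT1 := Finset.mem_filter.1 hT.1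
  exact ⟨T, mem_children.2 ⟨hT1.1, hT1.2, fun U hU hTU hUP => hTU.2 (hT.2 (by simp [hU, hUP]) hTU.1)⟩,
    hST⟩

lemma children_eq_of_mem {R : Finset (Set X)} (hR : Laminar R) {P S T : Set X}
    (hS : S ∈ children R P) (hT : T ∈ children R P) {x : X} (hxS : x ∈ S) (hxT : x ∈ T) : S = T := by
  rw [mem_children] at hS hT
  by_contra hne
  rcases hR.subset_or_ssubset hS.1 hT.1 hxS hxT with h | h
  · exact hS.2.2 T hT.1 (lt_of_le_of_ne h hne) hT.2.1
  · exact hT.2.2 S hS.1 h hS.2.1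

/-- The part of `P` outside its children. -/
def core (R : Finset (Set X)) (P : Set X) : Set X := P \ ⋃ S ∈ children R P, S

lemma core_disjoint {R : Finset (Set X)} (hR : Laminar R) {P S : Set X} (hP : P ∈ R) (hS : S ∈ R)
    {x : X} (hxP : x ∈ core R P) (hxS : x ∈ core R S) : P = S := by
  by_contra hne
  have key : ∀ {P S : Set X}, P ∈ R → P ⊂ S → x ∈ core R P → x ∈ core R S → False := by
    intro P S hP h hxP hxS
    obtain ⟨T, hT, hPT⟩ := exists_child_ge hP h
    exact hxS.2 (mem_biUnion hT (hPT hxP.1))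
  rcases hR.subset_or_ssubset hP hS hxP.1 hxS.1 with h | h
  · exact key hP (lt_of_le_of_ne h hne) hxP hxS
  · exact key hS h hxS hxP

section
variable [MeasurableSpace X]

lemma measurableSet_core {R : Finset (Set X)} (hm : ∀ Q ∈ R, MeasurableSet Q) {P : Set X}
    (hP : P ∈ R) : MeasurableSet (core R P) :=
  (hm P hP).diff (Finset.measurableSet_biUnion _ fun S hS => hm S (mem_children.1 hS).1)

/-- The function that equals `g` on the core of `P` and the means of `g` on the children of `P`. -/
def smoothed (R : Finset (Set X)) (w : Measure X) (g : X → ℝ≥0∞) (P : Set X) (x : X) : ℝ≥0∞ :=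
  (core R P).indicator g x + ∑ S ∈ children R P, S.indicator (fun _ => mean w g S) x

lemma measurable_smoothed {R : Finset (Set X)} (hm : ∀ Q ∈ R, MeasurableSet Q) {P : Set X}
    (hP : P ∈ R) {w : Measure X} {g : X → ℝ≥0∞} (hg : Measurable g) :
    Measurable (smoothed R w g P) :=
  (hg.indicator (measurableSet_core hm hP)).add (Finset.measurable_sum _ fun S hS =>
    measurable_const.indicator (hm S (mem_children.1 hS).1))

/-- A child of P inside Q keeps its integral when g is replaced by its mean there, and a child
disjoint from Q plays no part. Thus cubes that do not lie strictly inside a child cannot distinguish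
g from its smoothed version. -/
lemma setLIntegral_le_smoothed {R : Finset (Set X)} (hm : ∀ Q ∈ R, MeasurableSet Q) {P : Set X}
    (hP : P ∈ R) {w : Measure X} (h0 : ∀ Q ∈ R, w Q ≠ 0) (ht : ∀ Q ∈ R, w Q ≠ ⊤)
    {g : X → ℝ≥0∞} (hg : Measurable g) {Q : Set X} (hQm : MeasurableSet Q) (hQP : Q ⊆ P)
    (hQ : ∀ S ∈ children R P, S ⊆ Q ∨ Disjoint S Q) :
    ∫⁻ x in Q, g x ∂w ≤ ∫⁻ x in Q, smoothed R w g P x ∂w := by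
  calc ∫⁻ x in Q, g x ∂w
      ≤ ∫⁻ x in Q, ((core R P).indicator g x + ∑ S ∈ children R P, S.indicator g x) ∂w := by
        refine setLIntegral_mono' hQm fun x hx => ?_
        by_cases h : x ∈ core R P
        · simp [h]
        · have : ∃ S ∈ children R P, x ∈ S := by
            by_contra h'
            push Not at h'
            exact h ⟨hQP hx, by simpa using h'⟩
          obtain ⟨S, hS, hxS⟩ := this
          calc g x = S.indicator g x := by simp [hxS]
            _ ≤ ∑ S ∈ children R P, S.indicator g x :=
              Finset.single_le_sum (f := fun S => S.indicator g x) (fun _ _ => zero_le) hS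
            _ ≤ _ := le_add_self
    _ = ∫⁻ x in Q, (core R P).indicator g x ∂w + ∑ S ∈ children R P, ∫⁻ x in Q, S.indicator g x ∂w := by
        rw [lintegral_add_left (hg.indicator (measurableSet_core hm hP)),
          lintegral_finsetSum _ fun S hS => hg.indicator (hm S (mem_children.1 hS).1)]
    _ ≤ ∫⁻ x in Q, (core R P).indicator g x ∂w +
          ∑ S ∈ children R P, ∫⁻ x in Q, S.indicator (fun _ => mean w g S) x ∂w := by
        refine add_le_add le_rfl (Finset.sum_le_sum fun S hS => ?_)
        have hSR := (mem_children.1 hS).1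
        rw [lintegral_indicator (hm S hSR), lintegral_indicator (hm S hSR),
          Measure.restrict_restrict (hm S hSR)]
        rcases hQ S hS with h | h
        · rw [inter_eq_left.2 h, setLIntegral_const, mean_mul g (h0 S hSR) (ht S hSR)]
        · simp [h.inter_eq]
    _ = _ := by
        rw [← lintegral_finsetSum _ fun S hS => measurable_const.indicator (hm S (mem_children.1 hS).1),
          ← lintegral_add_left (hg.indicator (measurableSet_core hm hP))]
        rfl

lemma lintegral_smoothed_rpow_le {R : Finset (Set X)} (hR : Laminar R)
    (hm : ∀ Q ∈ R, MeasurableSet Q) {P : Set X}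
    (hP : P ∈ R) {w : Measure X} {g : X → ℝ≥0∞} (hg : Measurable g) {r : ℝ} (hr : 0 < r) :
    ∫⁻ x, smoothed R w g P x ^ r ∂w ≤
      ∫⁻ x, (core R P).indicator (fun x => g x ^ r) x ∂w
        + ∑ S ∈ children R P, mean w g S ^ r * w S := by
  have e : ∀ S ∈ children R P, mean w g S ^ r * w S =
      ∫⁻ x, S.indicator (fun _ => mean w g S ^ r) x ∂w := fun S hS => by
    rw [lintegral_indicator (hm S (mem_children.1 hS).1), setLIntegral_const]
  rw [Finset.sum_congr rfl e, ← lintegral_finsetSum _ fun S hS =>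
      measurable_const.indicator (hm S (mem_children.1 hS).1),
    ← lintegral_add_left ((hg.pow_const r).indicator (measurableSet_core hm hP))]
  refine lintegral_mono fun x => ?_
  by_cases h : x ∈ core R P
  · have : ∑ S ∈ children R P, S.indicator (fun _ => mean w g S) x = 0 :=
      Finset.sum_eq_zero fun S hS => indicator_of_notMem (fun hx => h.2 (mem_biUnion hS hx)) _
    simp [smoothed, h, this]
  · simp only [smoothed, h, not_false_eq_true, indicator_of_notMem, zero_add]
    by_cases h' : ∃ S ∈ children R P, x ∈ S
    · obtain ⟨S, hS, hxS⟩ := h'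
      rw [Finset.sum_eq_single_of_mem S hS fun T hT hne => indicator_of_notMem
        (fun hxT => hne (children_eq_of_mem hR hT hS hxT hxS)) _,
        Finset.sum_eq_single_of_mem S hS fun T hT hne => indicator_of_notMem
        (fun hxT => hne (children_eq_of_mem hR hT hS hxT hxS)) _]
      simp [hxS]
    · push Not at h'
      rw [Finset.sum_eq_zero fun S hS => indicator_of_notMem (h' S hS) _]
      simp [hr]

/-- Each point lies in at most one core and each record is a child of at most one record, so neither
term is counted twice. -/
lemma sum_lintegral_smoothed_rpow_le {R : Finset (Set X)} (hR : Laminar R)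
    (hm : ∀ Q ∈ R, MeasurableSet Q) (hne : ∀ Q ∈ R, Q.Nonempty)
    {w : Measure X} {g : X → ℝ≥0∞} (hg : Measurable g) {r : ℝ} (hr : 0 < r) :
    ∑ P ∈ R, ∫⁻ x, smoothed R w g P x ^ r ∂w ≤
      ∫⁻ x, g x ^ r ∂w + ∑ S ∈ R, mean w g S ^ r * w S := by
  classical
  refine (Finset.sum_le_sum fun P hP => lintegral_smoothed_rpow_le hR hm hP hg hr).trans ?_
  rw [Finset.sum_add_distrib]
  refine add_le_add ?_ ?_
  · rw [← lintegral_finsetSum _ fun P hP => (hg.pow_const r).indicator (measurableSet_core hm hP)]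
    refine lintegral_mono fun x => ?_
    simp only [indicator_apply]
    exact sum_ite_le_of_subsingleton R (x ∈ core R ·) _ fun P hP S hS h1 h2 =>
      core_disjoint hR hP hS h1 h2
  · have e : ∀ P, ∑ S ∈ children R P, mean w g S ^ r * w S =
        ∑ S ∈ R, if S ∈ children R P then mean w g S ^ r * w S else 0 := fun P => by
      rw [← Finset.sum_filter]
      refine Finset.sum_congr ?_ fun _ _ => rfl
      ext S
      simp only [Finset.mem_filter, mem_children]
      tauto
    simp only [e]
    rw [Finset.sum_comm]
    refine Finset.sum_le_sum fun S hS => ?_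
    refine sum_ite_le_of_subsingleton R (S ∈ children R ·) _ fun P hP T hT h1 h2 => ?_
    rw [mem_children] at h1 h2
    obtain ⟨x, hx⟩ := hne S hS
    by_contra hPT
    rcases hR.subset_or_ssubset hP hT (h1.2.1.1 hx) (h2.2.1.1 hx) with h | h
    · exact h2.2.2 P hP h1.2.1 (lt_of_le_of_ne h hPT)
    · exact h1.2.2 T hT h2.2.1 h

end
end SepBump

/-! ### The two-weight testing theorem for positive dyadic operators -/

namespace SepBump
variable {X : Type*} [MeasurableSpace X]

/-- The localized testing function `∑_{Q ⊆ R} τ_Q σ(Q) 1_Q`. -/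
def testFun (F : Finset (Set X)) (τ : Set X → ℝ≥0∞) (σ : Measure X) (R : Set X) (x : X) : ℝ≥0∞ :=
  ∑ Q ∈ F, {y | y ∈ Q ∧ Q ⊆ R}.indicator (fun _ => τ Q * σ Q) x

lemma testFun_mono {F G : Finset (Set X)} (h : F ⊆ G) (τ : Set X → ℝ≥0∞) (σ : Measure X)
    (R : Set X) (x : X) : testFun F τ σ R x ≤ testFun G τ σ R x :=
  Finset.sum_le_sum_of_subset h

/-- The testing condition with constant `T`. -/
def Testing (F : Finset (Set X)) (τ : Set X → ℝ≥0∞) (σ w : Measure X) (p q : ℝ) (T : ℝ≥0∞) : Prop :=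
  ∀ R ∈ F, (∫⁻ x, testFun F τ σ R x ^ q ∂w) ^ (1 / q) ≤ T * σ R ^ (1 / p)

lemma Testing.mono {F G : Finset (Set X)} (h : F ⊆ G) {τ : Set X → ℝ≥0∞} {σ w : Measure X}
    {p q : ℝ} (hq : 0 < q) {T : ℝ≥0∞} (hT : Testing G τ σ w p q T) : Testing F τ σ w p q T :=
  fun R hR => le_trans (ENNReal.rpow_le_rpow (lintegral_mono fun x =>
    ENNReal.rpow_le_rpow (testFun_mono h τ σ R x) hq.le) (by positivity)) (hT R (h hR))

/-- The constant of the Carleson embedding over records. -/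
def carlesonConst (p : ℝ) : ℝ≥0∞ := 2 * (2 ^ (p - 1) * 2 ^ (p - 1) * geomConst (p - 1))

lemma carlesonConst_ne_top {p : ℝ} (hp : 1 < p) : carlesonConst p ≠ ⊤ :=
  ENNReal.mul_ne_top (by simp) (ENNReal.mul_ne_top
    (ENNReal.mul_ne_top (two_rpow_ne_top _) (two_rpow_ne_top _)) (geomConst_ne_top (by linarith)))

/-- Non-degeneracy of a finite laminar family with respect to a measure. -/
structure Good (F : Finset (Set X)) (σ : Measure X) : Prop where
  meas : ∀ Q ∈ F, MeasurableSet Q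
  ne_zero : ∀ Q ∈ F, σ Q ≠ 0
  ne_top : ∀ Q ∈ F, σ Q ≠ ⊤

lemma Good.mono {F G : Finset (Set X)} {σ : Measure X} (hF : Good F σ) (h : G ⊆ F) : Good G σ :=
  ⟨fun Q hQ => hF.meas Q (h hQ), fun Q hQ => hF.ne_zero Q (h hQ), fun Q hQ => hF.ne_top Q (h hQ)⟩

lemma Good.nonempty {F : Finset (Set X)} {σ : Measure X} (hF : Good F σ) {Q : Set X} (hQ : Q ∈ F) :
    Q.Nonempty :=
  nonempty_of_measure_ne_zero (hF.ne_zero Q hQ)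

lemma holder_exponents {p p' q q' : ℝ} (hp : p.HolderConjugate p') (hq : q.HolderConjugate q')
    (hpq : p ≤ q) : 1 ≤ p' / q' := by
  rw [one_le_div hq.symm.pos]
  have h1 := hp.inv_add_inv_eq_one
  have h2 := hq.inv_add_inv_eq_one
  have h3 : q⁻¹ ≤ p⁻¹ := inv_anti₀ hp.pos hpq
  exact (inv_le_inv₀ hp.symm.pos hq.symm.pos).1 (by linarith)

/-- Stopping sets are taken for the means of f alone. For Q with stopping set P, the mean of f is at
most twice that on P, and g may be replaced by its smoothing at P. Hölder's inequality and testing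
on P bound the local sum by 2T times ⟨f⟩_P σ(P)^(1/p) and the L^q'(w) norm of the smoothed g. The
hypothesis `hfg` transfers the Carleson bound from the means of f to those of g, so no second
stopping family is needed. -/
lemma bilinear_half {F : Finset (Set X)} (hF : Laminar F) {σ w : Measure X} (hσ : Good F σ)
    (hw : Good F w) {τ : Set X → ℝ≥0∞} {p p' q q' : ℝ} (hp : p.HolderConjugate p')
    (hq : q.HolderConjugate q') (hpq : p ≤ q) {f g : X → ℝ≥0∞} (hf : Measurable f)
    (hg : Measurable g) (hf0 : ∀ Q ∈ F, ∫⁻ x in Q, f x ∂σ ≠ 0)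
    (hft : ∀ Q ∈ F, ∫⁻ x in Q, f x ∂σ ≠ ⊤)
    (hf1 : ∫⁻ x, f x ^ p ∂σ ≤ 1) (hg1 : ∫⁻ x, g x ^ q' ∂w ≤ 1)
    (hfg : ∀ Q ∈ F, mean w g Q ^ q' * w Q ≤ mean σ f Q ^ p * σ Q)
    {T : ℝ≥0∞} (hT : Testing F τ σ w p q T) :
    ∑ Q ∈ F, τ Q * (∫⁻ x in Q, f x ∂σ) * (∫⁻ x in Q, g x ∂w) ≤
      2 * carlesonConst p ^ (1 / p) * (1 + carlesonConst p) ^ (1 / q') * T := by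
  classical
  set κ : Set X → ℤ := fun Q => level (mean σ f Q) with hκ
  set R := records F κ with hRdef
  have hRF : R ⊆ F := records_subset F κ
  have hRl : Laminar R := hF.mono hRF
  have hne : ∀ Q ∈ F, Q.Nonempty := fun Q hQ => hσ.nonempty hQ
  have hlev : ∀ Q ∈ F, (2 : ℝ≥0∞) ^ (κ Q : ℝ) ≤ mean σ f Q ∧ mean σ f Q < 2 ^ ((κ Q : ℝ) + 1) :=
    fun P hP => level_spec (mean_ne_zero (hσ.ne_top P hP) (hf0 P hP))
      (mean_ne_top (hσ.ne_zero P hP) (hft P hP))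
  set b : Set X → ℝ≥0∞ := fun P => ∫⁻ x, smoothed R w g P x ^ q' ∂w with hb
  set C := carlesonConst p
  have hcar : ∑ P ∈ R, mean σ f P ^ p * σ P ≤ C := by
    refine (carleson_records hF hσ.meas hσ.ne_zero hσ.ne_top hf hf0 hft hp.lt).trans ?_
    calc _ ≤ C * 1 := by gcongr; exact le_rfl
      _ = C := mul_one _
  have hbsum : ∑ P ∈ R, b P ≤ 1 + C := by
    refine (sum_lintegral_smoothed_rpow_le hRl (fun Q hQ => hσ.meas Q (hRF hQ))
      (fun Q hQ => hne Q (hRF hQ)) hg hq.symm.pos).trans (add_le_add hg1 ?_)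
    exact (Finset.sum_le_sum fun S hS => hfg S (hRF hS)).trans hcar
  have hlocal : ∀ P ∈ R, ∑ Q ∈ F with stoppingSet F κ Q = P,
      τ Q * (∫⁻ x in Q, f x ∂σ) * (∫⁻ x in Q, g x ∂w) ≤
      2 * T * ((mean σ f P ^ p * σ P) ^ (1 / p) * b P ^ (1 / q')) := by
    intro P hP
    have h1 : ∀ Q ∈ F.filter (fun Q => stoppingSet F κ Q = P),
        τ Q * (∫⁻ x in Q, f x ∂σ) * (∫⁻ x in Q, g x ∂w) ≤
        2 * mean σ f P * ∫⁻ x, {y | y ∈ Q ∧ Q ⊆ P}.indicator (fun _ => τ Q * σ Q) x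
          * smoothed R w g P x ∂w := by
      intro Q hQ
      obtain ⟨hQF, hQs⟩ := Finset.mem_filter.1 hQ
      obtain ⟨-, hQP, hκQ, hmin⟩ := stoppingSet_spec hF κ hQF (hne Q hQF)
      rw [hQs] at hQP hκQ hmin
      have e1 : mean σ f Q ≤ 2 * mean σ f P := by
        refine (hlev Q hQF).2.le.trans ?_
        rw [two_rpow_add, ENNReal.rpow_one, mul_comm]
        gcongr
        refine le_trans ?_ (hlev P (hRF hP)).1
        rw [two_rpow_le_iff]; exact_mod_cast hκQ
      have e2 : ∫⁻ x in Q, g x ∂w ≤ ∫⁻ x in Q, smoothed R w g P x ∂w := by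
        refine setLIntegral_le_smoothed (fun Q hQ => hσ.meas Q (hRF hQ)) hP
          (fun Q hQ => hw.ne_zero Q (hRF hQ)) (fun Q hQ => hw.ne_top Q (hRF hQ)) hg
          (hσ.meas Q hQF) hQP fun S hS => ?_
        rw [mem_children] at hS
        rcases hF S (hRF hS.1) Q hQF with h | h | h
        · exact Or.inl h
        -- A child of P cannot contain Q, since P is the least record containing Q.
        · exact absurd (hmin S hS.1 h) hS.2.1.2
        · exact Or.inr h
      have e3 : {y | y ∈ Q ∧ Q ⊆ P} = Q := by ext y; simp [hQP]
      rw [e3]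
      have e4 : ∫⁻ x, Q.indicator (fun _ => τ Q * σ Q) x * smoothed R w g P x ∂w =
          τ Q * σ Q * ∫⁻ x in Q, smoothed R w g P x ∂w := by
        rw [← lintegral_const_mul _ (measurable_smoothed (fun Q hQ => hσ.meas Q (hRF hQ)) hP hg),
          ← lintegral_indicator (hσ.meas Q hQF)]
        refine lintegral_congr fun x => ?_
        by_cases hx : x ∈ Q <;> simp [hx]
      rw [e4, ← mean_mul f (hσ.ne_zero Q hQF) (hσ.ne_top Q hQF)]
      calc τ Q * (mean σ f Q * σ Q) * ∫⁻ x in Q, g x ∂w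
          ≤ τ Q * ((2 * mean σ f P) * σ Q) * ∫⁻ x in Q, smoothed R w g P x ∂w := by gcongr
        _ = _ := by ring
    refine (Finset.sum_le_sum h1).trans ?_
    have hsm := measurable_smoothed (fun Q hQ => hσ.meas Q (hRF hQ)) hP (w := w) hg
    have hmeas : ∀ Q ∈ F, Measurable fun x : X =>
        {y | y ∈ Q ∧ Q ⊆ P}.indicator (fun _ => τ Q * σ Q) x := fun Q hQ => by
      refine measurable_const.indicator ?_
      by_cases h : Q ⊆ P
      · simpa [h] using hσ.meas Q hQ
      · simp [h]
    have hmul : ∀ Q ∈ F.filter (fun Q => stoppingSet F κ Q = P), Measurable fun x : X =>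
        {y | y ∈ Q ∧ Q ⊆ P}.indicator (fun _ => τ Q * σ Q) x * smoothed R w g P x :=
      fun Q hQ => (hmeas Q (Finset.mem_filter.1 hQ).1).mul hsm
    rw [← Finset.mul_sum, ← lintegral_finsetSum _ hmul]
    have h2 : ∫⁻ x, ∑ Q ∈ F with stoppingSet F κ Q = P,
        {y | y ∈ Q ∧ Q ⊆ P}.indicator (fun _ => τ Q * σ Q) x * smoothed R w g P x ∂w ≤
        T * σ P ^ (1 / p) * b P ^ (1 / q') := by
      calc _ ≤ ∫⁻ x, testFun F τ σ P x * smoothed R w g P x ∂w := by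
            refine lintegral_mono fun x => ?_
            rw [← Finset.sum_mul]
            gcongr
            exact Finset.sum_le_sum_of_subset (Finset.filter_subset _ _)
        _ ≤ (∫⁻ x, testFun F τ σ P x ^ q ∂w) ^ (1 / q) * b P ^ (1 / q') :=
            ENNReal.lintegral_mul_le_Lp_mul_Lq w hq
              (Finset.measurable_sum _ fun Q hQ => hmeas Q hQ).aemeasurable hsm.aemeasurable
        _ ≤ _ := by gcongr; exact hT P (hRF hP)
    calc 2 * mean σ f P * _ ≤ 2 * mean σ f P * (T * σ P ^ (1 / p) * b P ^ (1 / q')) := by gcongr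
      _ = 2 * T * ((mean σ f P ^ p * σ P) ^ (1 / p) * b P ^ (1 / q')) := by
        rw [ENNReal.mul_rpow_of_nonneg _ _ (one_div_nonneg.2 hp.nonneg), ← ENNReal.rpow_mul,
          mul_one_div_cancel hp.ne_zero, ENNReal.rpow_one]
        ring
  rw [← Finset.sum_fiberwise_of_maps_to (t := R) (g := stoppingSet F κ)
    fun Q hQ => (stoppingSet_spec hF κ hQ (hne Q hQ)).1]
  refine (Finset.sum_le_sum hlocal).trans ?_
  rw [← Finset.mul_sum]
  have hhol := ENNReal.inner_le_Lp_mul_Lq R (fun P => (mean σ f P ^ p * σ P) ^ (1 / p))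
    (fun P => b P ^ (1 / q')) hp
  have e5 : ∀ P, ((mean σ f P ^ p * σ P) ^ (1 / p)) ^ p = mean σ f P ^ p * σ P := fun P => by
    rw [← ENNReal.rpow_mul, one_div_mul_cancel hp.ne_zero, ENNReal.rpow_one]
  -- Here p ≤ q enters: p'/q' ≥ 1, so a sum of powers is at most the power of the sum.
  have e6 : (∑ P ∈ R, (b P ^ (1 / q')) ^ p') ^ (1 / p') ≤ (1 + C) ^ (1 / q') := by
    have : ∀ P, (b P ^ (1 / q')) ^ p' = b P ^ (p' / q') := fun P => by
      rw [← ENNReal.rpow_mul]; congr 1; ring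
    simp only [this]
    calc (∑ P ∈ R, b P ^ (p' / q')) ^ (1 / p') ≤ ((∑ P ∈ R, b P) ^ (p' / q')) ^ (1 / p') :=
          ENNReal.rpow_le_rpow (sum_rpow_le_rpow_sum R b (holder_exponents hp hq hpq))
            (one_div_nonneg.2 hp.symm.nonneg)
      _ = (∑ P ∈ R, b P) ^ (1 / q') := by
          rw [← ENNReal.rpow_mul]; congr 1
          have := hp.symm.ne_zero
          field_simp
      _ ≤ _ := ENNReal.rpow_le_rpow hbsum (one_div_nonneg.2 hq.symm.nonneg)
  simp only [e5] at hhol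
  calc 2 * T * ∑ P ∈ R, (mean σ f P ^ p * σ P) ^ (1 / p) * b P ^ (1 / q')
      ≤ 2 * T * (C ^ (1 / p) * (1 + C) ^ (1 / q')) := by
        gcongr
        refine hhol.trans (mul_le_mul' (ENNReal.rpow_le_rpow hcar (one_div_nonneg.2 hp.nonneg)) e6)
    _ = _ := by ring

end SepBump

namespace SepBump
variable {X : Type*} [MeasurableSpace X]

/-- The constant in the two-weight testing theorem. -/
def testingConst (p q : ℝ) : ℝ≥0∞ :=
  2 * carlesonConst p ^ (1 / p) * (1 + carlesonConst p) ^ (1 / q.conjExponent) +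
    2 * carlesonConst q.conjExponent ^ (1 / q.conjExponent) *
      (1 + carlesonConst q.conjExponent) ^ (1 / p)

lemma testingConst_ne_top {p q : ℝ} (hp : 1 < p) (hq : 1 < q) : testingConst p q ≠ ⊤ := by
  have hq' : 1 < q.conjExponent := (Real.HolderConjugate.conjExponent hq).symm.lt
  have h1 := carlesonConst_ne_top hp
  have h2 := carlesonConst_ne_top hq'
  have h0 : ∀ {r : ℝ}, 1 < r → 0 ≤ 1 / r := fun h => by positivity
  exact ENNReal.add_ne_top.2 ⟨ENNReal.mul_ne_top (ENNReal.mul_ne_top (by simp)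
      (ENNReal.rpow_ne_top_of_nonneg (h0 hp) h1))
      (ENNReal.rpow_ne_top_of_nonneg (h0 hq') (ENNReal.add_ne_top.2 ⟨by simp, h1⟩)),
    ENNReal.mul_ne_top (ENNReal.mul_ne_top (by simp)
      (ENNReal.rpow_ne_top_of_nonneg (h0 hq') h2))
      (ENNReal.rpow_ne_top_of_nonneg (h0 hp) (ENNReal.add_ne_top.2 ⟨by simp, h2⟩))⟩

lemma setLIntegral_le_Lp_mul {σ : Measure X} {f : X → ℝ≥0∞} (hf : Measurable f) {p p' : ℝ}
    (hp : p.HolderConjugate p') (Q : Set X) :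
    ∫⁻ x in Q, f x ∂σ ≤ (∫⁻ x, f x ^ p ∂σ) ^ (1 / p) * σ Q ^ (1 / p') := by
  have h := ENNReal.lintegral_mul_le_Lp_mul_Lq (σ.restrict Q) hp hf.aemeasurable
    (g := fun _ => 1) aemeasurable_const
  simp only [Pi.mul_apply, mul_one, ENNReal.one_rpow, lintegral_const, one_mul,
    Measure.restrict_apply MeasurableSet.univ, univ_inter] at h
  refine h.trans ?_
  gcongr
  · exact one_div_nonneg.2 hp.nonneg
  · exact Measure.restrict_le_self

/-- Each cube is assigned to the function with the larger energy, and `bilinear_half` is applied to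
both groups, the second time with the two sides exchanged. The normalization lets energies of
different exponents be compared and added. -/
lemma bilinear_normalized {F : Finset (Set X)} (hF : Laminar F) {σ w : Measure X} (hσ : Good F σ)
    (hw : Good F w) {τ : Set X → ℝ≥0∞} {p p' q q' : ℝ} (hp : p.HolderConjugate p')
    (hq : q.HolderConjugate q') (hpq : p ≤ q) {f g : X → ℝ≥0∞} (hf : Measurable f)
    (hg : Measurable g)
    (hf1 : ∫⁻ x, f x ^ p ∂σ ≤ 1) (hg1 : ∫⁻ x, g x ^ q' ∂w ≤ 1)
    {T T' : ℝ≥0∞} (hT : Testing F τ σ w p q T) (hT' : Testing F τ w σ q' p' T') :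
    ∑ Q ∈ F, τ Q * (∫⁻ x in Q, f x ∂σ) * (∫⁻ x in Q, g x ∂w) ≤ testingConst p q * (T + T') := by
  classical
  set a : Set X → ℝ≥0∞ := fun Q => τ Q * (∫⁻ x in Q, f x ∂σ) * (∫⁻ x in Q, g x ∂w) with ha
  have hq'e : q.conjExponent = q' := hq.conjExponent_eq
  -- Cubes with a vanishing integral contribute nothing, but their means have no dyadic level.
  set G := F.filter fun Q => ∫⁻ x in Q, f x ∂σ ≠ 0 ∧ ∫⁻ x in Q, g x ∂w ≠ 0 with hG
  have hGF : G ⊆ F := Finset.filter_subset _ _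
  have hsum : ∑ Q ∈ F, a Q = ∑ Q ∈ G, a Q := by
    rw [hG, Finset.sum_filter_of_ne]
    intro Q hQ h
    simp only [ha, Ne, mul_eq_zero, not_or] at h
    exact ⟨h.1.2, h.2⟩
  have hft : ∀ Q ∈ F, ∫⁻ x in Q, f x ∂σ ≠ ⊤ := fun Q hQ =>
    ne_top_of_le_ne_top (ENNReal.mul_ne_top
      (ENNReal.rpow_ne_top_of_nonneg (one_div_nonneg.2 hp.nonneg)
        (ne_top_of_le_ne_top (by simp) hf1))
      (ENNReal.rpow_ne_top_of_nonneg (one_div_nonneg.2 hp.symm.nonneg) (hσ.ne_top Q hQ)))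
      (setLIntegral_le_Lp_mul hf hp Q)
  have hgt : ∀ Q ∈ F, ∫⁻ x in Q, g x ∂w ≠ ⊤ := fun Q hQ =>
    ne_top_of_le_ne_top (ENNReal.mul_ne_top
      (ENNReal.rpow_ne_top_of_nonneg (one_div_nonneg.2 hq.symm.nonneg)
        (ne_top_of_le_ne_top (by simp) hg1))
      (ENNReal.rpow_ne_top_of_nonneg (one_div_nonneg.2 hq.nonneg) (hw.ne_top Q hQ)))
      (setLIntegral_le_Lp_mul hg hq.symm Q)
  rw [hsum, ← Finset.sum_filter_add_sum_filter_not G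
    (fun Q => mean w g Q ^ q' * w Q ≤ mean σ f Q ^ p * σ Q)]
  set A := G.filter (fun Q => mean w g Q ^ q' * w Q ≤ mean σ f Q ^ p * σ Q) with hA
  set B := G.filter (fun Q => ¬ (mean w g Q ^ q' * w Q ≤ mean σ f Q ^ p * σ Q)) with hB
  have hAF : A ⊆ F := (Finset.filter_subset _ _).trans hGF
  have hBF : B ⊆ F := (Finset.filter_subset _ _).trans hGF
  have h1 := bilinear_half (hF.mono hAF) (hσ.mono hAF) (hw.mono hAF) hp hq hpq hf hg
    (fun Q hQ => (Finset.mem_filter.1 (Finset.mem_filter.1 hQ).1).2.1)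
    (fun Q hQ => hft Q (hAF hQ)) hf1 hg1 (fun Q hQ => (Finset.mem_filter.1 hQ).2)
    (hT.mono hAF hq.pos)
  have hq'p' : q' ≤ p' := by
    have := holder_exponents hp hq hpq
    rwa [one_le_div hq.symm.pos] at this
  have h2 := bilinear_half (hF.mono hBF) (hw.mono hBF) (hσ.mono hBF) hq.symm hp.symm hq'p' hg hf
    (fun Q hQ => (Finset.mem_filter.1 (Finset.mem_filter.1 hQ).1).2.2)
    (fun Q hQ => hgt Q (hBF hQ)) hg1 hf1
    (fun Q hQ => (not_le.1 (Finset.mem_filter.1 hQ).2).le)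
    (hT'.mono hBF hp.symm.pos)
  have h3 : ∑ Q ∈ B, a Q = ∑ Q ∈ B, τ Q * (∫⁻ x in Q, g x ∂w) * (∫⁻ x in Q, f x ∂σ) :=
    Finset.sum_congr rfl fun Q _ => by simp only [ha]; ring
  rw [h3]
  refine (add_le_add h1 h2).trans ?_
  rw [testingConst, hq'e]
  rw [add_mul]
  exact add_le_add (mul_le_mul' le_rfl le_self_add) (mul_le_mul' le_rfl le_add_self)

lemma bilinear_bound {F : Finset (Set X)} (hF : Laminar F) {σ w : Measure X} (hσ : Good F σ)
    (hw : Good F w) {τ : Set X → ℝ≥0∞} {p p' q q' : ℝ} (hp : p.HolderConjugate p')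
    (hq : q.HolderConjugate q') (hpq : p ≤ q) {f g : X → ℝ≥0∞} (hf : Measurable f)
    (hg : Measurable g)
    (hft : ∫⁻ x, f x ^ p ∂σ ≠ ⊤) (hgt : ∫⁻ x, g x ^ q' ∂w ≠ ⊤)
    {T T' : ℝ≥0∞} (hT : Testing F τ σ w p q T) (hT' : Testing F τ w σ q' p' T') :
    ∑ Q ∈ F, τ Q * (∫⁻ x in Q, f x ∂σ) * (∫⁻ x in Q, g x ∂w) ≤
      testingConst p q * (T + T') * (∫⁻ x, f x ^ p ∂σ) ^ (1 / p)
        * (∫⁻ x, g x ^ q' ∂w) ^ (1 / q') := by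
  set I := (∫⁻ x, f x ^ p ∂σ) ^ (1 / p) with hI
  set J := (∫⁻ x, g x ^ q' ∂w) ^ (1 / q') with hJ
  have hIt : I ≠ ⊤ := ENNReal.rpow_ne_top_of_nonneg (one_div_nonneg.2 hp.nonneg) hft
  have hJt : J ≠ ⊤ := ENNReal.rpow_ne_top_of_nonneg (one_div_nonneg.2 hq.symm.nonneg) hgt
  rcases eq_or_ne I 0 with hI0 | hI0
  · rw [Finset.sum_eq_zero]; · exact zero_le
    intro Q hQ
    have := setLIntegral_le_Lp_mul hf hp Q (σ := σ)
    rw [← hI, hI0, zero_mul] at this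
    simp [le_zero_iff.1 this]
  rcases eq_or_ne J 0 with hJ0 | hJ0
  · rw [Finset.sum_eq_zero]; · exact zero_le
    intro Q hQ
    have := setLIntegral_le_Lp_mul hg hq.symm Q (σ := w)
    rw [← hJ, hJ0, zero_mul] at this
    simp [le_zero_iff.1 this]
  have norm1 : ∀ {μ : Measure X} {h : X → ℝ≥0∞} {r : ℝ}, Measurable h → 0 < r →
      (∫⁻ x, h x ^ r ∂μ) ^ (1 / r) ≠ 0 → (∫⁻ x, h x ^ r ∂μ) ^ (1 / r) ≠ ⊤ →
      ∫⁻ x, (h x / (∫⁻ x, h x ^ r ∂μ) ^ (1 / r)) ^ r ∂μ ≤ 1 := by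
    intro μ h r hh hr h0 ht
    simp only [ENNReal.div_rpow_of_nonneg _ _ hr.le]
    simp only [div_eq_mul_inv]
    rw [lintegral_mul_const _ (hh.pow_const r), ← ENNReal.rpow_mul]
    rw [one_mul, inv_mul_cancel₀ hr.ne', ENNReal.rpow_one]
    exact ENNReal.div_self_le_one
  have h := bilinear_normalized hF hσ hw hp hq hpq (hf.div_const I) (hg.div_const J)
    (norm1 hf hp.pos hI0 hIt) (norm1 hg hq.symm.pos hJ0 hJt) hT hT'
  have e : ∀ Q, τ Q * (∫⁻ x in Q, f x ∂σ) * (∫⁻ x in Q, g x ∂w) =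
      (τ Q * (∫⁻ x in Q, f x / I ∂σ) * (∫⁻ x in Q, g x / J ∂w)) * (I * J) := fun Q => by
    simp only [div_eq_mul_inv]
    rw [lintegral_mul_const _ hf, lintegral_mul_const _ hg]
    calc _ = τ Q * (∫⁻ x in Q, f x ∂σ) * (∫⁻ x in Q, g x ∂w) * ((I⁻¹ * I) * (J⁻¹ * J)) := by
          rw [ENNReal.inv_mul_cancel hI0 hIt, ENNReal.inv_mul_cancel hJ0 hJt]; simp
      _ = _ := by ring
  simp only [e]
  rw [← Finset.sum_mul, mul_assoc]
  exact mul_le_mul' h le_rfl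

/-- The positive dyadic operator `f ↦ ∑ τ_Q (∫_Q f dσ) 1_Q`. -/
def dyadicOp (F : Finset (Set X)) (τ : Set X → ℝ≥0∞) (σ : Measure X) (f : X → ℝ≥0∞) (x : X) :
    ℝ≥0∞ :=
  ∑ Q ∈ F, Q.indicator (fun _ => τ Q * ∫⁻ y in Q, f y ∂σ) x

lemma measurable_dyadicOp {F : Finset (Set X)} (hm : ∀ Q ∈ F, MeasurableSet Q)
    (τ : Set X → ℝ≥0∞) (σ : Measure X) (f : X → ℝ≥0∞) : Measurable (dyadicOp F τ σ f) :=
  Finset.measurable_sum _ fun Q hQ => measurable_const.indicator (hm Q hQ)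

/-- The two-weight testing theorem for positive dyadic operators. -/
theorem dyadicOp_bound {F : Finset (Set X)} (hF : Laminar F) {σ w : Measure X} (hσ : Good F σ)
    (hw : Good F w) {τ : Set X → ℝ≥0∞} (hτ : ∀ Q ∈ F, τ Q ≠ ⊤) {p p' q q' : ℝ}
    (hp : p.HolderConjugate p')
    (hq : q.HolderConjugate q') (hpq : p ≤ q) {f : X → ℝ≥0∞} (hf : Measurable f)
    (hft : ∫⁻ x, f x ^ p ∂σ ≠ ⊤)
    {T T' : ℝ≥0∞} (hT : Testing F τ σ w p q T) (hT' : Testing F τ w σ q' p' T') :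
    (∫⁻ x, dyadicOp F τ σ f x ^ q ∂w) ^ (1 / q) ≤
      testingConst p q * (T + T') * (∫⁻ x, f x ^ p ∂σ) ^ (1 / p) := by
  classical
  set U := dyadicOp F τ σ f with hU
  have hUm : Measurable U := measurable_dyadicOp hσ.meas τ σ f
  have hfQ : ∀ Q ∈ F, ∫⁻ x in Q, f x ∂σ ≠ ⊤ := fun Q hQ =>
    ne_top_of_le_ne_top (ENNReal.mul_ne_top
      (ENNReal.rpow_ne_top_of_nonneg (one_div_nonneg.2 hp.nonneg) hft)
      (ENNReal.rpow_ne_top_of_nonneg (one_div_nonneg.2 hp.symm.nonneg) (hσ.ne_top Q hQ)))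
      (setLIntegral_le_Lp_mul hf hp Q)
  set M := ∑ Q ∈ F, τ Q * ∫⁻ y in Q, f y ∂σ with hM
  have hMt : M ≠ ⊤ := ENNReal.sum_ne_top.2 fun Q hQ => ENNReal.mul_ne_top (hτ Q hQ) (hfQ Q hQ)
  have hUM : ∀ x, U x ≤ M := fun x => Finset.sum_le_sum fun Q _ => indicator_le_self _ _ _
  -- Finiteness is needed because a power of V is cancelled at the end; it comes from the finiteness
  -- of the family.
  have hVt : ∫⁻ x, U x ^ q ∂w ≠ ⊤ := by
    have h1 : ∀ x, U x ^ q ≤ ∑ Q ∈ F, Q.indicator (fun _ => M ^ q) x := by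
      intro x
      by_cases hx : ∃ Q ∈ F, x ∈ Q
      · obtain ⟨Q, hQ, hxQ⟩ := hx
        calc U x ^ q ≤ M ^ q := ENNReal.rpow_le_rpow (hUM x) hq.nonneg
          _ = Q.indicator (fun _ => M ^ q) x := by simp [hxQ]
          _ ≤ _ := Finset.single_le_sum (f := fun Q : Set X => Q.indicator (fun _ => M ^ q) x)
            (fun _ _ => zero_le) hQ
      · push Not at hx
        have : U x = 0 := Finset.sum_eq_zero fun Q hQ => indicator_of_notMem (hx Q hQ) _
        rw [this, ENNReal.zero_rpow_of_pos hq.pos]; exact zero_le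
    refine ne_top_of_le_ne_top ?_ (lintegral_mono h1)
    rw [lintegral_finsetSum _ fun Q hQ => measurable_const.indicator (hσ.meas Q hQ)]
    refine ENNReal.sum_ne_top.2 fun Q hQ => ?_
    rw [lintegral_indicator (hσ.meas Q hQ), setLIntegral_const]
    exact ENNReal.mul_ne_top (ENNReal.rpow_ne_top_of_nonneg hq.nonneg hMt) (hw.ne_top Q hQ)
  set V := ∫⁻ x, U x ^ q ∂w with hV
  rcases eq_or_ne V 0 with hV0 | hV0
  · rw [hV0, ENNReal.zero_rpow_of_pos (one_div_pos.2 hq.pos)]; exact zero_le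
  have hqm : 0 < q - 1 := by linarith [hq.lt]
  have hgq : ∀ x, (U x ^ (q - 1)) ^ q' = U x ^ q := fun x => by
    rw [← ENNReal.rpow_mul]; congr 1
    exact hq.sub_one_mul_conj
  -- The dual function is U^(q - 1): its q'-th power is U^q, and pairing it with U gives V on the
  -- left and V^(1/q') on the right.
  have h := bilinear_bound hF hσ hw hp hq hpq hf (hUm.pow_const (q - 1)) hft
    (by simpa only [hgq] using hVt) hT hT'
  simp only [hgq] at h
  have e : ∑ Q ∈ F, τ Q * (∫⁻ x in Q, f x ∂σ) * (∫⁻ x in Q, U x ^ (q - 1) ∂w) = V := by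
    have e1 : ∀ Q ∈ F, τ Q * (∫⁻ x in Q, f x ∂σ) * (∫⁻ x in Q, U x ^ (q - 1) ∂w) =
        ∫⁻ x, Q.indicator (fun _ => τ Q * ∫⁻ y in Q, f y ∂σ) x * U x ^ (q - 1) ∂w := fun Q hQ => by
      rw [← lintegral_const_mul _ (hUm.pow_const _), ← lintegral_indicator (hσ.meas Q hQ)]
      refine lintegral_congr fun x => ?_
      by_cases hx : x ∈ Q <;> simp [hx]
    rw [Finset.sum_congr rfl e1]
    have hmul : ∀ Q ∈ F, Measurable fun x : X =>
        Q.indicator (fun _ => τ Q * ∫⁻ y in Q, f y ∂σ) x * U x ^ (q - 1) := fun Q hQ =>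
      (measurable_const.indicator (hσ.meas Q hQ)).mul (hUm.pow_const _)
    rw [← lintegral_finsetSum _ hmul]
    refine lintegral_congr fun x => ?_
    rw [← Finset.sum_mul]
    change U x * U x ^ (q - 1) = U x ^ q
    have hUt : U x ≠ ⊤ := ne_top_of_le_ne_top hMt (hUM x)
    rcases eq_or_ne (U x) 0 with h0 | h0
    · rw [h0, zero_mul, ENNReal.zero_rpow_of_pos hq.pos]
    · conv_lhs => rw [← ENNReal.rpow_one (U x), ← ENNReal.rpow_mul, ← ENNReal.rpow_add _ _ h0 hUt]
      congr 1; ring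
  rw [e] at h
  set N := testingConst p q * (T + T') * (∫⁻ x, f x ^ p ∂σ) ^ (1 / p)
  have hVq0 : V ^ (1 / q') ≠ 0 := by simp [ENNReal.rpow_eq_zero_iff, hV0, hVt]
  have hVqt : V ^ (1 / q') ≠ ⊤ := ENNReal.rpow_ne_top_of_nonneg (one_div_nonneg.2 hq.symm.nonneg) hVt
  have e2 : V = V ^ (1 / q) * V ^ (1 / q') := by
    rw [← ENNReal.rpow_add _ _ hV0 hVt, one_div, one_div, hq.inv_add_inv_eq_one, ENNReal.rpow_one]
  exact (ENNReal.mul_le_mul_iff_left hVq0 hVqt).1 (e2.symm.trans_le h)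

end SepBump

/-! ### A numerical inequality for chains of distinct levels -/

namespace SepBump

/-- The constant in `chain_sum_le`. -/
def chainConst (q : ℝ) : ℝ≥0∞ := ∑' m : ℕ, ENNReal.ofReal ((1 + 2 * q * m) * (2 * (1 / 2) ^ m))

lemma chainConst_ne_top {q : ℝ} (hq : 0 < q) : chainConst q ≠ ⊤ := by
  have h1 : Summable fun m : ℕ => ((1 / 2 : ℝ)) ^ m := summable_geometric_of_lt_one (by norm_num) (by norm_num)
  have h2 : Summable fun m : ℕ => (m : ℝ) ^ 1 * (1 / 2 : ℝ) ^ m :=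
    summable_pow_mul_geometric_of_norm_lt_one 1 (by norm_num)
  have h3 : Summable fun m : ℕ => (1 + 2 * q * m) * (2 * (1 / 2 : ℝ) ^ m) := by
    refine ((h1.mul_left 2).add (h2.mul_left (4 * q))).congr fun m => ?_
    ring
  rw [chainConst, ← ENNReal.ofReal_tsum_of_nonneg (fun m => by positivity) h3]
  exact ENNReal.ofReal_ne_top

lemma card_le_of_injOn_int {ι : Type*} (s : Finset ι) (κ : ι → ℤ) (hκ : Set.InjOn κ s)
    (hs : s.Nonempty) : ∃ i ∈ s, ∃ j ∈ s, (s.card : ℤ) ≤ κ i - κ j + 1 := by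
  obtain ⟨i, hi, hmax⟩ := s.exists_max_image κ hs
  obtain ⟨j, hj, hmin⟩ := s.exists_min_image κ hs
  refine ⟨i, hi, j, hj, ?_⟩
  have h := Finset.card_le_card_of_injOn (t := Finset.Icc (κ j) (κ i)) κ
    (fun k hk => by simp [hmax k hk, hmin k hk]) hκ
  have h0 := hmax j hj
  rw [Int.card_Icc] at h
  omega

/-- Let ρ^q be the double sum. Its diagonal gives l_i ≤ ρ. In the layer where l_i ≈ 2^(-m) ρ, the
pair of extreme levels already forces κ_i - κ_j ≤ 2qm, so injectivity leaves at most 1 + 2qm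
members. The layers then add up to a constant multiple of ρ. In this way an arbitrary real power q
is replaced by a double sum over nested pairs, whose growing factor 2^((κ_i - κ_j)/2) is affordable
by `sum_records_half_le`. -/
lemma chain_sum_le {ι : Type*} (s : Finset ι) (κ : ι → ℤ) (hκ : Set.InjOn κ s) (l : ι → ℝ≥0∞)
    (h0 : ∀ i ∈ s, l i ≠ 0) (ht : ∀ i ∈ s, l i ≠ ⊤) {c e q : ℝ} (hc : 0 ≤ c) (he : 0 ≤ e)
    (hq : 0 < q) (hce : c + e = q) :
    ∑ i ∈ s, l i ≤ chainConst q * (∑ i ∈ s, ∑ j ∈ s, if κ j ≤ κ i then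
      (2 : ℝ≥0∞) ^ (((κ i : ℝ) - κ j) / 2) * l i ^ c * l j ^ e else 0) ^ (1 / q) := by
  classical
  set R := ∑ i ∈ s, ∑ j ∈ s, if κ j ≤ κ i then
      (2 : ℝ≥0∞) ^ (((κ i : ℝ) - κ j) / 2) * l i ^ c * l j ^ e else 0 with hR
  have hRle : ∀ i ∈ s, ∀ j ∈ s, κ j ≤ κ i →
      (2 : ℝ≥0∞) ^ (((κ i : ℝ) - κ j) / 2) * l i ^ c * l j ^ e ≤ R := by
    intro i hi j hj hij
    refine le_trans ?_ (Finset.single_le_sum (f := fun i => ∑ j ∈ s, if κ j ≤ κ i then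
      (2 : ℝ≥0∞) ^ (((κ i : ℝ) - κ j) / 2) * l i ^ c * l j ^ e else 0) (fun _ _ => zero_le) hi)
    refine le_trans ?_ (Finset.single_le_sum (f := fun j => if κ j ≤ κ i then
      (2 : ℝ≥0∞) ^ (((κ i : ℝ) - κ j) / 2) * l i ^ c * l j ^ e else 0) (fun _ _ => zero_le) hj)
    simp [hij]
  set ρ := R ^ (1 / q) with hρ
  have hρq : ρ ^ q = R := by
    rw [hρ, ← ENNReal.rpow_mul, one_div_mul_cancel hq.ne', ENNReal.rpow_one]
  have hCpos : chainConst q ≠ 0 := by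
    intro h
    rw [chainConst, ENNReal.tsum_eq_zero] at h
    have := h 0
    simp at this

  rcases s.eq_empty_or_nonempty with rfl | ⟨i₀, hi₀⟩
  · simp
  rcases eq_or_ne ρ ⊤ with hρt | hρt
  · rw [hρt, ENNReal.mul_top hCpos]; exact le_top
  have hlρ : ∀ i ∈ s, l i ≤ ρ := by
    intro i hi
    have h := hRle i hi i hi le_rfl
    rw [sub_self, zero_div, ENNReal.rpow_zero, one_mul,
      ← ENNReal.rpow_add _ _ (h0 i hi) (ht i hi), hce, ← hρq] at h
    exact (ENNReal.rpow_le_rpow_iff hq).1 h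
  have hρ0 : ρ ≠ 0 := fun h => h0 i₀ hi₀ (le_zero_iff.1 (h ▸ hlρ i₀ hi₀))
  have hx0 : ∀ i ∈ s, l i / ρ ≠ 0 := fun i hi => by simp [ENNReal.div_eq_zero_iff, h0 i hi, hρt]
  have hxt : ∀ i ∈ s, l i / ρ ≠ ⊤ := fun i hi => ENNReal.div_ne_top (ht i hi) hρ0
  set m : ι → ℕ := fun i => (-level (l i / ρ)).toNat with hm
  have hmr : ∀ i ∈ s, (level (l i / ρ) : ℝ) = -(m i : ℝ) := by
    intro i hi
    have h1 : (2 : ℝ≥0∞) ^ (level (l i / ρ) : ℝ) ≤ 2 ^ (0 : ℝ) := by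
      refine (level_spec (hx0 i hi) (hxt i hi)).1.trans ?_
      rw [ENNReal.rpow_zero]
      exact ENNReal.div_le_of_le_mul (by simpa using hlρ i hi)
    rw [two_rpow_le_iff] at h1
    have h2 : level (l i / ρ) ≤ 0 := by exact_mod_cast h1
    have h3 : ((m i : ℕ) : ℤ) = - level (l i / ρ) := Int.toNat_of_nonneg (by omega)
    have h4 : level (l i / ρ) = -(m i : ℤ) := by omega
    rw [h4]; push_cast; rfl
  have hlow : ∀ i ∈ s, 2 ^ (-(m i : ℝ)) * ρ ≤ l i := fun i hi => by
    have := (level_spec (hx0 i hi) (hxt i hi)).1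
    rw [hmr i hi, ENNReal.le_div_iff_mul_le (Or.inl hρ0) (Or.inl hρt)] at this
    exact this
  have hup : ∀ i ∈ s, l i ≤ 2 ^ (-(m i : ℝ) + 1) * ρ := fun i hi => by
    have := (level_spec (hx0 i hi) (hxt i hi)).2.le
    rw [hmr i hi, ENNReal.div_le_iff_le_mul (Or.inl hρ0) (Or.inl hρt)] at this
    exact this
  -- Both members of the extreme pair are at least 2^(-k) ρ, so their term is at least 2^((κ i - κ
  -- j)/2 - kq) ρ^q, and it is at most ρ^q.
  have hcard : ∀ k : ℕ, ((s.filter (m · = k)).card : ℝ) ≤ 1 + 2 * q * k := by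
    intro k
    rcases (s.filter (m · = k)).eq_empty_or_nonempty with h | h
    · rw [h]; simp; positivity
    obtain ⟨i, hi, j, hj, hij⟩ := card_le_of_injOn_int (s.filter (m · = k)) κ
      (hκ.mono fun x hx => (Finset.mem_filter.1 hx).1) h
    have hcpos : 0 < (s.filter (m · = k)).card := h.card_pos
    obtain ⟨hi, hik⟩ := Finset.mem_filter.1 hi
    obtain ⟨hj, hjk⟩ := Finset.mem_filter.1 hj
    have h1 := hRle i hi j hj (by omega)
    have h2 : (2 : ℝ≥0∞) ^ (((κ i : ℝ) - κ j) / 2) * (2 ^ (-(k : ℝ)) * ρ) ^ c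
        * (2 ^ (-(k : ℝ)) * ρ) ^ e ≤ 1 * ρ ^ q := by
      rw [hρq, one_mul]
      refine le_trans ?_ h1
      gcongr
      · simpa [hik] using hlow i hi
      · simpa [hjk] using hlow j hj
    have h3 : 2 ^ (-(k : ℝ)) * ρ ≠ 0 := mul_ne_zero (two_rpow_ne_zero _) hρ0
    have h4 : 2 ^ (-(k : ℝ)) * ρ ≠ ⊤ := ENNReal.mul_ne_top (two_rpow_ne_top _) hρt
    rw [mul_assoc, ← ENNReal.rpow_add _ _ h3 h4, hce, ENNReal.mul_rpow_of_nonneg _ _ hq.le,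
      ← mul_assoc, ENNReal.mul_le_mul_iff_left (by rw [hρq]; intro h; simp [hρ, h, hq] at hρ0)
        (ENNReal.rpow_ne_top_of_nonneg hq.le hρt), ← ENNReal.rpow_mul, ← two_rpow_add,
      ← ENNReal.rpow_zero (x := 2), two_rpow_le_iff] at h2
    have h5 : ((s.filter (m · = k)).card : ℝ) ≤ κ i - κ j + 1 := by exact_mod_cast hij
    linarith
  have hsum : ∑ i ∈ s, l i ≤ ∑ k ∈ s.image m, ENNReal.ofReal ((1 + 2 * q * k) * (2 * (1 / 2) ^ k)) * ρ := by
    rw [← Finset.sum_fiberwise_of_maps_to (t := s.image m) (g := m)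
      (fun i hi => Finset.mem_image_of_mem m hi)]
    refine Finset.sum_le_sum fun k _ => ?_
    calc ∑ i ∈ s with m i = k, l i ≤ ∑ i ∈ s with m i = k, 2 ^ (-(k : ℝ) + 1) * ρ := by
          refine Finset.sum_le_sum fun i hi => ?_
          obtain ⟨hi, hik⟩ := Finset.mem_filter.1 hi
          simpa [hik] using hup i hi
      _ = ((s.filter (m · = k)).card : ℝ≥0∞) * (2 ^ (-(k : ℝ) + 1) * ρ) := by
          rw [Finset.sum_const, nsmul_eq_mul]
      _ ≤ ENNReal.ofReal (1 + 2 * q * k) * (ENNReal.ofReal (2 * (1 / 2) ^ k) * ρ) := by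
          refine mul_le_mul' ?_ (mul_le_mul' (le_of_eq ?_) le_rfl)
          · rw [← ENNReal.ofReal_natCast]
            exact ENNReal.ofReal_le_ofReal (hcard k)
          · rw [two_rpow_add, ENNReal.rpow_neg, ENNReal.rpow_natCast, ENNReal.rpow_one, mul_comm,
              ENNReal.ofReal_mul (by norm_num), ENNReal.ofReal_pow (by norm_num),
              one_div, ENNReal.ofReal_inv_of_pos (by norm_num), ENNReal.inv_pow]
            norm_num
      _ = _ := by rw [ENNReal.ofReal_mul (p := 1 + 2 * q * k) (by positivity)]; exact (mul_assoc _ _ _).symm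
  refine hsum.trans ?_
  rw [← Finset.sum_mul]
  gcongr
  exact ENNReal.sum_le_tsum _

end SepBump

/-! ### Sparseness of the records of the density -/

namespace SepBump
variable {X : Type*}

open Classical in
/-- The points of `P` outside the records of density exceeding that of `P` by three levels. -/
def thickPart (F : Finset (Set X)) (κ : Set X → ℤ) (P : Set X) : Set X :=
  P \ ⋃ S ∈ (records F κ).filter (fun S => S ⊆ P ∧ κ P + 3 ≤ κ S), S

open Classical in
-- Four records through x have distinct levels, so two of them differ by at least three; the denser
-- one lies inside the other and is removed from its thick part.
lemma card_thickPart_le {F : Finset (Set X)} (hF : Laminar F) (κ : Set X → ℤ) (x : X) :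
    ((records F κ).filter (x ∈ thickPart F κ ·)).card ≤ 3 := by
  set s := (records F κ).filter (x ∈ thickPart F κ ·)
  rcases s.eq_empty_or_nonempty with h | h
  · simp [h]
  obtain ⟨P, hP, Q, hQ, hPQ⟩ := card_le_of_injOn_int s κ (fun P hP Q hQ h => by
    have hP := Finset.mem_filter.1 hP
    have hQ := Finset.mem_filter.1 hQ
    exact records_level_inj hF hP.1 hQ.1 hP.2.1 hQ.2.1 h) h
  obtain ⟨hP, hxP⟩ := Finset.mem_filter.1 hP
  obtain ⟨hQ, hxQ⟩ := Finset.mem_filter.1 hQ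
  by_contra hcard
  push Not at hcard
  have h3 : κ Q + 3 ≤ κ P := by omega
  rcases hF.subset_or_ssubset (records_subset F κ hP) (records_subset F κ hQ) hxP.1 hxQ.1 with h | h
  · exact hxQ.2 (mem_biUnion (by simp [hP, h, h3]) hxP.1)
  · have := records_level_le hQ hP h.1
    omega

lemma exists_top {F : Finset (Set X)} {P : Set X} (hP : P ∈ F) :
    ∃ T ∈ F, P ⊆ T ∧ ∀ S ∈ F, ¬ T ⊂ S := by
  obtain ⟨T, hPT, hT⟩ := F.exists_le_maximal hP
  exact ⟨T, hT.1, hPT, fun S hS h => h.2 (hT.2 hS h.1)⟩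

variable [MeasurableSpace X]

/-- The density `σ(Q) / μ(Q)`, as a dyadic level. -/
def densityLevel (μ σ : Measure X) (Q : Set X) : ℤ := level (σ Q / μ Q)

lemma densityLevel_le {F : Finset (Set X)} {μ σ : Measure X} (hμ : Good F μ) (hσ : Good F σ)
    {Q : Set X} (hQ : Q ∈ F) :
    2 ^ (densityLevel μ σ Q : ℝ) * μ Q ≤ σ Q := by
  have h := (level_spec (x := σ Q / μ Q)
    (by simp [ENNReal.div_eq_zero_iff, hσ.ne_zero Q hQ, hμ.ne_top Q hQ])
    (ENNReal.div_ne_top (hσ.ne_top Q hQ) (hμ.ne_zero Q hQ))).1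
  rwa [ENNReal.le_div_iff_mul_le (Or.inl (hμ.ne_zero Q hQ)) (Or.inl (hμ.ne_top Q hQ))] at h

lemma le_densityLevel {F : Finset (Set X)} {μ σ : Measure X} (hμ : Good F μ) (hσ : Good F σ)
    {Q : Set X} (hQ : Q ∈ F) :
    σ Q ≤ 2 ^ ((densityLevel μ σ Q : ℝ) + 1) * μ Q := by
  have h := (level_spec (x := σ Q / μ Q)
    (by simp [ENNReal.div_eq_zero_iff, hσ.ne_zero Q hQ, hμ.ne_top Q hQ])
    (ENNReal.div_ne_top (hσ.ne_top Q hQ) (hμ.ne_zero Q hQ))).2.le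
  rwa [ENNReal.div_le_iff_le_mul (Or.inl (hμ.ne_zero Q hQ)) (Or.inl (hμ.ne_top Q hQ))] at h

/-- Records of the density pack: this is the sparseness of the family of records. -/
lemma sum_records_measure_le {F : Finset (Set X)} {μ σ : Measure X} (hμ : Good F μ) (hσ : Good F σ)
    (hF : Laminar F) {P : Set X}
    (G : Finset (Set X)) (hG : G ⊆ records F (densityLevel μ σ)) (hGP : ∀ Q ∈ G, Q ⊆ P)
    {a : ℝ} {k₀ : ℤ} (hk : ∀ Q ∈ G, k₀ ≤ densityLevel μ σ Q) :
    ∑ Q ∈ G, 2 ^ ((densityLevel μ σ Q : ℝ) * (1 - a)) * μ Q ≤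
      2 ^ (-(k₀ : ℝ) * a) * geomConst a * σ P := by
  classical
  set κ := densityLevel μ σ
  have hGF : G ⊆ F := hG.trans (records_subset F κ)
  calc ∑ Q ∈ G, 2 ^ ((κ Q : ℝ) * (1 - a)) * μ Q
      -- Since 2^(κ Q) μ(Q) ≤ σ(Q), the weight becomes 2^(-κ Q a) against σ; for fixed x this is a
      -- geometric sum over distinct levels, headed by k₀.
      ≤ ∑ Q ∈ G, ∫⁻ x in P, Q.indicator (fun _ => (2 : ℝ≥0∞) ^ (-(κ Q : ℝ) * a)) x ∂σ := by
        refine Finset.sum_le_sum fun Q hQ => ?_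
        rw [lintegral_indicator (hσ.meas Q (hGF hQ)), setLIntegral_const,
          Measure.restrict_apply (hσ.meas Q (hGF hQ)), inter_eq_left.2 (hGP Q hQ)]
        calc _ = 2 ^ (-(κ Q : ℝ) * a) * (2 ^ (κ Q : ℝ) * μ Q) := by
              rw [← mul_assoc, ← two_rpow_add]; congr 2; ring
          _ ≤ _ := by gcongr; exact densityLevel_le hμ hσ (hGF hQ)
    _ = ∫⁻ x in P, ∑ Q ∈ G, Q.indicator (fun _ => (2 : ℝ≥0∞) ^ (-(κ Q : ℝ) * a)) x ∂σ := by
        rw [lintegral_finsetSum _ fun Q hQ => measurable_const.indicator (hσ.meas Q (hGF hQ))]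
    _ ≤ ∫⁻ x in P, 2 ^ (-(k₀ : ℝ) * a) * geomConst a ∂σ := by
        refine lintegral_mono fun x => ?_
        simp only [indicator_apply]
        rw [← Finset.sum_filter]
        refine sum_geom_ge (G.filter (x ∈ ·)) κ (fun Q hQ S hS h => ?_) a k₀ fun Q hQ =>
          hk Q (Finset.mem_filter.1 hQ).1
        have hQ := Finset.mem_filter.1 hQ
        have hS := Finset.mem_filter.1 hS
        exact records_level_inj hF (hG hQ.1) (hG hS.1) hQ.2 hS.2 h
    _ = _ := setLIntegral_const _ _

/-- With the full density ratio each term would be comparable to a multiple of σ(Q), and nested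
records would not sum. The square root of the ratio leaves a geometrically decaying factor against
σ. -/
lemma sum_records_half_le {F : Finset (Set X)} {μ σ : Measure X} (hμ : Good F μ) (hσ : Good F σ)
    (hF : Laminar F) {P : Set X} (hP : P ∈ records F (densityLevel μ σ))
    (G : Finset (Set X)) (hG : G ⊆ records F (densityLevel μ σ)) (hGP : ∀ Q ∈ G, Q ⊆ P) :
    ∑ Q ∈ G, 2 ^ (((densityLevel μ σ Q : ℝ) - densityLevel μ σ P) / 2) * μ Q ≤
      2 * geomConst (1 / 2) * μ P := by
  set κ := densityLevel μ σ
  have hPF := records_subset F κ hP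
  have h := sum_records_measure_le hμ hσ hF G hG hGP (a := 1 / 2) (k₀ := κ P)
    fun Q hQ => records_level_le (hG hQ) hP (hGP Q hQ)
  calc ∑ Q ∈ G, 2 ^ (((κ Q : ℝ) - κ P) / 2) * μ Q
      = 2 ^ (-(κ P : ℝ) / 2) * ∑ Q ∈ G, 2 ^ ((κ Q : ℝ) * (1 - 1 / 2)) * μ Q := by
        rw [Finset.mul_sum]
        refine Finset.sum_congr rfl fun Q _ => ?_
        rw [← mul_assoc, ← two_rpow_add]; congr 2; ring
    _ ≤ 2 ^ (-(κ P : ℝ) / 2) * (2 ^ (-(κ P : ℝ) * (1 / 2)) * geomConst (1 / 2) * σ P) := by gcongr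
    _ ≤ 2 ^ (-(κ P : ℝ) / 2) * (2 ^ (-(κ P : ℝ) * (1 / 2)) * geomConst (1 / 2) *
          (2 ^ ((κ P : ℝ) + 1) * μ P)) := by gcongr; exact le_densityLevel hμ hσ hPF
    _ = (2 ^ (-(κ P : ℝ) / 2) * 2 ^ (-(κ P : ℝ) * (1 / 2)) * 2 ^ ((κ P : ℝ) + 1)) *
          geomConst (1 / 2) * μ P := by ring
    _ = _ := by
        rw [← two_rpow_add, ← two_rpow_add]
        have : -(κ P : ℝ) / 2 + -(κ P : ℝ) * (1 / 2) + ((κ P : ℝ) + 1) = 1 := by ring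
        rw [this, ENNReal.rpow_one]

/-- The removed records have total measure at most 2 · 2^(-(κ P + 3)) σ(P), and σ(P) ≤ 2^(κ P + 1)
μ(P): three levels are just enough for the fraction one half. -/
lemma measure_le_two_mul_thickPart {F : Finset (Set X)} {μ σ : Measure X} (hμ : Good F μ) (hσ : Good F σ)
    (hF : Laminar F) {P : Set X}
    (hP : P ∈ records F (densityLevel μ σ)) :
    μ P ≤ 2 * μ (thickPart F (densityLevel μ σ) P) := by
  classical
  set κ := densityLevel μ σ
  have hPF := records_subset F κ hP
  set G := (records F κ).filter (fun S => S ⊆ P ∧ κ P + 3 ≤ κ S) with hG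
  have h := sum_records_measure_le hμ hσ hF G (Finset.filter_subset _ _)
    (fun Q hQ => (Finset.mem_filter.1 hQ).2.1) (a := 1) (k₀ := κ P + 3)
    fun Q hQ => (Finset.mem_filter.1 hQ).2.2
  have hg : geomConst 1 = 2 := by
    rw [geomConst, ENNReal.rpow_neg_one, ENNReal.one_sub_inv_two, inv_inv]
  have h1 : 2 * μ (⋃ S ∈ G, S) ≤ μ P := by
    calc 2 * μ (⋃ S ∈ G, S) ≤ 2 * ∑ S ∈ G, μ S := by gcongr; exact measure_biUnion_finset_le G _
      _ = 2 * ∑ Q ∈ G, 2 ^ ((κ Q : ℝ) * (1 - 1)) * μ Q := by simp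
      _ ≤ 2 * (2 ^ (-((κ P + 3 : ℤ) : ℝ) * 1) * geomConst 1 * σ P) := by gcongr
      _ ≤ 2 * (2 ^ (-((κ P + 3 : ℤ) : ℝ) * 1) * 2 * (2 ^ ((κ P : ℝ) + 1) * μ P)) := by
          rw [hg]; gcongr; exact le_densityLevel hμ hσ hPF
      _ = (2 ^ (1 : ℝ) * 2 ^ (-((κ P + 3 : ℤ) : ℝ) * 1) * 2 ^ (1 : ℝ) * 2 ^ ((κ P : ℝ) + 1)) * μ P := by
          rw [ENNReal.rpow_one]; ring
      _ = μ P := by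
          rw [← two_rpow_add, ← two_rpow_add, ← two_rpow_add]
          push_cast
          have : 1 + -((κ P : ℝ) + 3) * 1 + 1 + ((κ P : ℝ) + 1) = 0 := by ring
          rw [this, ENNReal.rpow_zero, one_mul]
  have h2 : μ P ≤ μ (thickPart F κ P) + μ (⋃ S ∈ G, S) := by
    refine (measure_mono ?_).trans (measure_union_le _ _)
    intro x hx
    by_cases h : x ∈ ⋃ S ∈ G, S
    · exact Or.inr h
    · exact Or.inl ⟨hx, h⟩
  have h3 : μ P + μ P ≤ 2 * μ (thickPart F κ P) + μ P := by
    calc μ P + μ P = 2 * μ P := by ring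
      _ ≤ 2 * (μ (thickPart F κ P) + μ (⋃ S ∈ G, S)) := by gcongr
      _ = 2 * μ (thickPart F κ P) + 2 * μ (⋃ S ∈ G, S) := by ring
      _ ≤ _ := by gcongr
  exact (ENNReal.add_le_add_iff_right (hμ.ne_top P hPF)).1 h3

lemma measurableSet_thickPart {F : Finset (Set X)} (hm : ∀ Q ∈ F, MeasurableSet Q) {κ : Set X → ℤ}
    {P : Set X} (hP : P ∈ F) : MeasurableSet (thickPart F κ P) := by
  classical
  exact (hm P hP).diff (Finset.measurableSet_biUnion _ fun S hS =>
    hm S (records_subset F κ (Finset.mem_filter.1 hS).1))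

/-- A sum over records is controlled by a maximal function. -/
lemma sum_records_rpow_le {F : Finset (Set X)} (hF : Laminar F) {μ σ : Measure X} (hμ : Good F μ)
    (hσ : Good F σ) {l : Set X → ℝ≥0∞} {M : Set X → X → ℝ≥0∞} {e : ℝ} (he : 1 ≤ e) {B : ℝ≥0∞}
    (hlM : ∀ T ∈ F, ∀ Q ∈ F, Q ⊆ T → ∀ x ∈ Q, l Q ≤ M T x)
    (hM : ∀ T ∈ F, ∫⁻ x in T, M T x ^ e ∂μ ≤ B * σ T ^ e) {R : Set X} (hR : ∀ Q ∈ F, Q ⊆ R) :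
    ∑ P ∈ records F (densityLevel μ σ), l P ^ e * μ P ≤ 6 * B * σ R ^ e := by
  classical
  set κ := densityLevel μ σ
  set S := records F κ
  have hSF : S ⊆ F := records_subset F κ
  -- R need not belong to the family, so the maximal function bound is applied on the maximal
  -- members. They are disjoint, and e ≥ 1 makes the powers of their measures superadditive.
  set tops := F.filter (fun T => ∀ S ∈ F, ¬ T ⊂ S) with htops
  set H : X → ℝ≥0∞ := fun x => ∑ P ∈ S, (thickPart F κ P).indicator (fun _ => l P ^ e) x with hH
  have hmS : ∀ P ∈ S, Measurable ((thickPart F κ P).indicator (fun _ => l P ^ e)) := fun P hP =>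
    measurable_const.indicator (measurableSet_thickPart hμ.meas (hSF hP))
  have hHm : Measurable H := Finset.measurable_sum _ fun P hP => hmS P hP
  have htop : ∀ P ∈ F, ∀ T ∈ tops, ∀ x, x ∈ P → x ∈ T → P ⊆ T := by
    intro P hP T hT x hxP hxT
    have hT := Finset.mem_filter.1 hT
    exact (hF.subset_or_ssubset hP hT.1 hxP hxT).resolve_right (hT.2 P hP)
  calc ∑ P ∈ S, l P ^ e * μ P ≤ ∑ P ∈ S, l P ^ e * (2 * μ (thickPart F κ P)) := by
        gcongr with P hP
        exact measure_le_two_mul_thickPart hμ hσ hF hP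
    _ = 2 * ∫⁻ x, H x ∂μ := by
        rw [hH, lintegral_finsetSum _ hmS, Finset.mul_sum]
        refine Finset.sum_congr rfl fun P hP => ?_
        rw [lintegral_indicator (measurableSet_thickPart hμ.meas (hSF hP)), setLIntegral_const]
        ring
    _ ≤ 2 * ∫⁻ x, ∑ T ∈ tops, T.indicator H x ∂μ := by
        gcongr with x
        by_cases hx : ∃ P ∈ S, x ∈ P
        · obtain ⟨P, hP, hxP⟩ := hx
          obtain ⟨T, hT, hPT, hTmax⟩ := exists_top (hSF hP)
          calc H x = T.indicator H x := by rw [indicator_of_mem (hPT hxP)]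
            _ ≤ _ := Finset.single_le_sum (f := fun T : Set X => T.indicator H x)
              (fun _ _ => zero_le) (by simp only [htops, Finset.mem_filter]; exact ⟨hT, hTmax⟩)
        · push Not at hx
          have : H x = 0 := Finset.sum_eq_zero fun P hP =>
            indicator_of_notMem (fun h => hx P hP h.1) _
          rw [this]; exact zero_le
    _ = 2 * ∑ T ∈ tops, ∫⁻ x in T, H x ∂μ := by
        rw [lintegral_finsetSum _ fun T hT => hHm.indicator (hμ.meas T (Finset.mem_filter.1 hT).1)]
        congr 1
        exact Finset.sum_congr rfl fun T hT =>
          lintegral_indicator (hμ.meas T (Finset.mem_filter.1 hT).1) _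
    -- The factor 2 is the loss from P to its thick part, and 3 bounds the overlap of thick parts.
    _ ≤ 2 * ∑ T ∈ tops, 3 * (B * σ T ^ e) := by
        gcongr with T hT
        have hTF := (Finset.mem_filter.1 hT).1
        calc ∫⁻ x in T, H x ∂μ ≤ ∫⁻ x in T, 3 * M T x ^ e ∂μ := by
              refine setLIntegral_mono' (hμ.meas T hTF) fun x hx => ?_
              simp only [hH, indicator_apply]
              rw [← Finset.sum_filter]
              calc _ ≤ ∑ P ∈ S with x ∈ thickPart F κ P, M T x ^ e := by
                    refine Finset.sum_le_sum fun P hP => ?_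
                    have hP := Finset.mem_filter.1 hP
                    exact ENNReal.rpow_le_rpow (hlM T hTF P (hSF hP.1)
                      (htop P (hSF hP.1) T hT x hP.2.1 hx) x hP.2.1) (by linarith)
                _ = ((S.filter (x ∈ thickPart F κ ·)).card : ℝ≥0∞) * M T x ^ e := by
                    rw [Finset.sum_const, nsmul_eq_mul]
                _ ≤ _ := by
                    gcongr
                    exact_mod_cast card_thickPart_le hF κ x
          _ = 3 * ∫⁻ x in T, M T x ^ e ∂μ := lintegral_const_mul' _ _ (by norm_num)
          _ ≤ _ := by gcongr; exact hM T hTF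
    _ = 6 * B * ∑ T ∈ tops, σ T ^ e := by
        rw [Finset.mul_sum, Finset.mul_sum]
        refine Finset.sum_congr rfl fun T _ => ?_
        ring
    _ ≤ 6 * B * σ R ^ e := by
        gcongr
        refine (sum_rpow_le_rpow_sum tops (fun T => σ T) he).trans ?_
        refine ENNReal.rpow_le_rpow ?_ (by linarith)
        rw [← measure_biUnion_finset]
        · exact measure_mono (iUnion₂_subset fun T hT => hR T (Finset.mem_filter.1 hT).1)
        · intro T hT U hU hne
          refine Set.disjoint_left.2 fun x hxT hxU => hne ?_
          exact (htop T (Finset.mem_filter.1 hT).1 U hU x hxT hxU).antisymm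
            (htop U (Finset.mem_filter.1 hU).1 T hT x hxU hxT)
        · exact fun T hT => hμ.meas T (Finset.mem_filter.1 hT).1

end SepBump

/-! ### The testing estimate on one slice -/

namespace SepBump
variable {X : Type*} [MeasurableSpace X]

/-- The constant in `slice_bound`. -/
def sliceConst (q : ℝ) : ℝ≥0∞ := chainConst q ^ q * (2 * geomConst (1 / 2) * 6)

lemma sliceConst_ne_top {q : ℝ} (hq : 0 < q) : sliceConst q ≠ ⊤ :=
  ENNReal.mul_ne_top (ENNReal.rpow_ne_top_of_nonneg hq.le (chainConst_ne_top hq))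
    (ENNReal.mul_ne_top (ENNReal.mul_ne_top (by simp) (geomConst_ne_top (by norm_num))) (by simp))

/-- If P is the stopping set of Q, then σ(Q) ≤ 2^(κ P + 1) μ(Q). Hence the members stopped at P add
up to at most a density times a sum of τ_Q μ(Q), which `hD` bounds by the term of P. -/
lemma sum_le_sum_records {F : Finset (Set X)} (hF : Laminar F) {μ σ : Measure X} (hμ : Good F μ)
    (hσ : Good F σ) {τ : Set X → ℝ≥0∞} {D : ℝ≥0∞}
    (hD : ∀ P ∈ F, ∀ x, ∑ Q ∈ F, {y | y ∈ Q ∧ Q ⊆ P}.indicator (fun _ => τ Q * μ Q) x ≤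
      D * (τ P * μ P)) (x : X) :
    ∑ Q ∈ F, Q.indicator (fun _ => τ Q * σ Q) x ≤
      2 * D * ∑ P ∈ records F (densityLevel μ σ), P.indicator (fun _ => τ P * σ P) x := by
  classical
  set κ := densityLevel μ σ
  set S := records F κ
  have hSF : S ⊆ F := records_subset F κ
  rw [← Finset.sum_fiberwise_of_maps_to (t := S) (g := stoppingSet F κ)
    fun Q hQ => (stoppingSet_spec hF κ hQ (hσ.nonempty hQ)).1, Finset.mul_sum]
  refine Finset.sum_le_sum fun P hP => ?_
  by_cases hx : x ∈ P
  · rw [indicator_of_mem hx]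
    calc ∑ Q ∈ F with stoppingSet F κ Q = P, Q.indicator (fun _ => τ Q * σ Q) x
        ≤ ∑ Q ∈ F with stoppingSet F κ Q = P, {y | y ∈ Q ∧ Q ⊆ P}.indicator (fun _ => τ Q * μ Q) x *
            2 ^ ((κ P : ℝ) + 1) := by
          refine Finset.sum_le_sum fun Q hQ => ?_
          obtain ⟨hQF, hQP⟩ := Finset.mem_filter.1 hQ
          obtain ⟨-, hsub, hκ, -⟩ := stoppingSet_spec hF κ hQF (hσ.nonempty hQF)
          rw [hQP] at hsub hκ
          by_cases hxQ : x ∈ Q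
          · rw [indicator_of_mem hxQ, indicator_of_mem (show x ∈ {y | y ∈ Q ∧ Q ⊆ P} from ⟨hxQ, hsub⟩),
              mul_assoc]
            gcongr
            refine (le_densityLevel hμ hσ hQF).trans ?_
            rw [mul_comm]
            gcongr
            norm_num
          · rw [indicator_of_notMem hxQ]; exact zero_le
      _ ≤ (∑ Q ∈ F, {y | y ∈ Q ∧ Q ⊆ P}.indicator (fun _ => τ Q * μ Q) x) * 2 ^ ((κ P : ℝ) + 1) := by
          rw [← Finset.sum_mul]
          gcongr
          exact Finset.filter_subset _ _
      _ ≤ (D * (τ P * μ P)) * 2 ^ ((κ P : ℝ) + 1) := by gcongr; exact hD P (hSF hP) x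
      _ = 2 * D * (τ P * (2 ^ (κ P : ℝ) * μ P)) := by
          rw [two_rpow_add, ENNReal.rpow_one]; ring
      _ ≤ _ := by gcongr; exact densityLevel_le hμ hσ (hSF hP)
  · rw [indicator_of_notMem hx, mul_zero]
    refine le_of_eq (Finset.sum_eq_zero fun Q hQ => ?_)
    obtain ⟨hQF, hQP⟩ := Finset.mem_filter.1 hQ
    have hsub := (stoppingSet_spec hF κ hQF (hσ.nonempty hQF)).2.1
    rw [hQP] at hsub
    exact indicator_of_notMem (fun h => hx (hsub h)) _

/-- The testing estimate for a slice, on which a Muckenhoupt-type condition with constant `A` and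
a maximal function estimate with constant `B` hold. -/
lemma slice_bound {F : Finset (Set X)} (hF : Laminar F) {μ σ w : Measure X} (hμ : Good F μ)
    (hσ : Good F σ) {τ : Set X → ℝ≥0∞} (hτ0 : ∀ Q ∈ F, τ Q ≠ 0)
    (hτt : ∀ Q ∈ F, τ Q ≠ ⊤) {c e q : ℝ} (hc : 0 ≤ c) (he : 1 ≤ e) (hq : 0 < q) (hce : c + e = q)
    {A B D : ℝ≥0∞}
    (hD : ∀ P ∈ F, ∀ x, ∑ Q ∈ F, {y | y ∈ Q ∧ Q ⊆ P}.indicator (fun _ => τ Q * μ Q) x ≤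
      D * (τ P * μ P))
    (hA : ∀ Q ∈ F, (τ Q * σ Q) ^ c * w Q ≤ A * μ Q)
    {M : Set X → X → ℝ≥0∞}
    (hlM : ∀ T ∈ F, ∀ Q ∈ F, Q ⊆ T → ∀ x ∈ Q, τ Q * σ Q ≤ M T x)
    (hM : ∀ T ∈ F, ∫⁻ x in T, M T x ^ e ∂μ ≤ B * σ T ^ e) {R : Set X} (hR : ∀ Q ∈ F, Q ⊆ R) :
    ∫⁻ x, (∑ Q ∈ F, Q.indicator (fun _ => τ Q * σ Q) x) ^ q ∂w ≤
      (2 * D) ^ q * sliceConst q * (A * B * σ R ^ e) := by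
  classical
  set κ := densityLevel μ σ
  set S := records F κ
  have hSF : S ⊆ F := records_subset F κ
  set l : Set X → ℝ≥0∞ := fun Q => τ Q * σ Q with hl
  -- W is the double sum of `chain_sum_le` for the records through x, indexed by nested pairs. Power
  -- c sits on the inner record P, where `hA` trades l^c w for A μ; power e sits on the outer one
  -- and is left for the maximal function.
  set W : X → ℝ≥0∞ := fun x => ∑ P'' ∈ S, ∑ P ∈ S with P ⊆ P'',
    P.indicator (fun _ => (2 : ℝ≥0∞) ^ (((κ P : ℝ) - κ P'') / 2) * l P ^ c * l P'' ^ e) x with hW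
  have hchain : ∀ x, ∑ P ∈ S, P.indicator (fun _ => l P) x ≤ chainConst q * W x ^ (1 / q) := by
    intro x
    simp only [indicator_apply]
    rw [← Finset.sum_filter]
    refine (chain_sum_le (S.filter (x ∈ ·)) κ (fun P hP Q hQ h => ?_) l
      (fun P hP => mul_ne_zero (hτ0 P (hSF (Finset.mem_filter.1 hP).1))
        (hσ.ne_zero P (hSF (Finset.mem_filter.1 hP).1)))
      (fun P hP => ENNReal.mul_ne_top (hτt P (hSF (Finset.mem_filter.1 hP).1))
        (hσ.ne_top P (hSF (Finset.mem_filter.1 hP).1))) hc (by linarith) hq hce).trans ?_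
    · have hP := Finset.mem_filter.1 hP
      have hQ := Finset.mem_filter.1 hQ
      exact records_level_inj hF hP.1 hQ.1 hP.2 hQ.2 h
    gcongr
    rw [Finset.sum_comm, hW]
    simp only [indicator_apply]
    rw [Finset.sum_filter]
    refine Finset.sum_le_sum fun P'' hP'' => ?_
    by_cases hx : x ∈ P''
    · rw [if_pos hx, ← Finset.sum_filter, ← Finset.sum_filter, Finset.filter_filter,
        Finset.filter_filter]
      refine Finset.sum_le_sum_of_subset fun P hP => ?_
      simp only [Finset.mem_filter] at hP ⊢
      refine ⟨hP.1, ?_, hP.2.1⟩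
      rcases hF.subset_or_ssubset (hSF hP.1) (hSF hP'') hP.2.1 hx with h | h
      · exact h
      · have := (mem_records.1 hP'').2 P (hSF hP.1) h
        omega
    · rw [if_neg hx]; exact zero_le
  have hWint : ∫⁻ x, W x ∂w ≤ 2 * geomConst (1 / 2) * 6 * (A * B * σ R ^ e) := by
    have hmeas : ∀ P'' : Set X, ∀ P ∈ S.filter (· ⊆ P''), Measurable (P.indicator
        (fun _ : X => (2 : ℝ≥0∞) ^ (((κ P : ℝ) - κ P'') / 2) * l P ^ c * l P'' ^ e)) :=
      fun P'' P hP => measurable_const.indicator (hμ.meas P (hSF (Finset.mem_filter.1 hP).1))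
    rw [hW, lintegral_finsetSum _ fun P'' _ => Finset.measurable_sum _ (hmeas P'')]
    calc _ ≤ ∑ P'' ∈ S, A * (2 * geomConst (1 / 2)) * (l P'' ^ e * μ P'') := by
          refine Finset.sum_le_sum fun P'' hP'' => ?_
          rw [lintegral_finsetSum _ (hmeas P'')]
          calc _ ≤ ∑ P ∈ S with P ⊆ P'',
                A * l P'' ^ e * (2 ^ (((κ P : ℝ) - κ P'') / 2) * μ P) := by
                refine Finset.sum_le_sum fun P hP => ?_
                have hPF := hSF (Finset.mem_filter.1 hP).1
                rw [lintegral_indicator (hμ.meas P hPF), setLIntegral_const]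
                calc _ = 2 ^ (((κ P : ℝ) - κ P'') / 2) * l P'' ^ e * (l P ^ c * w P) := by ring
                  _ ≤ 2 ^ (((κ P : ℝ) - κ P'') / 2) * l P'' ^ e * (A * μ P) := by
                    exact mul_le_mul' le_rfl (hA P hPF)
                  _ = _ := by ring
            _ ≤ A * l P'' ^ e * (2 * geomConst (1 / 2) * μ P'') := by
                rw [← Finset.mul_sum]
                gcongr
                exact sum_records_half_le hμ hσ hF hP'' _ (Finset.filter_subset _ _)
                  fun Q hQ => (Finset.mem_filter.1 hQ).2
            _ = _ := by ring
      _ ≤ A * (2 * geomConst (1 / 2)) * (6 * B * σ R ^ e) := by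
          rw [← Finset.mul_sum]
          gcongr
          exact sum_records_rpow_le hF hμ hσ he hlM hM hR
      _ = _ := by ring
  calc ∫⁻ x, (∑ Q ∈ F, Q.indicator (fun _ => τ Q * σ Q) x) ^ q ∂w
      ≤ ∫⁻ x, (2 * D) ^ q * chainConst q ^ q * W x ∂w := by
        refine lintegral_mono fun x => ?_
        have h1 := (sum_le_sum_records hF hμ hσ hD x).trans (mul_le_mul' le_rfl (hchain x))
        refine (ENNReal.rpow_le_rpow h1 hq.le).trans (le_of_eq ?_)
        rw [ENNReal.mul_rpow_of_nonneg (2 * D) _ hq.le,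
          ENNReal.mul_rpow_of_nonneg (chainConst q) _ hq.le, ← ENNReal.rpow_mul, one_div_mul_cancel hq.ne', ENNReal.rpow_one, mul_assoc]
    _ = (2 * D) ^ q * chainConst q ^ q * ∫⁻ x, W x ∂w := by
        rw [lintegral_const_mul]
        exact Finset.measurable_sum _ fun P'' _ => Finset.measurable_sum _ fun P hP =>
          measurable_const.indicator (hμ.meas P (hSF (Finset.mem_filter.1 hP).1))
    _ ≤ (2 * D) ^ q * chainConst q ^ q * (2 * geomConst (1 / 2) * 6 * (A * B * σ R ^ e)) := by
        gcongr
    _ = _ := by rw [sliceConst]; ring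

end SepBump

/-! ### From the integral condition on ε to the testing condition -/

namespace SepBump

lemma toReal_two_rpow (k : ℤ) : ((2 : ℝ≥0∞) ^ (k : ℝ)).toReal = (2 : ℝ) ^ k := by
  rw [← ENNReal.toReal_rpow]
  simp [Real.rpow_intCast]

/-- On an interval of length a where u < 2a and ε(u) ≤ ε(t), the integrand is at least
ε(t)^(-1/s)/(2a). -/
lemma rpow_neg_le_two_mul_lintegral {s : ℝ} (hs : 0 < s) {ε : ℝ → ℝ}
    (hpos : ∀ t, 0 < t → 0 < ε t) {t a : ℝ} (ha : 0 < a)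
    (h : ∀ u ∈ Ioo a (2 * a), ε u ≤ ε t) :
    ENNReal.ofReal (ε t ^ (-(1 / s))) ≤
      2 * ∫⁻ u in Ioo a (2 * a), ENNReal.ofReal (1 / (u * ε u ^ (1 / s))) := by
  have h1 : ∀ u ∈ Ioo a (2 * a), ENNReal.ofReal (1 / (2 * a) * ε t ^ (-(1 / s))) ≤
      ENNReal.ofReal (1 / (u * ε u ^ (1 / s))) := by
    intro u hu
    have hu0 : 0 < u := ha.trans hu.1
    have hεu := hpos u hu0
    refine ENNReal.ofReal_le_ofReal ?_
    rw [Real.rpow_neg (hεu.trans_le (h u hu)).le, ← one_div (ε t ^ _), one_div_mul_one_div]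
    refine one_div_le_one_div_of_le (mul_pos hu0 (Real.rpow_pos_of_pos hεu _)) ?_
    refine mul_le_mul hu.2.le (Real.rpow_le_rpow hεu.le (h u hu) (by positivity))
      (Real.rpow_nonneg hεu.le _) (by linarith)
  calc ENNReal.ofReal (ε t ^ (-(1 / s)))
      = 2 * ∫⁻ u in Ioo a (2 * a), ENNReal.ofReal (1 / (2 * a) * ε t ^ (-(1 / s))) := by
        rw [setLIntegral_const, Real.volume_Ioo, ENNReal.ofReal_mul (by positivity)]
        have : (2 * ENNReal.ofReal (1 / (2 * a))) * ENNReal.ofReal (2 * a - a) = 1 := by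
          rw [show (2 : ℝ≥0∞) = ENNReal.ofReal 2 by simp, ← ENNReal.ofReal_mul (by norm_num),
            ← ENNReal.ofReal_mul (by positivity), ← ENNReal.ofReal_one]
          congr 1; field_simp; ring
        calc _ = (2 * ENNReal.ofReal (1 / (2 * a))) * ENNReal.ofReal (2 * a - a)
              * ENNReal.ofReal (ε t ^ (-(1 / s))) := by rw [this, one_mul]
          _ = _ := by ring
    _ ≤ _ := by
        gcongr 2 * ?_
        exact setLIntegral_mono' measurableSet_Ioo h1

/-- A summable sequence that bounds `ε ^ (-1 / s)` on the dyadic intervals. -/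
lemma exists_bumpWeight {s : ℝ} (hs : 0 < s) {ε : ℝ → ℝ} (h : IsBumpFunction s ε) :
    ∃ β : ℤ → ℝ≥0∞, ∑' r, β r ≠ ⊤ ∧ ∀ (r : ℤ) (t : ℝ), (2 : ℝ) ^ r ≤ t → t < 2 ^ (r + 1) →
      ENNReal.ofReal (ε t) ^ (-(1 / s)) ≤ β r := by
  obtain ⟨m, hm, hmε⟩ := h.pos
  have hpos : ∀ t, 0 < t → 0 < ε t := fun t ht => hm.trans_le (hmε t ht)
  set I : ℤ → ℝ≥0∞ := fun r => ∫⁻ u in Ioo ((2 : ℝ) ^ r) (2 * 2 ^ r),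
    ENNReal.ofReal (1 / (u * ε u ^ (1 / s))) with hI
  have hIsum : ∑' r, I r ≠ ⊤ := by
    have h1 : ∑' r, I r ≤ ∫⁻ u in Ioi 0, ENNReal.ofReal (1 / (u * ε u ^ (1 / s))) := by
      rw [hI, ← lintegral_iUnion (fun _ => measurableSet_Ioo)]
      · refine lintegral_mono_set (iUnion_subset fun r u hu => ?_)
        exact lt_trans (by positivity) hu.1
      · intro i j hij
        refine Set.disjoint_left.2 fun u hi hj => hij ?_
        have e : ∀ k : ℤ, (2 : ℝ) * 2 ^ k = 2 ^ (k + 1) := fun k => by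
          rw [zpow_add₀ (by norm_num), zpow_one, mul_comm]
        simp only [e] at hi hj
        have h1 := hi.1.trans hj.2
        have h2 := hj.1.trans hi.2
        rw [zpow_lt_zpow_iff_right₀ (by norm_num)] at h1 h2
        omega
    refine ne_top_of_le_ne_top ?_ h1
    have := h.integrableOn.2
    rw [hasFiniteIntegral_iff_enorm] at this
    refine ne_top_of_le_ne_top this.ne (lintegral_mono fun u => ?_)
    exact Real.ofReal_le_enorm _
  refine ⟨fun r => 2 * I (r - 1) + 2 * I (r + 1) +
    (if r = 0 then ENNReal.ofReal (m ^ (-(1 / s))) else 0) +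
    (if r = -1 then ENNReal.ofReal (m ^ (-(1 / s))) else 0), ?_, ?_⟩
  · rw [ENNReal.tsum_add, ENNReal.tsum_add, ENNReal.tsum_add, ENNReal.tsum_mul_left,
      ENNReal.tsum_mul_left, tsum_ite_eq, tsum_ite_eq,
      show ∑' i, I (i - 1) = ∑' i, I i from (Equiv.subRight (1 : ℤ)).tsum_eq I,
      show ∑' i, I (i + 1) = ∑' i, I i from (Equiv.addRight (1 : ℤ)).tsum_eq I]
    simp [ENNReal.mul_eq_top, hIsum]
  · intro r t ht1 ht2
    have ht0 : 0 < t := lt_of_lt_of_le (by positivity) ht1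
    rw [ENNReal.ofReal_rpow_of_pos (hpos t ht0)]
    have hz : ∀ k : ℤ, (2 : ℝ) * 2 ^ k = 2 ^ (k + 1) := fun k => by
      rw [zpow_add₀ (by norm_num), zpow_one, mul_comm]
    have hmt : ENNReal.ofReal (ε t ^ (-(1 / s))) ≤ ENNReal.ofReal (m ^ (-(1 / s))) :=
      ENNReal.ofReal_le_ofReal (Real.rpow_le_rpow_of_nonpos hm (hmε t ht0)
        (neg_nonpos.2 (by positivity)))
    -- For r ≥ 1 the dyadic interval is compared with its left neighbour, for r ≤ -2 with its right
    -- one; both stay on one side of 1, where ε is monotone. For r = 0 and r = -1 the neighbour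
    -- would cross 1, and the lower bound m is used instead.
    have hcases : 1 ≤ r ∨ r ≤ -2 ∨ r = 0 ∨ r = -1 := by omega
    rcases hcases with hr | hr | rfl | rfl
    · have h1 := rpow_neg_le_two_mul_lintegral hs hpos (t := t) (a := 2 ^ (r - 1)) (by positivity)
        (fun u hu => by
          rw [hz, sub_add_cancel] at hu
          have hu1 : 1 < u := lt_of_le_of_lt (one_le_zpow₀ (by norm_num) (by omega)) hu.1
          exact h.monotoneOn hu1 (hu1.trans (hu.2.trans_le ht1)) (hu.2.le.trans ht1))
      exact h1.trans (le_add_right (le_add_right (le_add_right le_rfl)))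
    · have h1 := rpow_neg_le_two_mul_lintegral hs hpos (t := t) (a := 2 ^ (r + 1)) (by positivity)
        (fun u hu => by
          have hu1 : u < 1 := hu.2.trans_le (by
            rw [hz]; exact zpow_le_one_of_nonpos₀ (by norm_num) (by omega))
          exact h.antitoneOn ⟨ht0, (ht2.trans hu.1).trans hu1⟩ ⟨ht0.trans (ht2.trans hu.1), hu1⟩
            (ht2.trans hu.1).le)
      exact h1.trans (le_add_right (le_add_right (le_add_left le_rfl)))
    · simpa using hmt.trans (le_add_left le_rfl)
    · simpa using hmt.trans (le_add_left le_rfl)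

variable {X : Type*} [MeasurableSpace X]

lemma lintegral_Lp_finsetSum_le {ι : Type*} (s : Finset ι) (u : ι → X → ℝ≥0∞) (w : Measure X)
    (hu : ∀ i ∈ s, Measurable (u i)) {q : ℝ} (hq : 1 ≤ q) :
    (∫⁻ x, (∑ i ∈ s, u i x) ^ q ∂w) ^ (1 / q) ≤ ∑ i ∈ s, (∫⁻ x, u i x ^ q ∂w) ^ (1 / q) := by
  classical
  have hq0 : 0 < q := by linarith
  induction s using Finset.induction_on with
  | empty => simp [hq0]
  | insert i s hi ih =>
    simp only [Finset.sum_insert hi]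
    have h1 := ENNReal.lintegral_Lp_add_le (μ := w) (hu i (Finset.mem_insert_self i s)).aemeasurable
      (Finset.measurable_sum s fun j hj => hu j (Finset.mem_insert_of_mem hj)).aemeasurable hq
    simp only [Pi.add_apply] at h1
    exact h1.trans (add_le_add le_rfl (ih fun j hj => hu j (Finset.mem_insert_of_mem hj)))

/-- The testing condition follows from the separated bump condition. -/
lemma testing_of_bump {F : Finset (Set X)} (hF : Laminar F) {μ σ w : Measure X} (hμ : Good F μ)
    (hσ : Good F σ) {τ : Set X → ℝ≥0∞} (hτ0 : ∀ Q ∈ F, τ Q ≠ 0)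
    (hτt : ∀ Q ∈ F, τ Q ≠ ⊤) {p p' q : ℝ} (hp : p.HolderConjugate p') (hpq : p ≤ q)
    {ε : ℝ → ℝ} (hε : ∀ t, 0 < t → 0 < ε t) {β : ℤ → ℝ≥0∞}
    (hβ : ∀ (r : ℤ) (t : ℝ), (2 : ℝ) ^ r ≤ t → t < 2 ^ (r + 1) →
      ENNReal.ofReal (ε t) ^ (-(1 / q)) ≤ β r)
    {B D : ℝ≥0∞}
    (hD : ∀ P ∈ F, ∀ x, ∑ Q ∈ F, {y | y ∈ Q ∧ Q ⊆ P}.indicator (fun _ => τ Q * μ Q) x ≤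
      D * (τ P * μ P))
    {ρ : Set X → ℝ≥0∞} (hρ0 : ∀ Q ∈ F, ρ Q ≠ 0) (hρt : ∀ Q ∈ F, ρ Q ≠ ⊤)
    (hA : ∀ Q ∈ F, (τ Q * σ Q) ^ (q / p') * (w Q / μ Q) *
      (ρ Q * ENNReal.ofReal (ε (ρ Q).toReal)) ≤ B)
    {M : Set X → X → ℝ≥0∞}
    (hlM : ∀ T ∈ F, ∀ Q ∈ F, Q ⊆ T → ∀ x ∈ Q, τ Q * σ Q ≤ M T x)
    (hM : ∀ T ∈ F, ∫⁻ x in T, M T x ^ (q / p) ∂μ ≤ ρ T * σ T ^ (q / p)) :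
    Testing F τ σ w p q (2 * (2 * sliceConst q) ^ (1 / q) * (∑' r, β r) * D * B ^ (1 / q)) := by
  classical
  have hq0 : 0 < q := hp.pos.trans_le hpq
  intro R hR
  set G := F.filter (· ⊆ R) with hG
  set lev : Set X → ℤ := fun Q => level (ρ Q) with hlev
  have hGF : G ⊆ F := Finset.filter_subset _ _
  have htest : ∀ x, testFun F τ σ R x = ∑ r ∈ G.image lev, ∑ Q ∈ G with lev Q = r,
      Q.indicator (fun _ => τ Q * σ Q) x := by
    intro x
    rw [Finset.sum_fiberwise_of_maps_to (fun Q hQ => Finset.mem_image_of_mem lev hQ), testFun, hG,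
      Finset.sum_filter]
    refine Finset.sum_congr rfl fun Q _ => ?_
    by_cases h : Q ⊆ R <;> simp [h]
  simp only [htest]
  refine (lintegral_Lp_finsetSum_le _ _ _ (fun r _ => Finset.measurable_sum _ fun Q hQ =>
    measurable_const.indicator (hμ.meas Q (hGF (Finset.mem_filter.1 hQ).1)))
    (hp.lt.le.trans hpq)).trans ?_
  have hslice : ∀ r : ℤ, (∫⁻ x, (∑ Q ∈ G with lev Q = r,
      Q.indicator (fun _ => τ Q * σ Q) x) ^ q ∂w) ^ (1 / q) ≤
      (2 * (2 * sliceConst q) ^ (1 / q) * D * B ^ (1 / q) * σ R ^ (1 / p)) * β r := by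
    intro r
    set H := G.filter (lev · = r) with hH
    have hHF : H ⊆ F := (Finset.filter_subset _ _).trans hGF
    have hlevH : ∀ Q ∈ H, (2 : ℝ≥0∞) ^ (r : ℝ) ≤ ρ Q ∧ ρ Q < 2 ^ ((r : ℝ) + 1) := by
      intro Q hQ
      have := level_spec (hρ0 Q (hHF hQ)) (hρt Q (hHF hQ))
      rwa [show level (ρ Q) = r from (Finset.mem_filter.1 hQ).2] at this
    -- On the slice ϱ lies between 2^r and 2^(r + 1). The lower bound puts 2^(-r) into the
    -- Muckenhoupt constant, the upper bound puts 2^(r + 1) into the maximal constant, and their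
    -- product no longer contains r except through β r.
    have h := slice_bound (hF.mono hHF) (hμ.mono hHF) (hσ.mono hHF) (w := w) (τ := τ)
      (fun Q hQ => hτ0 Q (hHF hQ)) (fun Q hQ => hτt Q (hHF hQ)) (c := q / p') (e := q / p) (q := q)
      (A := B * β r ^ q * 2 ^ (-(r : ℝ))) (B := 2 ^ ((r : ℝ) + 1)) (D := D) (M := M) (R := R)
      (div_nonneg hq0.le hp.symm.nonneg) ((one_le_div hp.pos).2 hpq) hq0
      (by rw [div_eq_mul_inv, div_eq_mul_inv, ← mul_add, add_comm, hp.inv_add_inv_eq_one, mul_one])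
      (fun P hP x => (Finset.sum_le_sum_of_subset hHF).trans (hD P (hHF hP) x))
      (fun Q hQ => by
        have hQF := hHF hQ
        have hρr : 0 < (ρ Q).toReal := ENNReal.toReal_pos (hρ0 Q hQF) (hρt Q hQF)
        set E := ENNReal.ofReal (ε (ρ Q).toReal) with hE
        have hE0 : E ≠ 0 := by simp [hE, hε _ hρr]
        have hEt : E ≠ ⊤ := ENNReal.ofReal_ne_top
        obtain ⟨h1, h2⟩ := hlevH Q hQ
        have hEβ : E⁻¹ ≤ β r ^ q := by
          have h3 := hβ r (ρ Q).toReal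
            (by rw [← toReal_two_rpow]; exact ENNReal.toReal_mono (hρt Q hQF) h1)
            (by rw [← toReal_two_rpow]
                push_cast
                exact (ENNReal.toReal_lt_toReal (hρt Q hQF) (two_rpow_ne_top _)).2 h2)
          have h4 := ENNReal.rpow_le_rpow h3 hq0.le
          rwa [← ENNReal.rpow_mul, neg_mul, one_div_mul_cancel hq0.ne', ENNReal.rpow_neg_one] at h4
        have hρi : (ρ Q)⁻¹ ≤ 2 ^ (-(r : ℝ)) := by
          rw [ENNReal.rpow_neg]; exact ENNReal.inv_le_inv.2 h1
        calc (τ Q * σ Q) ^ (q / p') * w Q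
            = ((τ Q * σ Q) ^ (q / p') * (w Q / μ Q) * (ρ Q * E)) * E⁻¹ * (ρ Q)⁻¹ * μ Q := by
              calc _ = (τ Q * σ Q) ^ (q / p') * (w Q / μ Q * μ Q) * (ρ Q * (ρ Q)⁻¹) * (E * E⁻¹) := by
                    rw [ENNReal.div_mul_cancel (hμ.ne_zero Q hQF) (hμ.ne_top Q hQF),
                      ENNReal.mul_inv_cancel (hρ0 Q hQF) (hρt Q hQF), ENNReal.mul_inv_cancel hE0 hEt,
                      mul_one, mul_one]
                _ = _ := by ring
          _ ≤ B * β r ^ q * 2 ^ (-(r : ℝ)) * μ Q := by gcongr; exact hA Q hQF)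
      (fun T hT Q hQ => hlM T (hHF hT) Q (hHF hQ))
      (fun T hT => (hM T (hHF hT)).trans (mul_le_mul' (hlevH T hT).2.le le_rfl))
      (fun Q hQ => (Finset.mem_filter.1 (Finset.mem_filter.1 hQ).1).2)
    refine (ENNReal.rpow_le_rpow h (by positivity)).trans (le_of_eq ?_)
    have e1 : B * β r ^ q * 2 ^ (-(r : ℝ)) * 2 ^ ((r : ℝ) + 1) * σ R ^ (q / p) =
        2 * B * (σ R ^ (q / p)) * β r ^ q := by
      have : (2 : ℝ≥0∞) ^ (-(r : ℝ)) * 2 ^ ((r : ℝ) + 1) = 2 := by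
        rw [← two_rpow_add, neg_add_cancel_left, ENNReal.rpow_one]
      calc _ = B * β r ^ q * (2 ^ (-(r : ℝ)) * 2 ^ ((r : ℝ) + 1)) * σ R ^ (q / p) := by ring
        _ = _ := by rw [this]; ring
    rw [e1]
    have h0 : 0 ≤ 1 / q := by positivity
    have e2 : (2 * D) ^ q * sliceConst q * (2 * B * σ R ^ (q / p) * β r ^ q) =
        ((2 * D) ^ q * (2 * sliceConst q)) * B * σ R ^ (q / p) * β r ^ q := by ring
    rw [e2, ENNReal.mul_rpow_of_nonneg _ _ h0, ENNReal.mul_rpow_of_nonneg _ _ h0,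
      ENNReal.mul_rpow_of_nonneg _ _ h0, ENNReal.mul_rpow_of_nonneg _ _ h0, ← ENNReal.rpow_mul,
      ← ENNReal.rpow_mul, ← ENNReal.rpow_mul, mul_one_div_cancel hq0.ne', ENNReal.rpow_one,
      ENNReal.rpow_one]
    have : q / p * (1 / q) = 1 / p := by field_simp
    rw [this]
    ring
  calc _ ≤ ∑ r ∈ G.image lev,
        (2 * (2 * sliceConst q) ^ (1 / q) * D * B ^ (1 / q) * σ R ^ (1 / p)) * β r :=
        Finset.sum_le_sum fun r _ => hslice r
    _ ≤ (2 * (2 * sliceConst q) ^ (1 / q) * D * B ^ (1 / q) * σ R ^ (1 / p)) * ∑' r, β r := by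
        rw [← Finset.mul_sum]; gcongr; exact ENNReal.sum_le_tsum _
    _ = _ := by ring

end SepBump

/-! ### Cubes, dyadic grids, and domination of the kernel -/

namespace SepBump
variable {n : ℕ}

lemma measurableSet_cube (a : EuclideanSpace ℝ (Fin n)) (l : ℝ) : MeasurableSet (cube a l) := by
  have : cube a l = ⋂ i, (fun x : EuclideanSpace ℝ (Fin n) => x i) ⁻¹' Ico (a i) (a i + l) := by
    ext x; simp [cube]
  rw [this]
  exact MeasurableSet.iInter fun i => (by fun_prop : Measurable
    fun x : EuclideanSpace ℝ (Fin n) => x i) measurableSet_Ico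

lemma volume_cube (a : EuclideanSpace ℝ (Fin n)) (l : ℝ) :
    volume (cube a l) = ENNReal.ofReal l ^ n := by
  have h : cube a l = (MeasurableEquiv.toLp 2 (Fin n → ℝ)).symm ⁻¹'
      (Set.univ.pi fun i => Ico (a i) (a i + l)) := by
    ext x; simp [cube]
  rw [h, (EuclideanSpace.volume_preserving_symm_measurableEquiv_toLp (Fin n)).measure_preimage_equiv,
    Real.volume_pi_Ico]
  simp

/-- The cube of side length `2 ^ j` with index `m` in the dyadic grid with origin `v`. -/
def dcube (v : Fin n → ℝ) (j : ℤ) (m : Fin n → ℤ) : Set (EuclideanSpace ℝ (Fin n)) :=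
  cube (WithLp.toLp 2 fun i => v i + m i * 2 ^ j) (2 ^ j)

lemma mem_dcube {v : Fin n → ℝ} {j : ℤ} {m : Fin n → ℤ} {x : EuclideanSpace ℝ (Fin n)} :
    x ∈ dcube v j m ↔ ∀ i, ⌊(x i - v i) / 2 ^ j⌋ = m i := by
  have h2 : (0 : ℝ) < 2 ^ j := by positivity
  refine forall_congr' fun i => ?_
  rw [Int.floor_eq_iff, le_div_iff₀ h2, div_lt_iff₀ h2]
  simp only [mem_Ico]
  constructor <;> rintro ⟨h, h'⟩ <;> constructor <;> linarith

lemma volume_dcube (v : Fin n → ℝ) (j : ℤ) (m : Fin n → ℤ) :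
    volume (dcube v j m) = 2 ^ ((j : ℝ) * n) := by
  rw [dcube, volume_cube, ENNReal.rpow_mul, ENNReal.rpow_natCast, ENNReal.rpow_intCast]
  congr 1
  rw [← Real.rpow_intCast, ← ENNReal.ofReal_rpow_of_pos (by norm_num)]
  simp

/-- The integer part of s/2^k depends only on that of s/2^j when j ≤ k; this is the nestedness of
dyadic intervals. -/
lemma floor_div_zpow_congr {s t : ℝ} {j k : ℤ} (hjk : j ≤ k)
    (h : ⌊s / 2 ^ j⌋ = ⌊t / 2 ^ j⌋) : ⌊s / 2 ^ k⌋ = ⌊t / 2 ^ k⌋ := by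
  obtain ⟨d, rfl⟩ := Int.le.dest hjk
  have e : ∀ u : ℝ, u / 2 ^ (j + d) = u / 2 ^ j / ((2 ^ d : ℕ) : ℝ) := fun u => by
    rw [zpow_add₀ (by norm_num), div_div]; simp
  rw [e, e, Int.floor_div_natCast, Int.floor_div_natCast, h]

lemma dcube_subset_of_le {v : Fin n → ℝ} {j k : ℤ} (hjk : j ≤ k) {m m' : Fin n → ℤ}
    {x : EuclideanSpace ℝ (Fin n)} (hx : x ∈ dcube v j m) (hx' : x ∈ dcube v k m') :
    dcube v j m ⊆ dcube v k m' := by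
  intro y hy
  rw [mem_dcube] at *
  intro i
  rw [← hx' i]
  exact floor_div_zpow_congr hjk ((hy i).trans (hx i).symm)

/-- The cubes of side lengths `2 ^ j`, `|j| ≤ N`, with bounded index, in the grid with origin `v`. -/
def grid (v : Fin n → ℝ) (N : ℕ) : Finset (Set (EuclideanSpace ℝ (Fin n))) :=
  open Classical in
  ((Finset.Icc (-(N : ℤ)) N) ×ˢ
    Fintype.piFinset fun _ : Fin n => Finset.Icc (-(4 : ℤ) ^ (N + 1)) (4 ^ (N + 1))).image
    fun z => dcube v z.1 z.2

lemma mem_grid {v : Fin n → ℝ} {N : ℕ} {Q : Set (EuclideanSpace ℝ (Fin n))} :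
    Q ∈ grid v N ↔ ∃ j m, (-(N : ℤ) ≤ j ∧ j ≤ N) ∧
      (∀ i, -(4 : ℤ) ^ (N + 1) ≤ m i ∧ m i ≤ 4 ^ (N + 1)) ∧ dcube v j m = Q := by
  simp only [grid, Finset.mem_image, Finset.mem_product, Finset.mem_Icc, Fintype.mem_piFinset,
    Prod.exists, and_assoc]

lemma laminar_grid (v : Fin n → ℝ) (N : ℕ) : Laminar (grid v N) := by
  intro P hP Q hQ
  obtain ⟨j, m, -, -, rfl⟩ := mem_grid.1 hP
  obtain ⟨k, m', -, -, rfl⟩ := mem_grid.1 hQ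
  by_cases h : ∃ x, x ∈ dcube v j m ∧ x ∈ dcube v k m'
  · obtain ⟨x, hx, hx'⟩ := h
    rcases le_total j k with hjk | hjk
    · exact Or.inl (dcube_subset_of_le hjk hx hx')
    · exact Or.inr (Or.inl (dcube_subset_of_le hjk hx' hx))
  · exact Or.inr (Or.inr (Set.disjoint_left.2 fun x hx hx' => h ⟨x, hx, hx'⟩))

/-- The coefficient `|Q| ^ (α / n - 1)` of the fractional integral. -/
def fracCoeff (α : ℝ) (Q : Set (EuclideanSpace ℝ (Fin n))) : ℝ≥0∞ := volume Q ^ (α / n - 1)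

lemma fracCoeff_dcube (hn : n ≠ 0) (α : ℝ) (v : Fin n → ℝ) (j : ℤ) (m : Fin n → ℤ) :
    fracCoeff α (dcube v j m) = 2 ^ ((j : ℝ) * (α - n)) := by
  rw [fracCoeff, volume_dcube, ← ENNReal.rpow_mul]
  have : (n : ℝ) ≠ 0 := by exact_mod_cast hn
  congr 1; field_simp

lemma fracCoeff_mul_volume_dcube (hn : n ≠ 0) (α : ℝ) (v : Fin n → ℝ) (j : ℤ) (m : Fin n → ℤ) :
    fracCoeff α (dcube v j m) * volume (dcube v j m) = 2 ^ ((j : ℝ) * α) := by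
  rw [fracCoeff_dcube hn, volume_dcube, ← two_rpow_add]
  congr 1; ring

lemma good_volume_grid (v : Fin n → ℝ) (N : ℕ) : Good (grid v N) volume where
  meas Q hQ := by
    obtain ⟨j, m, -, -, rfl⟩ := mem_grid.1 hQ
    exact measurableSet_cube _ _
  ne_zero Q hQ := by
    obtain ⟨j, m, -, -, rfl⟩ := mem_grid.1 hQ
    rw [volume_dcube]; exact two_rpow_ne_zero _
  ne_top Q hQ := by
    obtain ⟨j, m, -, -, rfl⟩ := mem_grid.1 hQ
    rw [volume_dcube]; exact two_rpow_ne_top _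

/-- The coefficients of the cubes inside `P` that contain a point add up to a multiple of the
coefficient of `P`. -/
lemma sum_fracCoeff_mul_volume_le (hn : n ≠ 0) (α : ℝ) (v : Fin n → ℝ) (N : ℕ)
    {F : Finset (Set (EuclideanSpace ℝ (Fin n)))} (hF : F ⊆ grid v N)
    {P : Set (EuclideanSpace ℝ (Fin n))} (hP : P ∈ F) (x : EuclideanSpace ℝ (Fin n)) :
    ∑ Q ∈ F, {y | y ∈ Q ∧ Q ⊆ P}.indicator (fun _ => fracCoeff α Q * volume Q) x ≤
      geomConst α * (fracCoeff α P * volume P) := by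
  classical
  have hrep : ∀ Q : Set (EuclideanSpace ℝ (Fin n)), ∃ z : ℤ × (Fin n → ℤ),
      Q ∈ F → dcube v z.1 z.2 = Q := by
    -- The grid consists of bare sets, so a scale and an index are chosen for each member.
    intro Q
    by_cases hQ : Q ∈ F
    · obtain ⟨j, m, -, -, h⟩ := mem_grid.1 (hF hQ)
      exact ⟨(j, m), fun _ => h⟩
    · exact ⟨0, fun h => absurd h hQ⟩
  choose z hz using hrep
  have hcoeff : ∀ Q ∈ F, fracCoeff α Q * volume Q = 2 ^ (((z Q).1 : ℝ) * α) := fun Q hQ => by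
    rw [← fracCoeff_mul_volume_dcube hn α v (z Q).1 (z Q).2, hz Q hQ]
  simp only [indicator_apply]
  rw [← Finset.sum_filter, Finset.sum_congr rfl fun Q hQ => hcoeff Q (Finset.mem_filter.1 hQ).1,
    hcoeff P hP, mul_comm (geomConst α)]
  refine sum_geom_le _ (fun Q => (z Q).1) ?_ α (z P).1 ?_
  · intro Q hQ S hS h
    obtain ⟨hQ, hxQ, -⟩ := Finset.mem_filter.1 hQ
    obtain ⟨hS, hxS, -⟩ := Finset.mem_filter.1 hS
    simp only at h
    have h1 := hxQ
    have h2 := hxS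
    rw [← hz Q hQ] at h1
    rw [← hz S hS] at h2
    rw [← hz Q hQ, ← hz S hS]
    exact (dcube_subset_of_le h.le h1 h2).antisymm (dcube_subset_of_le h.ge h2 h1)
  · intro Q hQ
    obtain ⟨hQ, -, hQP⟩ := Finset.mem_filter.1 hQ
    have h := measure_mono (μ := volume) hQP
    rw [← hz Q hQ, ← hz P hP, volume_dcube, volume_dcube, two_rpow_le_iff] at h
    have : (0 : ℝ) < n := by exact_mod_cast Nat.pos_of_ne_zero hn
    exact_mod_cast le_of_mul_le_mul_right h this

/-! ### The shifted grids -/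

/-- If both grids separated s and t, integers a and b would satisfy |a - b - 2^k/3| < 1/3. Then 2^k
= 3(a - b), which is impossible because 3 does not divide a power of 2. -/
lemma floor_eq_or_floor_shift_eq {s t : ℝ} (h : |s - t| < 1 / 3) (k : ℕ) :
    ⌊s⌋ = ⌊t⌋ ∨ ⌊s - 2 ^ k / 3⌋ = ⌊t - 2 ^ k / 3⌋ := by
  wlog hst : s ≤ t generalizing s t
  · rcases this (by rwa [abs_sub_comm]) (le_of_not_ge hst) with h | h
    · exact Or.inl h.symm
    · exact Or.inr h.symm
  by_contra hcon
  push Not at hcon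
  have h1 : ⌊s⌋ < ⌊t⌋ := lt_of_le_of_ne (Int.floor_mono hst) hcon.1
  have h2 : ⌊s - 2 ^ k / 3⌋ < ⌊t - 2 ^ k / 3⌋ :=
    lt_of_le_of_ne (Int.floor_mono (by linarith)) hcon.2
  have a1 : s < ⌊t⌋ := Int.floor_lt.1 h1
  have a2 := Int.floor_le t
  have b1 : s - 2 ^ k / 3 < ⌊t - 2 ^ k / 3⌋ := Int.floor_lt.1 h2
  have b2 := Int.floor_le (t - 2 ^ k / 3)
  rw [abs_lt] at h
  set a := ⌊t⌋
  set b := ⌊t - 2 ^ k / 3⌋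
  have c1 : (2 : ℝ) ^ k < 3 * (a - b) + 1 := by linarith [h.1]
  have c2 : 3 * ((a : ℝ) - b) - 1 < 2 ^ k := by linarith [h.1]
  have d1 : (2 : ℤ) ^ k < 3 * (a - b) + 1 := by exact_mod_cast c1
  have d2 : 3 * (a - b) - 1 < (2 : ℤ) ^ k := by exact_mod_cast c2
  have d3 : (2 : ℤ) ^ k = 3 * (a - b) := by omega
  have : (3 : ℤ) ∣ 2 := Int.Prime.dvd_pow' (p := 3) Nat.prime_three ⟨a - b, d3⟩
  norm_num at this

/-- The origins of the shifted grids. -/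
def shift (N : ℕ) (θ : Fin n → Bool) (i : Fin n) : ℝ := if θ i then 2 ^ N / 3 else 0

lemma abs_shift_le (N : ℕ) (θ : Fin n → Bool) (i : Fin n) : |shift N θ i| ≤ 2 ^ N := by
  have : (0 : ℝ) < 2 ^ N := by positivity
  rw [shift]
  split_ifs
  · rw [abs_of_pos (by positivity)]; linarith
  · simp

/-- Measured at scale 2^j with j ≤ N, the origin 2^N/3 is 2^k/3 with k = N - j, so one origin serves
all scales of the grid. The choice between shifted and unshifted is made in each coordinate
separately, which accounts for 2^n grids. -/
lemma exists_shift_mem {N : ℕ} {j : ℤ} (hj : -(N : ℤ) ≤ j ∧ j ≤ N)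
    {x y : EuclideanSpace ℝ (Fin n)} (hxy : ∀ i, 3 * |x i - y i| < 2 ^ j)
    (hx : ∀ i, |x i| ≤ 2 ^ N) :
    ∃ θ : Fin n → Bool, ∃ Q ∈ grid (shift N θ) N, ∃ m, Q = dcube (shift N θ) j m ∧ x ∈ Q ∧ y ∈ Q := by
  have h2 : (0 : ℝ) < 2 ^ j := by positivity
  have hex : ∀ i, ∃ b : Bool, ⌊(x i - if b then (2 : ℝ) ^ N / 3 else 0) / 2 ^ j⌋ =
      ⌊(y i - if b then (2 : ℝ) ^ N / 3 else 0) / 2 ^ j⌋ := by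
    intro i
    obtain ⟨k, hk⟩ := Int.le.dest hj.2
    have hs : |x i / 2 ^ j - y i / 2 ^ j| < 1 / 3 := by
      rw [← sub_div, abs_div, abs_of_pos h2, div_lt_iff₀ h2]
      linarith [hxy i]
    have e : ∀ u : ℝ, (u - 2 ^ N / 3) / 2 ^ j = u / 2 ^ j - 2 ^ k / 3 := fun u => by
      have : (2 : ℝ) ^ N = 2 ^ j * 2 ^ k := by
        rw [← zpow_natCast, ← zpow_natCast, ← zpow_add₀ (by norm_num), hk]
      rw [this]; field_simp
    rcases floor_eq_or_floor_shift_eq hs k with h | h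
    · exact ⟨false, by simpa using h⟩
    · exact ⟨true, by simpa [e] using h⟩
  choose θ hθ using hex
  set m : Fin n → ℤ := fun i => ⌊(x i - shift N θ i) / 2 ^ j⌋ with hm
  refine ⟨θ, dcube (shift N θ) j m, mem_grid.2 ⟨j, m, hj, fun i => ?_, rfl⟩, m, rfl, ?_, ?_⟩
  · have hN : (0 : ℝ) < 2 ^ N := by positivity
    -- The numerator is at most 2 · 2^N and 2^j ≥ 2^(-N); this is why the indices of the grid run up
    -- to 4^(N + 1).
    have habs : |(x i - shift N θ i) / 2 ^ j| ≤ 2 * 4 ^ N := by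
      rw [abs_div, abs_of_pos h2, div_le_iff₀ h2]
      have h3 : |x i - shift N θ i| ≤ 2 * 2 ^ N := by
        have := abs_sub (x i) (shift N θ i)
        linarith [hx i, abs_shift_le N θ i]
      have h4 : (1 : ℝ) ≤ 2 ^ N * 2 ^ j := by
        rw [← zpow_natCast, ← zpow_add₀ (by norm_num)]
        exact one_le_zpow₀ (by norm_num) (by omega)
      have h5 : (4 : ℝ) ^ N = 2 ^ N * 2 ^ N := by rw [← mul_pow]; norm_num
      rw [h5]
      nlinarith [mul_le_mul_of_nonneg_left h4 hN.le]
    rw [abs_le] at habs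
    have h4 : (1 : ℝ) ≤ 4 ^ N := one_le_pow₀ (by norm_num)
    constructor
    · refine Int.le_floor.2 ?_
      push_cast
      rw [pow_succ]; linarith [habs.1]
    · have h6 : (⌊(x i - shift N θ i) / 2 ^ j⌋ : ℝ) ≤ 4 ^ (N + 1) := by
        refine (Int.floor_le _).trans ?_
        rw [pow_succ]; linarith [habs.2]
      exact_mod_cast h6
  · exact mem_dcube.2 fun i => rfl
  · exact mem_dcube.2 fun i => (hθ i).symm

lemma abs_apply_le_norm (x : EuclideanSpace ℝ (Fin n)) (i : Fin n) : |x i| ≤ ‖x‖ := by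
  simpa using PiLp.norm_apply_le x i

/-- The kernel of the fractional integral is dominated by the dyadic kernels. -/
lemma kernel_le_dyadic (hn : n ≠ 0) {α : ℝ} (hα : α < n) {x y : EuclideanSpace ℝ (Fin n)}
    (hxy : x ≠ y) : ∀ᶠ N : ℕ in Filter.atTop,
      ENNReal.ofReal (‖y - x‖ ^ ((n : ℝ) - α))⁻¹ ≤ 8 ^ (n - α) *
        ∑ θ : Fin n → Bool, ∑ Q ∈ grid (shift N θ) N,
          Q.indicator (fun _ => Q.indicator (fun _ => fracCoeff α Q) y) x := by
  set r := ‖y - x‖ with hr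
  have hr0 : 0 < r := norm_pos_iff.2 (sub_ne_zero.2 hxy.symm)
  obtain ⟨k, hk1, hk2⟩ := exists_mem_Ico_zpow (x := 3 * r) (y := (2 : ℝ)) (by positivity) (by norm_num)
  -- Now 3r < 2^j ≤ 6r: the lower bound lets one cube of side 2^j hold both points, and the upper
  -- one, relaxed to 8r, gives the constant 8^(n - α).
  set j := k + 1
  have hj6 : (2 : ℝ) ^ j ≤ 8 * r := by
    rw [zpow_add₀ (by norm_num), zpow_one]; linarith
  have hxyi : ∀ i, 3 * |x i - y i| < 2 ^ j := fun i => by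
    have h1 := abs_apply_le_norm (y - x) i
    rw [PiLp.sub_apply, abs_sub_comm] at h1
    linarith
  obtain ⟨N₀, hN₀⟩ := pow_unbounded_of_one_lt ‖x‖ (one_lt_two)
  filter_upwards [Filter.eventually_ge_atTop N₀, Filter.eventually_ge_atTop j.natAbs] with N hN1 hN2
  have hxN : ∀ i, |x i| ≤ 2 ^ N := fun i => (abs_apply_le_norm x i).trans
    (hN₀.le.trans (pow_le_pow_right₀ (by norm_num) hN1))
  obtain ⟨θ, Q, hQ, m, hQm, hxQ, hyQ⟩ := exists_shift_mem (N := N) (j := j) (by omega) hxyi hxN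
  have hpos : 0 < (n : ℝ) - α := by linarith
  calc ENNReal.ofReal (r ^ ((n : ℝ) - α))⁻¹ ≤ 8 ^ (n - α) * fracCoeff α Q := by
        rw [hQm, fracCoeff_dcube hn, ENNReal.ofReal_inv_of_pos (by positivity),
          ← ENNReal.ofReal_rpow_of_pos hr0]
        have h1 : (2 : ℝ≥0∞) ^ ((j : ℝ)) ≤ 8 * ENNReal.ofReal r := by
          have := ENNReal.ofReal_le_ofReal hj6
          rw [ENNReal.ofReal_mul (by norm_num), ← Real.rpow_intCast,
            ← ENNReal.ofReal_rpow_of_pos (by norm_num)] at this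
          simpa using this
        have h2 : ((8 : ℝ≥0∞) * ENNReal.ofReal r) ^ (-((n : ℝ) - α)) ≤ 2 ^ ((j : ℝ) * (α - n)) := by
          rw [show (j : ℝ) * (α - n) = j * (-((n : ℝ) - α)) by ring, ENNReal.rpow_mul,
            ENNReal.rpow_neg, ENNReal.rpow_neg]
          exact ENNReal.inv_le_inv.2 (ENNReal.rpow_le_rpow h1 hpos.le)
        calc (ENNReal.ofReal r ^ ((n : ℝ) - α))⁻¹
            = 8 ^ ((n : ℝ) - α) * (8 * ENNReal.ofReal r) ^ (-((n : ℝ) - α)) := by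
              rw [ENNReal.mul_rpow_of_ne_top (by simp) (by simp), ← mul_assoc,
                ← ENNReal.rpow_add _ _ (by norm_num) (by norm_num), add_neg_cancel,
                ENNReal.rpow_zero, one_mul, ENNReal.rpow_neg]
          _ ≤ _ := by gcongr
    _ ≤ _ := by
        gcongr
        refine le_trans ?_ (Finset.single_le_sum (f := fun θ : Fin n → Bool =>
          ∑ Q ∈ grid (shift N θ) N, Q.indicator (fun _ => Q.indicator (fun _ => fracCoeff α Q) y) x)
          (fun _ _ => zero_le) (Finset.mem_univ θ))
        refine le_trans ?_ (Finset.single_le_sum (f := fun Q : Set (EuclideanSpace ℝ (Fin n)) =>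
          Q.indicator (fun _ => Q.indicator (fun _ => fracCoeff α Q) y) x) (fun _ _ => zero_le) hQ)
        simp [hxQ, hyQ]

end SepBump

/-! ### The bump condition on grids and the passage to the fractional integral -/

namespace SepBump
variable {n : ℕ}

lemma IsWeight.aemeasurable {σ : EuclideanSpace ℝ (Fin n) → ℝ} (hσ : IsWeight σ) :
    AEMeasurable (fun x => ENNReal.ofReal (σ x)) volume :=
  hσ.locallyIntegrable.aestronglyMeasurable.aemeasurable.ennreal_ofReal

lemma IsWeight.enorm_eq {σ : EuclideanSpace ℝ (Fin n) → ℝ} (hσ : IsWeight σ)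
    (x : EuclideanSpace ℝ (Fin n)) : ‖σ x‖ₑ = ENNReal.ofReal (σ x) :=
  Real.enorm_of_nonneg (hσ.nonneg x)

lemma weightMeasure_cube_ne_top {σ : EuclideanSpace ℝ (Fin n) → ℝ} (hσ : IsWeight σ)
    (a : EuclideanSpace ℝ (Fin n)) (l : ℝ) : weightMeasure σ (cube a l) ≠ ⊤ := by
  have hK : IsCompact ((WithLp.toLp 2 : (Fin n → ℝ) → EuclideanSpace ℝ (Fin n)) ''
      (Set.univ.pi fun i => Icc (a i) (a i + l))) :=
    (isCompact_univ_pi fun i => isCompact_Icc).image (PiLp.continuous_toLp 2 _)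
  have hsub : cube a l ⊆ (WithLp.toLp 2 : (Fin n → ℝ) → EuclideanSpace ℝ (Fin n)) ''
      (Set.univ.pi fun i => Icc (a i) (a i + l)) := fun x hx =>
    ⟨x.ofLp, fun i _ => ⟨(hx i).1, (hx i).2.le⟩, rfl⟩
  have h := ((hσ.locallyIntegrable.integrableOn_isCompact hK).mono_set hsub).2
  rw [hasFiniteIntegral_iff_enorm] at h
  rw [weightMeasure, withDensity_apply _ (measurableSet_cube a l)]
  simpa only [hσ.enorm_eq] using h.ne

lemma le_fracMax (α : ℝ) {σ : EuclideanSpace ℝ (Fin n) → ℝ} (hσ : IsWeight σ)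
    {a : EuclideanSpace ℝ (Fin n)} {l : ℝ} (hl : 0 < l) {T : Set (EuclideanSpace ℝ (Fin n))}
    (hT : cube a l ⊆ T) {x : EuclideanSpace ℝ (Fin n)} (hx : x ∈ cube a l) :
    fracCoeff α (cube a l) * weightMeasure σ (cube a l) ≤ fracMax α (T.indicator σ) x := by
  have h : weightMeasure σ (cube a l) = ∫⁻ y in cube a l, ‖T.indicator σ y‖ₑ := by
    rw [weightMeasure, withDensity_apply _ (measurableSet_cube a l)]
    refine setLIntegral_congr_fun (measurableSet_cube a l) fun y hy => ?_
    simp only [indicator_of_mem (hT hy), hσ.enorm_eq]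
  rw [h]
  exact le_iSup_of_le a (le_iSup_of_le l (le_iSup_of_le hl (le_iSup_of_le hx le_rfl)))

/-- The constant that relates the testing condition to the separated bump. -/
def bumpTestConst (q : ℝ) (β : ℤ → ℝ≥0∞) : ℝ≥0∞ := 2 * (2 * sliceConst q) ^ (1 / q) * ∑' r, β r

lemma bumpTestConst_ne_top {q : ℝ} (hq : 0 < q) {β : ℤ → ℝ≥0∞} (hβ : ∑' r, β r ≠ ⊤) :
    bumpTestConst q β ≠ ⊤ :=
  ENNReal.mul_ne_top (ENNReal.mul_ne_top (by simp) (ENNReal.rpow_ne_top_of_nonneg (by positivity)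
    (ENNReal.mul_ne_top (by simp) (sliceConst_ne_top hq)))) hβ

/-- The maximal function of `testing_of_bump` is M_α(1_T σ); by the definition of ϱ its bound on T
is an equality, and D comes from the geometric sum of |Q|^(α/n). -/
lemma testing_of_sepBump (hn : n ≠ 0) {α p p' q : ℝ} (hp : p.HolderConjugate p')
    (hpq : p ≤ q) {ε : ℝ → ℝ} (hε : IsBumpFunction q ε) {β : ℤ → ℝ≥0∞}
    (hβ : ∀ (r : ℤ) (t : ℝ), (2 : ℝ) ^ r ≤ t → t < 2 ^ (r + 1) →
      ENNReal.ofReal (ε t) ^ (-(1 / q)) ≤ β r)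
    {σ w : EuclideanSpace ℝ (Fin n) → ℝ} (hσ : IsWeight σ)
    {v : Fin n → ℝ} {N : ℕ} {F : Finset (Set (EuclideanSpace ℝ (Fin n)))} (hF : F ⊆ grid v N)
    (hFσ : Good F (weightMeasure σ)) (hFw : Good F (weightMeasure w))
    (hfin : sepBump α p q ε σ w ≠ ⊤) :
    Testing F (fracCoeff α) (weightMeasure σ) (weightMeasure w) p q
      (bumpTestConst q β * geomConst α * sepBump α p q ε σ w ^ (1 / q)) := by
  have hq0 : 0 < q := hp.pos.trans_le hpq
  have hs : 0 < q / p := div_pos hq0 hp.pos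
  have hFμ : Good F volume := (good_volume_grid v N).mono hF
  have hcube : ∀ Q ∈ F, ∃ a l, 0 < l ∧ Q = cube a l := fun Q hQ => by
    obtain ⟨j, m, -, -, rfl⟩ := mem_grid.1 (hF hQ)
    exact ⟨_, _, by positivity, rfl⟩
  have hτ0 : ∀ Q ∈ F, fracCoeff α Q ≠ 0 := fun Q hQ => by
    obtain ⟨j, m, -, -, rfl⟩ := mem_grid.1 (hF hQ)
    rw [fracCoeff_dcube hn]; exact two_rpow_ne_zero _
  have hτt : ∀ Q ∈ F, fracCoeff α Q ≠ ⊤ := fun Q hQ => by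
    obtain ⟨j, m, -, -, rfl⟩ := mem_grid.1 (hF hQ)
    rw [fracCoeff_dcube hn]; exact two_rpow_ne_top _
  have hlM : ∀ T ∈ F, ∀ Q ∈ F, Q ⊆ T → ∀ x ∈ Q,
      fracCoeff α Q * weightMeasure σ Q ≤ fracMax α (T.indicator σ) x := by
    intro T _ Q hQ hQT x hx
    obtain ⟨a, l, hl, rfl⟩ := hcube Q hQ
    exact le_fracMax α hσ hl hQT hx
  have hpow0 : ∀ Q ∈ F, weightMeasure σ Q ^ (q / p) ≠ 0 := fun Q hQ => by
    simp [ENNReal.rpow_eq_zero_iff, hFσ.ne_zero Q hQ, hFσ.ne_top Q hQ]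
  have hpowt : ∀ Q ∈ F, weightMeasure σ Q ^ (q / p) ≠ ⊤ := fun Q hQ =>
    ENNReal.rpow_ne_top_of_nonneg hs.le (hFσ.ne_top Q hQ)
  have hρ0 : ∀ Q ∈ F, varrho α p q σ Q ≠ 0 := by
    intro Q hQ h
    rw [varrho, ENNReal.div_eq_zero_iff, or_iff_left (hpowt Q hQ)] at h
    have h1 : ∫⁻ _ in Q, (fracCoeff α Q * weightMeasure σ Q) ^ (q / p) ∂volume ≤
        ∫⁻ x in Q, fracMax α (Q.indicator σ) x ^ (q / p) :=
      setLIntegral_mono' (hFμ.meas Q hQ) fun x hx =>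
        ENNReal.rpow_le_rpow (hlM Q hQ Q hQ subset_rfl x hx) hs.le
    rw [h, setLIntegral_const, le_zero_iff, mul_eq_zero, or_iff_left (hFμ.ne_zero Q hQ),
      ENNReal.rpow_eq_zero_iff_of_pos hs, mul_eq_zero] at h1
    exact h1.elim (hτ0 Q hQ) (hFσ.ne_zero Q hQ)
  have hterm : ∀ Q ∈ F, (fracCoeff α Q * weightMeasure σ Q) ^ (q / p') *
      (weightMeasure w Q / volume Q) * timesBump ε (varrho α p q σ Q) ≤ sepBump α p q ε σ w := by
    intro Q hQ
    have e : volume Q ^ (α / n) * average σ Q = fracCoeff α Q * weightMeasure σ Q := by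
      rw [average, fracCoeff, ENNReal.rpow_sub _ _ (hFμ.ne_zero Q hQ) (hFμ.ne_top Q hQ),
        ENNReal.rpow_one, ENNReal.mul_comm_div]
    rw [← e, ← hp.conjExponent_eq]
    obtain ⟨a, l, hl, rfl⟩ := hcube Q hQ
    exact le_iSup_of_le a (le_iSup_of_le l (le_iSup_of_le hl le_rfl))
  -- If ϱ were infinite the bump would be infinite too, as both weights charge Q and the other
  -- factors are nonzero.
  have hρt : ∀ Q ∈ F, varrho α p q σ Q ≠ ⊤ := by
    intro Q hQ h
    have h1 := hterm Q hQ
    rw [timesBump, if_pos h, ENNReal.mul_top] at h1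
    · exact hfin (top_le_iff.1 h1)
    · refine mul_ne_zero ?_ ?_
      · refine (ENNReal.rpow_pos (pos_iff_ne_zero.2 (mul_ne_zero (hτ0 Q hQ) (hFσ.ne_zero Q hQ)))
          (ENNReal.mul_ne_top (hτt Q hQ) (hFσ.ne_top Q hQ))).ne'
      · simp [ENNReal.div_eq_zero_iff, hFw.ne_zero Q hQ, hFμ.ne_top Q hQ]
  obtain ⟨m, hm, hmε⟩ := hε.pos
  have h := testing_of_bump ((laminar_grid v N).mono hF) hFμ hFσ hτ0 hτt hp hpq
    (w := weightMeasure w) (fun t ht => hm.trans_le (hmε t ht)) hβ (B := sepBump α p q ε σ w)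
    (D := geomConst α)
    (fun P hP x => sum_fracCoeff_mul_volume_le hn α v N hF hP x) hρ0 hρt
    (fun Q hQ => by
      have := hterm Q hQ
      rwa [timesBump, if_neg (hρt Q hQ)] at this)
    (M := fun T => fracMax α (T.indicator σ)) hlM
    (fun T hT => by
      rw [varrho, ENNReal.div_mul_cancel (hpow0 T hT) (hpowt T hT)])
  exact h

/-- Cubes with σ(Q) = 0 contribute nothing to the operator, and those with w(Q) = 0 only affect a
w-null set; removing both gives a family to which the testing theorem applies. -/
lemma dyadicOp_grid_bound (hn : n ≠ 0) {α p p' q q' : ℝ} (hp : p.HolderConjugate p')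
    (hq : q.HolderConjugate q') (hpq : p ≤ q) {εq εp' : ℝ → ℝ} (hεq : IsBumpFunction q εq)
    (hεp' : IsBumpFunction p' εp') {β β' : ℤ → ℝ≥0∞}
    (hβ : ∀ (r : ℤ) (t : ℝ), (2 : ℝ) ^ r ≤ t → t < 2 ^ (r + 1) →
      ENNReal.ofReal (εq t) ^ (-(1 / q)) ≤ β r)
    (hβ' : ∀ (r : ℤ) (t : ℝ), (2 : ℝ) ^ r ≤ t → t < 2 ^ (r + 1) →
      ENNReal.ofReal (εp' t) ^ (-(1 / p')) ≤ β' r)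
    {σ w : EuclideanSpace ℝ (Fin n) → ℝ} (hσ : IsWeight σ) (hw : IsWeight w)
    (h1 : sepBump α p q εq σ w ≠ ⊤) (h2 : sepBump α q' p' εp' w σ ≠ ⊤)
    (v : Fin n → ℝ) (N : ℕ) {f : EuclideanSpace ℝ (Fin n) → ℝ≥0∞} (hf : Measurable f)
    (hft : ∫⁻ x, f x ^ p ∂(weightMeasure σ) ≠ ⊤) :
    (∫⁻ x, dyadicOp (grid v N) (fracCoeff α) (weightMeasure σ) f x ^ q ∂(weightMeasure w)) ^ (1 / q)
      ≤ testingConst p q * (bumpTestConst q β * geomConst α * sepBump α p q εq σ w ^ (1 / q) +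
          bumpTestConst p' β' * geomConst α * sepBump α q' p' εp' w σ ^ (1 / p')) *
        (∫⁻ x, f x ^ p ∂(weightMeasure σ)) ^ (1 / p) := by
  classical
  set F := (grid v N).filter (fun Q => weightMeasure σ Q ≠ 0 ∧ weightMeasure w Q ≠ 0) with hF
  have hFg : F ⊆ grid v N := Finset.filter_subset _ _
  have hfin : ∀ {u : EuclideanSpace ℝ (Fin n) → ℝ}, IsWeight u → ∀ Q ∈ F, weightMeasure u Q ≠ ⊤ := by
    intro u hu Q hQ
    obtain ⟨j, m, -, -, rfl⟩ := mem_grid.1 (hFg hQ)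
    exact weightMeasure_cube_ne_top hu _ _
  have hFσ : Good F (weightMeasure σ) :=
    ⟨fun Q hQ => (good_volume_grid v N).meas Q (hFg hQ),
      fun Q hQ => (Finset.mem_filter.1 hQ).2.1, hfin hσ⟩
  have hFw : Good F (weightMeasure w) :=
    ⟨fun Q hQ => (good_volume_grid v N).meas Q (hFg hQ),
      fun Q hQ => (Finset.mem_filter.1 hQ).2.2, hfin hw⟩
  have hae : ∀ᵐ x ∂(weightMeasure w), dyadicOp (grid v N) (fracCoeff α) (weightMeasure σ) f x =
      dyadicOp F (fracCoeff α) (weightMeasure σ) f x := by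
    have hz : ∀ᵐ x ∂(weightMeasure w), ∀ Q ∈ grid v N, weightMeasure w Q = 0 → x ∉ Q := by
      rw [Finset.eventually_all]
      intro Q _
      by_cases h : weightMeasure w Q = 0
      · filter_upwards [measure_eq_zero_iff_ae_notMem.1 h] with x hx _ using hx
      · exact Filter.Eventually.of_forall fun x h' => absurd h' h
    filter_upwards [hz] with x hx
    rw [dyadicOp, dyadicOp, hF, Finset.sum_filter_of_ne]
    intro Q hQ hne
    have hxQ : x ∈ Q := by
      by_contra h
      exact hne (indicator_of_notMem h _)
    refine ⟨fun h => hne ?_, fun h => hx Q hQ h hxQ⟩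
    rw [indicator_of_mem hxQ, setLIntegral_measure_zero _ _ h, mul_zero]
  rw [lintegral_congr_ae (hae.mono fun x hx => by rw [hx])]
  have hq'p' : q' ≤ p' := by
    have := holder_exponents hp hq hpq
    rwa [one_le_div hq.symm.pos] at this
  exact dyadicOp_bound ((laminar_grid v N).mono hFg) hFσ hFw (fun Q hQ => by
      obtain ⟨j, m, -, -, rfl⟩ := mem_grid.1 (hFg hQ)
      rw [fracCoeff_dcube hn]; exact two_rpow_ne_top _) hp hq hpq hf hft
    (testing_of_sepBump hn hp hpq hεq hβ hσ hFg hFσ hFw h1)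
    (testing_of_sepBump hn hq.symm hq'p' hεp' hβ' hw hFg hFw hFσ h2)

/-- The fractional integral of a non-negative function, as an extended non-negative number. -/
def fracPot (α : ℝ) (σ : Measure (EuclideanSpace ℝ (Fin n))) (f : EuclideanSpace ℝ (Fin n) → ℝ≥0∞)
    (x : EuclideanSpace ℝ (Fin n)) : ℝ≥0∞ :=
  ∫⁻ y, ENNReal.ofReal (‖y - x‖ ^ ((n : ℝ) - α))⁻¹ * f y ∂σ

/-- The grids are not nested in N, so monotone convergence is not available; the eventual domination
of the kernel is combined with Fatou's lemma. -/
lemma fracPot_le_liminf (hn : n ≠ 0) {α : ℝ} (hα : α < n) (σ : Measure (EuclideanSpace ℝ (Fin n)))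
    {f : EuclideanSpace ℝ (Fin n) → ℝ≥0∞} (hf : Measurable f) (x : EuclideanSpace ℝ (Fin n)) :
    fracPot α σ f x ≤ Filter.liminf (fun N : ℕ => 8 ^ (n - α) * ∑ θ : Fin n → Bool,
      dyadicOp (grid (shift N θ) N) (fracCoeff α) σ f x) Filter.atTop := by
  set g : ℕ → EuclideanSpace ℝ (Fin n) → ℝ≥0∞ := fun N y => (8 ^ (n - α) *
        ∑ θ : Fin n → Bool, ∑ Q ∈ grid (shift N θ) N,
          Q.indicator (fun _ => Q.indicator (fun _ => fracCoeff α Q) y) x) * f y with hg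
  have hmeas : ∀ N (θ : Fin n → Bool), ∀ Q ∈ grid (shift N θ) N, Measurable
      fun y => Q.indicator (fun _ => Q.indicator (fun _ => fracCoeff α Q) y) x := by
    intro N θ Q hQ
    by_cases hx : x ∈ Q
    · simp only [indicator_of_mem hx]
      exact measurable_const.indicator ((good_volume_grid _ _).meas Q hQ)
    · simp only [indicator_of_notMem hx]
      exact measurable_const
  have hgm : ∀ N, Measurable (g N) := fun N =>
    ((Finset.measurable_sum _ fun θ _ => Finset.measurable_sum _ (hmeas N θ)).const_mul _).mul hf
  have hint : ∀ N, ∫⁻ y, g N y ∂σ = 8 ^ (n - α) * ∑ θ : Fin n → Bool,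
      dyadicOp (grid (shift N θ) N) (fracCoeff α) σ f x := by
    intro N
    simp only [hg, mul_assoc, Finset.sum_mul]
    have hmf : ∀ (θ : Fin n → Bool), ∀ Q ∈ grid (shift N θ) N, Measurable
        fun y => Q.indicator (fun _ => Q.indicator (fun _ => fracCoeff α Q) y) x * f y :=
      fun θ Q hQ => (hmeas N θ Q hQ).mul hf
    rw [lintegral_const_mul _ (Finset.measurable_sum _ fun θ _ => Finset.measurable_sum _ (hmf θ)),
      lintegral_finsetSum _ fun θ _ => Finset.measurable_sum _ (hmf θ)]
    congr 1
    refine Finset.sum_congr rfl fun θ _ => ?_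
    rw [lintegral_finsetSum _ (hmf θ), dyadicOp]
    refine Finset.sum_congr rfl fun Q hQ => ?_
    by_cases hx : x ∈ Q
    · simp only [indicator_of_mem hx]
      rw [← lintegral_const_mul _ hf, ← lintegral_indicator ((good_volume_grid _ _).meas Q hQ)]
      refine lintegral_congr fun y => ?_
      by_cases hy : y ∈ Q <;> simp [hy]
    · simp [hx]
  simp only [← hint]
  refine le_trans (lintegral_mono fun y => ?_) (lintegral_liminf_le hgm)
  -- On the diagonal the kernel is 0, being the inverse of 0 in the reals.
  rcases eq_or_ne x y with rfl | hxy
  · have : ((n : ℝ) - α) ≠ 0 := by linarith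
    simp [Real.zero_rpow this]
  · refine Filter.le_liminf_of_le (by isBoundedDefault) ?_
    filter_upwards [kernel_le_dyadic hn hα hxy] with N hN
    exact mul_le_mul' hN le_rfl

/-- Fatou's lemma with respect to w, then Minkowski's inequality over the 2^n grids. -/
lemma fracPot_bound (hn : n ≠ 0) {α : ℝ} (hα : α < n) {σ w : Measure (EuclideanSpace ℝ (Fin n))}
    {f : EuclideanSpace ℝ (Fin n) → ℝ≥0∞} (hf : Measurable f) {q : ℝ} (hq : 1 ≤ q) {B : ℝ≥0∞}
    (hB : ∀ (v : Fin n → ℝ) (N : ℕ),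
      (∫⁻ x, dyadicOp (grid v N) (fracCoeff α) σ f x ^ q ∂w) ^ (1 / q) ≤ B) :
    (∫⁻ x, fracPot α σ f x ^ q ∂w) ^ (1 / q) ≤ 8 ^ (n - α) * 2 ^ n * B := by
  have hq0 : 0 < q := by linarith
  set U : ℕ → EuclideanSpace ℝ (Fin n) → ℝ≥0∞ := fun N x => ∑ θ : Fin n → Bool,
      dyadicOp (grid (shift N θ) N) (fracCoeff α) σ f x with hU
  have hdm : ∀ v N, Measurable (dyadicOp (grid v N) (fracCoeff α) σ f) := fun v N =>
    measurable_dyadicOp (good_volume_grid v N).meas _ _ _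
  have hUm : ∀ N, Measurable (U N) := fun N => Finset.measurable_sum _ fun θ _ => hdm _ _
  have hUB : ∀ N, ∫⁻ x, (8 ^ (n - α) * U N x) ^ q ∂w ≤ (8 ^ (n - α) * 2 ^ n * B) ^ q := by
    intro N
    simp only [ENNReal.mul_rpow_of_nonneg _ _ hq0.le]
    rw [lintegral_const_mul _ ((hUm N).pow_const q), ← ENNReal.mul_rpow_of_nonneg _ _ hq0.le,
      ← ENNReal.mul_rpow_of_nonneg _ _ hq0.le, mul_assoc, ENNReal.mul_rpow_of_nonneg _ _ hq0.le]
    gcongr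
    have h := lintegral_Lp_finsetSum_le Finset.univ (fun θ : Fin n → Bool =>
      dyadicOp (grid (shift N θ) N) (fracCoeff α) σ f) w (fun θ _ => hdm _ _) hq
    have h' : (∫⁻ x, U N x ^ q ∂w) ^ (1 / q) ≤ 2 ^ n * B := by
      refine h.trans ((Finset.sum_le_sum fun θ _ => hB (shift N θ) N).trans ?_)
      simp
    have h'' := ENNReal.rpow_le_rpow h' hq0.le
    rwa [← ENNReal.rpow_mul, one_div_mul_cancel hq0.ne', ENNReal.rpow_one] at h''
  have key : ∫⁻ x, fracPot α σ f x ^ q ∂w ≤ (8 ^ (n - α) * 2 ^ n * B) ^ q := by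
    calc ∫⁻ x, fracPot α σ f x ^ q ∂w
        ≤ ∫⁻ x, Filter.liminf (fun N : ℕ => (8 ^ (n - α) * U N x) ^ q) Filter.atTop ∂w := by
          refine lintegral_mono fun x => ?_
          refine (ENNReal.rpow_le_rpow (fracPot_le_liminf hn hα σ hf x) hq0.le).trans (le_of_eq ?_)
          exact (ENNReal.orderIsoRpow q hq0).liminf_apply
      _ ≤ Filter.liminf (fun N : ℕ => ∫⁻ x, (8 ^ (n - α) * U N x) ^ q ∂w) Filter.atTop :=
          lintegral_liminf_le fun N => ((hUm N).const_mul _).pow_const q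
      _ ≤ Filter.liminf (fun _ : ℕ => (8 ^ (n - α) * 2 ^ n * B) ^ q) Filter.atTop :=
          Filter.liminf_le_liminf (Filter.Eventually.of_forall hUB)
      _ = _ := Filter.liminf_const _
  have := ENNReal.rpow_le_rpow key (one_div_nonneg.2 hq0.le)
  rwa [← ENNReal.rpow_mul, mul_one_div_cancel hq0.ne', ENNReal.rpow_one] at this

end SepBump

/-! ### Complex-valued functions, absolute convergence and measurability -/

namespace SepBump
variable {n : ℕ}

lemma measurable_fracPot (α : ℝ) (σ : Measure (EuclideanSpace ℝ (Fin n))) [SFinite σ]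
    {f : EuclideanSpace ℝ (Fin n) → ℝ≥0∞} (hf : Measurable f) : Measurable (fracPot α σ f) := by
  refine Measurable.lintegral_prod_right' (f := fun z : EuclideanSpace ℝ (Fin n) ×
    EuclideanSpace ℝ (Fin n) => ENNReal.ofReal (‖z.2 - z.1‖ ^ ((n : ℝ) - α))⁻¹ * f z.2) ?_
  fun_prop

lemma enorm_fracKernel (α : ℝ) (f : EuclideanSpace ℝ (Fin n) → ℂ) (x y : EuclideanSpace ℝ (Fin n)) :
    ‖fracKernel α f x y‖ₑ = ENNReal.ofReal (‖y - x‖ ^ ((n : ℝ) - α))⁻¹ * ‖f y‖ₑ := by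
  have h : 0 ≤ ‖y - x‖ ^ ((n : ℝ) - α) := Real.rpow_nonneg (norm_nonneg _) _
  rw [fracKernel, div_eq_mul_inv, enorm_mul, mul_comm, ← Complex.ofReal_inv]
  congr 1
  rw [← Real.enorm_of_nonneg (inv_nonneg.2 h), ← ofReal_norm, ← ofReal_norm,
    Complex.norm_real]

/-- The function f and the weight σ are replaced by measurable representatives. This changes the
integrand only on a null set of y, hence the fractional integral at no x at all. The potential of
|f| then bounds the norm, and its w-a.e. finiteness is the absolute convergence. -/
lemma isBound_of_fracPot {α p q : ℝ} (hp : 0 < p) (hq : 0 < q)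
    {σ w : EuclideanSpace ℝ (Fin n) → ℝ} (hσ : IsWeight σ) {B : ℝ≥0∞} (hBt : B ≠ ⊤)
    (hB : ∀ f : EuclideanSpace ℝ (Fin n) → ℝ≥0∞, Measurable f →
      ∫⁻ x, f x ^ p ∂(weightMeasure σ) ≠ ⊤ →
      (∫⁻ x, fracPot α (weightMeasure σ) f x ^ q ∂(weightMeasure w)) ^ (1 / q) ≤
        B * (∫⁻ x, f x ^ p ∂(weightMeasure σ)) ^ (1 / p)) :
    IsBound α p q σ w B := by
  intro f hf
  set f' := hf.1.mk f with hf'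
  have hf'm : StronglyMeasurable f' := hf.1.stronglyMeasurable_mk
  have hff' : f =ᵐ[weightMeasure σ] f' := hf.1.ae_eq_mk
  have hpne : ENNReal.ofReal p ≠ 0 := by simpa using hp
  have hqne : ENNReal.ofReal q ≠ 0 := by simpa using hq
  have hLp : eLpNorm f (ENNReal.ofReal p) (weightMeasure σ) =
      (∫⁻ x, ‖f' x‖ₑ ^ p ∂(weightMeasure σ)) ^ (1 / p) := by
    rw [eLpNorm_congr_ae hff', eLpNorm_eq_lintegral_rpow_enorm_toReal hpne ENNReal.ofReal_ne_top,
      ENNReal.toReal_ofReal hp.le]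
  have hft : ∫⁻ x, ‖f' x‖ₑ ^ p ∂(weightMeasure σ) ≠ ⊤ := by
    intro h
    have := hf.2
    rw [hLp, h, ENNReal.top_rpow_of_pos (by positivity)] at this
    exact lt_irrefl _ this
  set P := fracPot α (weightMeasure σ) (fun x => ‖f' x‖ₑ) with hP
  have hPm : Measurable P := by
    have : SFinite (weightMeasure σ) := by unfold weightMeasure; infer_instance
    exact measurable_fracPot α _ hf'm.enorm
  have hPB := hB (fun x => ‖f' x‖ₑ) hf'm.enorm hft
  rw [← hLp] at hPB
  have hσm := hσ.locallyIntegrable.aestronglyMeasurable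
  set h : EuclideanSpace ℝ (Fin n) → ℂ := fun y => ((hσm.mk σ y : ℝ) : ℂ) * f' y with hh
  have hhm : StronglyMeasurable h :=
    (Complex.continuous_ofReal.comp_stronglyMeasurable hσm.stronglyMeasurable_mk).mul hf'm
  have hfh : ∀ᵐ y, (σ y : ℂ) * f y = h y := by
    have h1 := hff'
    rw [Filter.EventuallyEq, weightMeasure, ae_withDensity_iff' hσ.aemeasurable] at h1
    filter_upwards [h1, hσm.ae_eq_mk] with y hy1 hy2
    rw [hh]
    simp only [← hy2]
    -- The representative of f agrees with f only almost everywhere for σ(y) dy; where σ vanishes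
    -- both products are 0.
    by_cases h0 : σ y = 0
    · simp [h0]
    · rw [hy1 (by simpa using lt_of_le_of_ne (hσ.nonneg y) (Ne.symm h0))]
  have hker : ∀ x, fracKernel α (fun y => (σ y : ℂ) * f y) x =ᵐ[volume] fracKernel α h x := fun x =>
    hfh.mono fun y hy => by simp only [fracKernel, hy]
  have hkm : StronglyMeasurable (Function.uncurry (fracKernel α h)) := by
    have e : Function.uncurry (fracKernel α h) = fun z : EuclideanSpace ℝ (Fin n) ×
        EuclideanSpace ℝ (Fin n) => h z.2 / ((‖z.2 - z.1‖ ^ ((n : ℝ) - α) : ℝ) : ℂ) := rfl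
    rw [e]
    have h1 : Measurable h := hhm.measurable
    exact Measurable.stronglyMeasurable (by fun_prop)
  have hPint : ∀ x, ∫⁻ y, ‖fracKernel α h x y‖ₑ = P x := by
    intro x
    have hg : AEMeasurable (fun y => ENNReal.ofReal (‖y - x‖ ^ ((n : ℝ) - α))⁻¹ * ‖f' y‖ₑ) volume := by
      have := hf'm.enorm
      fun_prop
    rw [hP, fracPot, weightMeasure, lintegral_withDensity_eq_lintegral_mul₀ hσ.aemeasurable hg]
    refine lintegral_congr_ae (hσm.ae_eq_mk.mono fun y hy => ?_)
    simp only [Pi.mul_apply, enorm_fracKernel, hh, ← hy, enorm_mul]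
    have : ‖((σ y : ℝ) : ℂ)‖ₑ = ENNReal.ofReal (σ y) := by
      rw [← hσ.enorm_eq, ← ofReal_norm, ← ofReal_norm, Complex.norm_real]
    rw [this]; ring
  have hfrac : fracInt α (fun y => (σ y : ℂ) * f y) = fracInt α h := by
    funext x
    exact integral_congr_ae (hker x)
  refine ⟨?_, ?_, ?_⟩
  · have hfin : ∫⁻ x, P x ^ q ∂(weightMeasure w) ≠ ⊤ := by
      intro htop
      rw [htop, ENNReal.top_rpow_of_pos (by positivity)] at hPB
      exact ENNReal.mul_ne_top hBt hf.2.ne (top_le_iff.1 hPB)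
    filter_upwards [ae_lt_top (hPm.pow_const q) hfin] with x hx
    have hPx : P x < ⊤ := by
      by_contra hcon
      rw [not_lt_top_iff] at hcon
      rw [hcon, ENNReal.top_rpow_of_pos hq] at hx
      exact lt_irrefl _ hx
    refine Integrable.congr (f := fracKernel α h x) ⟨?_, ?_⟩ (hker x).symm
    · exact (hkm.comp_measurable measurable_prodMk_left).aestronglyMeasurable
    · rw [hasFiniteIntegral_iff_enorm, hPint]; exact hPx
  · rw [hfrac]
    exact (StronglyMeasurable.integral_prod_right hkm).aestronglyMeasurable
  · rw [hfrac, eLpNorm_eq_lintegral_rpow_enorm_toReal hqne ENNReal.ofReal_ne_top,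
      ENNReal.toReal_ofReal hq.le]
    refine le_trans (ENNReal.rpow_le_rpow (lintegral_mono fun x => ENNReal.rpow_le_rpow ?_ hq.le)
      (by positivity)) hPB
    exact (enorm_integral_le_lintegral_enorm _).trans (hPint x).le

end SepBump

end

/-! ### The main theorem -/

theorem theorem1p4 :
    ∃ C : ℕ → ℝ → ℝ≥0, ∀ (p q : ℝ), 1 < p → p ≤ q → ∀ (εq εp' : ℝ → ℝ),
      SepBump.IsBumpFunction q εq → SepBump.IsBumpFunction p.conjExponent εp' →
      ∃ K : ℝ≥0, ∀ (n : ℕ) (α : ℝ), 0 < α → α < n →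
        ∀ (σ w : EuclideanSpace ℝ (Fin n) → ℝ), SepBump.IsWeight σ → SepBump.IsWeight w →
          SepBump.fracIntNorm α p q σ w ≤
            (K : ℝ≥0∞) * (C n α : ℝ≥0∞) *
              (SepBump.sepBump α p q εq σ w ^ (1 / q) +
                SepBump.sepBump α q.conjExponent p.conjExponent εp' w σ
                  ^ (1 / p.conjExponent)) := by
  -- C collects the kernel domination, the number of grids and the geometric sum over scales. The
  -- added 1, here and in K, keeps the constants positive, so that an infinite bump gives an
  -- infinite right-hand side rather than 0 · ∞ = 0.
  refine ⟨fun n α => ((8 : ℝ≥0∞) ^ (n - α) * 2 ^ n * SepBump.geomConst α).toNNReal + 1, ?_⟩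
  intro p q hp1 hpq εq εp' hεq hεp'
  have hp := Real.HolderConjugate.conjExponent hp1
  have hq := Real.HolderConjugate.conjExponent (hp1.trans_le hpq)
  obtain ⟨β, hβsum, hβ⟩ := SepBump.exists_bumpWeight hq.pos hεq
  obtain ⟨β', hβsum', hβ'⟩ := SepBump.exists_bumpWeight hp.symm.pos hεp'
  set k₁ := SepBump.bumpTestConst q β
  set k₂ := SepBump.bumpTestConst p.conjExponent β'
  have hk₁ : k₁ ≠ ⊤ := SepBump.bumpTestConst_ne_top hq.pos hβsum
  have hk₂ : k₂ ≠ ⊤ := SepBump.bumpTestConst_ne_top hp.symm.pos hβsum'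
  refine ⟨(SepBump.testingConst p q * (k₁ + k₂)).toNNReal + 1, ?_⟩
  intro n α hα hαn σ w hσ hw
  have hn : n ≠ 0 := by
    rintro rfl
    rw [Nat.cast_zero] at hαn
    linarith
  set A := SepBump.sepBump α p q εq σ w
  set B := SepBump.sepBump α q.conjExponent p.conjExponent εp' w σ
  have hpc : 0 < 1 / p.conjExponent := one_div_pos.2 hp.symm.pos
  have hqc : 0 < 1 / q := one_div_pos.2 hq.pos
  have hC : (8 : ℝ≥0∞) ^ (n - α) * 2 ^ n * SepBump.geomConst α ≠ ⊤ :=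
    ENNReal.mul_ne_top (ENNReal.mul_ne_top (ENNReal.rpow_ne_top_of_nonneg (by linarith) (by simp))
      (by simp)) (SepBump.geomConst_ne_top hα)
  have hK : SepBump.testingConst p q * (k₁ + k₂) ≠ ⊤ :=
    ENNReal.mul_ne_top (SepBump.testingConst_ne_top hp1 hq.lt) (ENNReal.add_ne_top.2 ⟨hk₁, hk₂⟩)
  have hC' : (8 : ℝ≥0∞) ^ (n - α) * 2 ^ n * SepBump.geomConst α ≤
      ((((8 : ℝ≥0∞) ^ (n - α) * 2 ^ n * SepBump.geomConst α).toNNReal + 1 : ℝ≥0) : ℝ≥0∞) := by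
    rw [ENNReal.coe_add, ENNReal.coe_toNNReal hC]; exact le_self_add
  have hK' : SepBump.testingConst p q * (k₁ + k₂) ≤
      (((SepBump.testingConst p q * (k₁ + k₂)).toNNReal + 1 : ℝ≥0) : ℝ≥0∞) := by
    rw [ENNReal.coe_add, ENNReal.coe_toNNReal hK]; exact le_self_add
  by_cases htop : A = ⊤ ∨ B = ⊤
  · have : A ^ (1 / q) + B ^ (1 / p.conjExponent) = ⊤ := by
      rcases htop with h | h
      · rw [h, ENNReal.top_rpow_of_pos hqc, top_add]
      · rw [h, ENNReal.top_rpow_of_pos hpc, add_top]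
    rw [this, ENNReal.mul_top]
    · exact le_top
    · rw [← ENNReal.coe_mul]
      exact_mod_cast (by positivity : (0 : ℝ≥0) < _).ne'
  push Not at htop
  have hAB : A ^ (1 / q) + B ^ (1 / p.conjExponent) ≠ ⊤ :=
    ENNReal.add_ne_top.2 ⟨ENNReal.rpow_ne_top_of_nonneg hqc.le htop.1,
      ENNReal.rpow_ne_top_of_nonneg hpc.le htop.2⟩
  refine sInf_le (SepBump.isBound_of_fracPot hp.pos hq.pos hσ
    (ENNReal.mul_ne_top (ENNReal.mul_ne_top ENNReal.coe_ne_top ENNReal.coe_ne_top) hAB)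
    fun f hf hft => ?_)
  refine (SepBump.fracPot_bound hn hαn hf hq.lt.le fun v N =>
    SepBump.dyadicOp_grid_bound hn hp hq hpq hεq hεp' hβ hβ' hσ hw htop.1 htop.2 v N hf hft).trans ?_
  refine (mul_assoc _ _ _).symm.le.trans (mul_le_mul' ?_ le_rfl)
  set G := SepBump.geomConst α
  set S := A ^ (1 / q)
  set T := B ^ (1 / p.conjExponent)
  calc (8 : ℝ≥0∞) ^ (n - α) * 2 ^ n * (SepBump.testingConst p q * (k₁ * G * S + k₂ * G * T))
      ≤ (8 : ℝ≥0∞) ^ (n - α) * 2 ^ n * (SepBump.testingConst p q *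
          ((k₁ + k₂) * G * S + (k₁ + k₂) * G * T)) := by
        gcongr
        · exact le_self_add
        · exact le_add_self
    _ = (SepBump.testingConst p q * (k₁ + k₂)) * ((8 : ℝ≥0∞) ^ (n - α) * 2 ^ n * G) * (S + T) := by
        ring
    _ ≤ _ := by gcongr
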